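/- Let $\Phi:\mathbb C\to\mathbb R$ be a $C^2$-smooth function such that for every $A>0$ there is a constant $C_A$ with $\Phi(z)\ge A\log|z|-C_A$ for all $z\in\mathbb C\setminus\{0\}$. Fix $\tau>0$ and put $\theta=1/(2\tau)$ and, for each integer $N\ge 2$, $\beta=\beta_N=(N-1)/\tau$. Let $d\mu_{\beta,\Phi}(z)=e^{-\beta\Phi(z)}\,d\lambda_2(z)$, where $\lambda_2$ is Lebesgue measure on $\mathbb C$, let $\triangle(z_1,\dots,z_N)=\prod_{1\le j<k\le N}(z_j-z_k)$, and for $1\le n\le N$ define the $n$-point marginal distribution on $\mathbb C^n$ by $$d\Pi^{(n)}_{N,\beta,\Phi}(z_1,\dots,z_n)=\frac1{Z_N}\Big\{\int_{\mathbb C^{N-n}}|\triangle(z_1,\dots,z_N)|^2\,d\mu_{\beta,\Phi}(z_{n+1})\cdots d\mu_{\beta,\Phi}(z_N)\Big\}\,d\mu_{\beta,\Phi}(z_1)\cdots d\mu_{\beta,\Phi}(z_n),$$ $$Z_N=\int_{\mathbb C^N}|\triangle(z_1,\dots,z_N)|^2\,d\mu_{\beta,\Phi}(z_1)\cdots d\mu_{\beta,\Phi}(z_N).$$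 Let $E(z,w)=|z-w|\,e^{-\theta[\Phi(z)+\Phi(w)]}$, with $\log\frac1{E(z,w)}=+\infty$ if $z=w$. For a compactly supported Borel probability measure $\sigma$ on $\mathbb C$ let $$\mathcal E[\sigma]=\iint_{\mathbb C^2}\log\frac1{E(z,w)}\,d\sigma(z)\,d\sigma(w)\in(-\infty,+\infty],$$ and let $\kappa=\inf_\sigma\mathcal E[\sigma]$ over all such $\sigma$. Then there is exactly one compactly supported Borel probability measure $\widehat\sigma$ with $\mathcal E[\widehat\sigma]=\kappa$ (the extremal, or weighted equilibrium, measure), and there is a compact set $K\subset\mathbb C$ such that $$\kappa+1<\log\frac1{E(z,w)}\qquad\text{for all }(z,w)\in\mathbb C^2\setminus(K\times K).\tag{1}$$ Moreover, for every fixed integer $n\ge1$: (i) $\Pi^{(n)}_{N,\beta,\Phi}(\mathbb C^n)=1$ for all $N\ge\max(n,2)$; (ii) $\Pi^{(n)}_{N,\beta,\Phi}(K^n)\to1$ as $N\to+\infty$, for every compact set $K$ satisfying (1); (iii) for every bounded continuous function $f:\mathbb C^n\to\mathbb C$, $$\int_{\mathbb C^n}f\,d\Pi^{(n)}_{N,\beta,\Phi}\to\int_{\mathbb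 C^n}f(z_1,\dots,z_n)\,d\widehat\sigma(z_1)\cdots d\widehat\sigma(z_n)\qquad\text{as }N\to+\infty,$$ that is, $\Pi^{(n)}_{N,\beta,\Phi}\to\widehat\sigma^{\otimes n}$ in the weak-star topology. -/

import Mathlib

open MeasureTheory Filter Topology
open scoped ENNReal BoundedContinuousFunction

noncomputable section

namespace NormalMatrix

/-- `Φ` grows faster than every multiple of `log |z|`:
for every `A > 0`, `Φ(z) ≥ A log |z| + O(1)`, with `O(1)` dependent on `A`. -/
def GrowsFasterThanLog (Φ : ℂ → ℝ) : Prop :=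
  ∀ A : ℝ, 0 < A → ∃ C : ℝ, ∀ z : ℂ, z ≠ 0 → A * Real.log ‖z‖ - C ≤ Φ z

/-! ### The weighted distribution of `N`-tuples and its marginals -/

/-- The van der Monde determinant `∏_{j<k} (z_j - z_k)`. -/
def vanDerMonde {N : ℕ} (z : Fin N → ℂ) : ℂ :=
  ∏ p : Fin N × Fin N with p.1 < p.2, (z p.1 - z p.2)

/-- The measure `dμ_{β,Φ}(z) = exp(-β Φ(z)) dλ₂(z)` on the plane. -/
def muMeasure (β : ℝ) (Φ : ℂ → ℝ) : Measure ℂ :=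
  volume.withDensity fun z => ENNReal.ofReal (Real.exp (-β * Φ z))

/-- The normalizing constant `Z_N`. -/
def partitionZ (N : ℕ) (β : ℝ) (Φ : ℂ → ℝ) : ℝ≥0∞ :=
  ∫⁻ z : Fin N → ℂ, ENNReal.ofReal (‖vanDerMonde z‖ ^ 2)
    ∂(Measure.pi fun _ : Fin N => muMeasure β Φ)

/-- `(z_1, …, z_n)` followed by `(z_{n+1}, …, z_N)`, as a point of `ℂ^N` (meant for `n ≤ N`). -/
def concat {n N : ℕ} (z : Fin n → ℂ) (w : Fin (N - n) → ℂ) : Fin N → ℂ :=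
  fun i => if h : (i : ℕ) < n then z ⟨i, h⟩ else w ⟨i - n, by have := i.isLt; omega⟩

/-- The `n`-point marginal distribution `Π^{(n)}_{N,β,Φ}` on `ℂ^n` (meant for `n ≤ N`):
its density with respect to `dμ(z_1) ⋯ dμ(z_n)` is
`Z_N⁻¹ ∫_{ℂ^{N-n}} |△(z_1, …, z_N)|² dμ(z_{n+1}) ⋯ dμ(z_N)`. -/
def marginal (n N : ℕ) (β : ℝ) (Φ : ℂ → ℝ) : Measure (Fin n → ℂ) :=
  (Measure.pi fun _ : Fin n => muMeasure β Φ).withDensity fun z =>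
    (partitionZ N β Φ)⁻¹ *
      ∫⁻ w : Fin (N - n) → ℂ, ENNReal.ofReal (‖vanDerMonde (concat z w : Fin N → ℂ)‖ ^ 2)
        ∂(Measure.pi fun _ : Fin (N - n) => muMeasure β Φ)

/-! ### The weighted logarithmic energy and its extremal measure -/

/-- `E_Φ(z,w;θ) = |z - w| exp(-θ [Φ(z) + Φ(w)])`. -/
def EFun (Φ : ℂ → ℝ) (θ : ℝ) (z w : ℂ) : ℝ :=
  ‖z - w‖ * Real.exp (-θ * (Φ z + Φ w))

/-- `log (1 / E_Φ(z,w;θ))`, with the value `+∞` at `z = w`. -/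
def logInvE (Φ : ℂ → ℝ) (θ : ℝ) (z w : ℂ) : EReal :=
  ENNReal.log (ENNReal.ofReal (EFun Φ θ z w))⁻¹

/-- The integral of an extended real valued function: integral of the positive part minus
integral of the negative part (meaningful when one of the two is finite). -/
def extIntegral {α : Type*} [MeasurableSpace α] (μ : Measure α) (f : α → EReal) : EReal :=
  ((∫⁻ x, (f x).toENNReal ∂μ : ℝ≥0∞) : EReal) - ((∫⁻ x, (-(f x)).toENNReal ∂μ : ℝ≥0∞) : EReal)

/-- The energy `ℰ_Φ[σ](θ) = ∬ log (1 / E_Φ(z,w;θ)) dσ(z) dσ(w)`, that is,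
`∬ {log (1/|z-w|) + θ Φ(z) + θ Φ(w)} dσ(z) dσ(w)`. For a compactly supported probability
measure `σ` and continuous `Φ` the negative part has finite integral. -/
def energy (Φ : ℂ → ℝ) (θ : ℝ) (σ : Measure ℂ) : EReal :=
  extIntegral (σ.prod σ) fun p => logInvE Φ θ p.1 p.2

/-- The compactly supported Borel probability measures on `ℂ`. -/
def compactProb : Set (Measure ℂ) :=
  {σ | IsProbabilityMeasure σ ∧ ∃ K : Set ℂ, IsCompact K ∧ σ Kᶜ = 0}

/-- `κ_Φ(θ)`, the infimum of the energy over compactly supported probability measures. -/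
def kappa (Φ : ℂ → ℝ) (θ : ℝ) : EReal :=
  ⨅ σ ∈ compactProb, energy Φ θ σ

/-- `σ` is an extremal (equilibrium) measure: it is a compactly supported probability measure
at which the infimum of the energy is attained. -/
def IsExtremalMeasure (Φ : ℂ → ℝ) (θ : ℝ) (σ : Measure ℂ) : Prop :=
  σ ∈ compactProb ∧ energy Φ θ σ = kappa Φ θ

/-- The requirement on the compact set `K`:
`κ_Φ(θ) + 1 < log (1 / E_Φ(z,w;θ))` for all `(z,w) ∈ ℂ² \ (K × K)`. -/
def IsConfining (Φ : ℂ → ℝ) (θ : ℝ) (K : Set ℂ) : Prop :=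
  IsCompact K ∧ ∀ z w : ℂ, (z, w) ∉ K ×ˢ K → kappa Φ θ + 1 < logInvE Φ θ z w

end NormalMatrix

end

noncomputable section

namespace NormalMatrix

open Complex (I)
open scoped ComplexConjugate

/-! Since 2(N-1)θ = β, the density |△|² ∏ exp(-βΦ(z_i)) equals ∏ E(z_i, z_j) over ordered pairs i ≠
j. Up to the diagonal this is exp(-N² · energy of the empirical measure), so for large N the
configurations whose empirical measure has nearly minimal energy carry almost all the mass. The
theorem follows by a large deviation estimate, together with uniqueness of the minimizer and
exchangeability.

Energy problem. The growth of Φ gives a constant c with log(1/E) + c ≥ 0, so energies can be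
computed in `ℝ≥0∞` with a kernel that is the increasing limit of bounded continuous truncations.
Sublevels of the energy are tight because the kernel is large off large compact sets, and weak
cluster points do not gain energy (`exists_mapClusterPt_mutualEnergy_le`); this yields a minimizer.
If K confines the kernel, conditioning on K shows that the energy of any probability measure ν is at
least the minimum plus ν(Kᶜ) (`minEnergy_add_le`), so minimizers live on K. Uniqueness is strict
convexity: log(b/|z-w|²) is a mixture of the Gaussians exp(-t|z-w|²), which are positive definite by
Fourier transform (`logEnergy_parallelogram`, `minimizer_unique`).

Concentration. Jensen's inequality for a product of smoothed near-minimizers bounds the partition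
function below by exp(-N² (min - c + δ/2) - O(N)) (`exp_le_mul_gibbsZ`). Where the truncated energy
of the empirical measure exceeds min + δ, the density is at most exp(-N² (min - c + δ) + O(N)); a
small power of the density supplies integrability at infinity (`setLIntegral_weight_le`). Hence this
event has probability at most exp(-N² δ/2 + O(N)) (`tendsto_gibbs_truncEnergy`). Truncation matters
because an empirical measure has infinite energy on the diagonal.

Conclusion. By compactness, measures of nearly minimal truncated energy are weakly close to the
minimizer and have little mass off K. The n-point marginal is the law of any n distinct coordinates,
so it differs from the mean of the n-th power of the empirical measure only through the maps `Fin n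
→ Fin N` that are not injective, a vanishing fraction. -/

/-! ### The logarithm as a mixture of Gaussians -/

/-- The Frullani integral `∫₀^∞ (e^{-ta} - e^{-tb}) dt / t`, equal to `log (b / a)`. -/
def frullani (b a : ℝ) : ℝ≥0∞ :=
  ∫⁻ t in Set.Ioi (0 : ℝ), ENNReal.ofReal ((Real.exp (-t * a) - Real.exp (-t * b)) / t)

lemma lintegral_exp_neg_mul_Ioi {s : ℝ} (hs : 0 < s) :
    ∫⁻ t in Set.Ioi (0 : ℝ), ENNReal.ofReal (Real.exp (-t * s)) = ENNReal.ofReal s⁻¹ := by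
  have h := integrableOn_exp_mul_Ioi (neg_lt_zero.2 hs) 0
  have h2 := integral_exp_mul_Ioi (neg_lt_zero.2 hs) 0
  rw [show (fun t : ℝ => ENNReal.ofReal (Real.exp (-t * s)))
    = fun t => ENNReal.ofReal (Real.exp (-s * t)) by ext t; ring_nf,
    ← ofReal_integral_eq_lintegral_ofReal h (ae_of_all _ fun _ => (Real.exp_pos _).le), h2]
  simp

lemma lintegral_exp_neg_mul_Ioc {t a b : ℝ} (ht : 0 < t) (hab : a ≤ b) :
    ∫⁻ s in Set.Ioc a b, ENNReal.ofReal (Real.exp (-t * s))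
      = ENNReal.ofReal ((Real.exp (-t * a) - Real.exp (-t * b)) / t) := by
  have hc : Continuous fun s : ℝ => Real.exp (-t * s) := by fun_prop
  rw [← ofReal_integral_eq_lintegral_ofReal
      ((hc.intervalIntegrable a b).1) (ae_of_all _ fun _ => (Real.exp_pos _).le),
    ← intervalIntegral.integral_of_le hab]
  congr 1
  have hd : ∀ x ∈ Set.uIcc a b,
      HasDerivAt (fun s : ℝ => -(Real.exp (-t * s) / t)) (Real.exp (-t * x)) x := by
    intro x _
    have h1 : HasDerivAt (fun s : ℝ => -t * s) (-t) x := by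
      simpa using (hasDerivAt_id x).const_mul (-t)
    refine (h1.exp.div_const t).neg.congr_deriv ?_
    field_simp
  rw [intervalIntegral.integral_eq_sub_of_hasDerivAt hd (hc.intervalIntegrable a b)]
  ring

lemma frullani_eq {a b : ℝ} (ha : 0 < a) (hab : a ≤ b) :
    frullani b a = ENNReal.ofReal (Real.log (b / a)) := by
  have hb := ha.trans_le hab
  calc frullani b a
      = ∫⁻ t in Set.Ioi (0 : ℝ), ∫⁻ s in Set.Ioc a b, ENNReal.ofReal (Real.exp (-t * s)) :=
        setLIntegral_congr_fun measurableSet_Ioi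
          fun t ht => (lintegral_exp_neg_mul_Ioc ht hab).symm
    _ = ∫⁻ s in Set.Ioc a b, ∫⁻ t in Set.Ioi (0 : ℝ), ENNReal.ofReal (Real.exp (-t * s)) :=
        lintegral_lintegral_swap (by fun_prop)
    _ = ∫⁻ s in Set.Ioc a b, ENNReal.ofReal s⁻¹ :=
        setLIntegral_congr_fun measurableSet_Ioc
          fun s hs => lintegral_exp_neg_mul_Ioi (ha.trans hs.1)
    _ = ENNReal.ofReal (Real.log (b / a)) := by
        rw [← ofReal_integral_eq_lintegral_ofReal, ← intervalIntegral.integral_of_le hab,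
          integral_inv_of_pos ha hb]
        · rw [← IntegrableOn, ← intervalIntegrable_iff_integrableOn_Ioc_of_le hab]
          refine intervalIntegral.intervalIntegrable_inv (fun x hx => ?_) continuousOn_id
          rw [Set.uIcc_of_le hab] at hx
          exact (ha.trans_le hx.1).ne'
        · filter_upwards [ae_restrict_mem measurableSet_Ioc] with s hs
          exact inv_nonneg.2 (ha.trans hs.1).le

lemma frullani_antitone (b : ℝ) : Antitone (frullani b) := by
  intro x y hxy
  refine setLIntegral_mono' measurableSet_Ioi fun t ht => ENNReal.ofReal_le_ofReal ?_
  have : 0 < t := ht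
  have h1 : Real.exp (-t * y) ≤ Real.exp (-t * x) := Real.exp_le_exp.2 (by nlinarith)
  exact div_le_div_of_nonneg_right (by linarith) this.le

/-- Antitonicity compares the value at 0 with the value at b·exp(-r), which is r, for every r. -/
lemma frullani_zero {b : ℝ} (hb : 0 < b) : frullani b 0 = ⊤ := by
  refine ENNReal.eq_top_of_forall_nnreal_le fun r => ?_
  have h1 : b * Real.exp (-r) ≤ b := by
    exact mul_le_of_le_one_right hb.le (Real.exp_le_one_iff.2 (neg_nonpos.2 r.2))
  have h2 := frullani_eq (b := b) (mul_pos hb (Real.exp_pos (-r))) h1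
  rw [show b / (b * Real.exp (-r)) = Real.exp r by
    rw [Real.exp_neg]; field_simp, Real.log_exp, ENNReal.ofReal_coe_nnreal] at h2
  rw [← h2]
  exact frullani_antitone b (by positivity)

lemma measurable_frullani (b : ℝ) : Measurable (frullani b) :=
  (frullani_antitone b).measurable

/-! ### Positive definiteness of the Gaussian -/

/-- The measure `e^{-s|x|²} dλ₂(x)`. -/
def gaussMeasure (s : ℝ) : Measure ℂ :=
  volume.withDensity fun x => ENNReal.ofReal (Real.exp (-s * ‖x‖ ^ 2))

lemma integrable_exp_neg_mul_sq_norm {s : ℝ} (hs : 0 < s) :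
    Integrable fun x : ℂ => Real.exp (-s * ‖x‖ ^ 2) := by
  -- The Bochner integral of a non-integrable function is 0, but the known value of the Gaussian
  -- integral is positive.
  by_contra h
  have h1 := GaussianFourier.integral_rexp_neg_mul_sq_norm (V := ℂ) hs
  rw [integral_undef h] at h1
  have : 0 < (Real.pi / s) ^ (Module.finrank ℝ ℂ / 2 : ℝ) := by positivity
  exact this.ne h1

lemma isFiniteMeasure_gaussMeasure {s : ℝ} (hs : 0 < s) : IsFiniteMeasure (gaussMeasure s) :=
  isFiniteMeasure_withDensity_ofReal (integrable_exp_neg_mul_sq_norm hs).2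

lemma integral_gaussMeasure {s : ℝ} (f : ℂ → ℂ) :
    ∫ x, f x ∂(gaussMeasure s) = ∫ x, (Real.exp (-s * ‖x‖ ^ 2) : ℂ) * f x := by
  rw [gaussMeasure, integral_withDensity_eq_integral_toReal_smul (by fun_prop)
    (ae_of_all _ fun _ => ENNReal.ofReal_lt_top)]
  congr with x
  rw [ENNReal.toReal_ofReal (Real.exp_pos _).le, Complex.real_smul]

lemma charFun_gaussMeasure {s : ℝ} (hs : 0 < s) (w : ℂ) :
    charFun (gaussMeasure s) w = ((Real.pi / s * Real.exp (-‖w‖ ^ 2 / (4 * s)) : ℝ) : ℂ) := by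
  rw [charFun_apply, integral_gaussMeasure]
  have h := GaussianFourier.integral_cexp_neg_mul_sq_norm_add (V := ℂ) (b := (s : ℂ))
    (by simpa using hs) I w
  simp only [Complex.finrank_real_complex] at h
  norm_num at h
  push_cast
  rw [← h]
  congr with x
  rw [← Complex.exp_add]
  simp [Complex.inner]
  ring_nf

/-- Fubini for characteristic functions. -/
lemma integral_charFun_sub (γ μ ν : Measure ℂ) [IsFiniteMeasure γ] [IsFiniteMeasure μ]
    [IsFiniteMeasure ν] :
    ∫ p, charFun γ (p.1 - p.2) ∂(μ.prod ν) = ∫ x, charFun μ x * conj (charFun ν x) ∂γ := by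
  simp only [charFun_apply]
  rw [integral_integral_swap]
  · congr with x
    rw [← integral_conj, ← integral_prod_mul]
    congr with p
    rw [← Complex.exp_conj, ← Complex.exp_add, inner_sub_right, real_inner_comm x, real_inner_comm x]
    simp
    ring_nf
  · refine Integrable.mono' (g := fun _ => (1 : ℝ)) (integrable_const _) ?_ ?_
    · exact Continuous.aestronglyMeasurable (by fun_prop)
    · refine ae_of_all _ fun p => ?_
      exact (Complex.norm_exp_ofReal_mul_I _).le

/-- The Gaussian energy `∬ e^{-t|z-w|²} dμ(z) dν(w)`. -/
def gaussEnergy (t : ℝ) (μ ν : Measure ℂ) : ℝ :=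
  ∫ p, Real.exp (-t * ‖p.1 - p.2‖ ^ 2) ∂(μ.prod ν)

/-- The squared distance of the characteristic functions, weighted by a Gaussian. -/
def charDist (t : ℝ) (μ ν : Measure ℂ) : ℝ :=
  (4 * Real.pi * t)⁻¹ * ∫ x, ‖charFun μ x - charFun ν x‖ ^ 2 ∂(gaussMeasure (4 * t)⁻¹)

lemma charDist_nonneg {t : ℝ} (ht : 0 < t) (μ ν : Measure ℂ) : 0 ≤ charDist t μ ν :=
  mul_nonneg (by positivity) (integral_nonneg fun _ => by positivity)

/-- The function exp(-t|·|²) is (4πt)⁻¹ times the characteristic function of the Gaussian with s =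
(4t)⁻¹, so Fubini turns the double integral into an inner product of characteristic functions. -/
lemma gaussEnergy_eq {t : ℝ} (ht : 0 < t) (μ ν : Measure ℂ) [IsFiniteMeasure μ]
    [IsFiniteMeasure ν] :
    gaussEnergy t μ ν = (4 * Real.pi * t)⁻¹ *
      (∫ x, charFun μ x * conj (charFun ν x) ∂(gaussMeasure (4 * t)⁻¹)).re := by
  have hs : 0 < (4 * t)⁻¹ := by positivity
  have := isFiniteMeasure_gaussMeasure hs
  rw [← integral_charFun_sub]
  simp only [charFun_gaussMeasure hs]
  rw [integral_complex_ofReal, Complex.ofReal_re, integral_const_mul, gaussEnergy, ← mul_assoc]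
  rw [show (4 * Real.pi * t)⁻¹ * (Real.pi / (4 * t)⁻¹) = 1 by
    have := Real.pi_pos; field_simp, one_mul]
  congr with p
  field_simp

lemma integrable_charFun_mul (γ μ ν : Measure ℂ) [IsFiniteMeasure γ] [IsFiniteMeasure μ]
    [IsFiniteMeasure ν] : Integrable (fun x => charFun μ x * conj (charFun ν x)) γ := by
  refine Integrable.mono' (g := fun _ => μ.real Set.univ * ν.real Set.univ) (integrable_const _)
    ?_ (ae_of_all _ fun x => ?_)
  · exact (stronglyMeasurable_charFun.mul
      (Complex.continuous_conj.comp_stronglyMeasurable stronglyMeasurable_charFun)).aestronglyMeasurable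
  · rw [norm_mul, RCLike.norm_conj]
    exact mul_le_mul (norm_charFun_le x) (norm_charFun_le x) (norm_nonneg _) (by positivity)

/-- On the Fourier side this is |a - b|² = |a|² + |b|² - 2 Re(a b̄), integrated against a Gaussian.
-/
lemma gaussEnergy_parallelogram {t : ℝ} (ht : 0 < t) (μ ν : Measure ℂ) [IsFiniteMeasure μ]
    [IsFiniteMeasure ν] :
    gaussEnergy t μ μ + gaussEnergy t ν ν = 2 * gaussEnergy t μ ν + charDist t μ ν := by
  have := isFiniteMeasure_gaussMeasure (s := (4 * t)⁻¹) (by positivity)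
  simp only [gaussEnergy_eq ht, charDist]
  have hi := fun μ ν : Measure ℂ => fun (_ : IsFiniteMeasure μ) (_ : IsFiniteMeasure ν) =>
    integrable_charFun_mul (gaussMeasure (4 * t)⁻¹) μ ν
  have hre : ∀ μ ν : Measure ℂ, IsFiniteMeasure μ → IsFiniteMeasure ν →
      (∫ x, charFun μ x * conj (charFun ν x) ∂(gaussMeasure (4 * t)⁻¹)).re =
        ∫ x, (charFun μ x * conj (charFun ν x)).re ∂(gaussMeasure (4 * t)⁻¹) :=
    fun μ ν hμ hν => (integral_re (𝕜 := ℂ) (hi μ ν hμ hν)).symm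
  have hir := fun μ ν h1 h2 => (hi μ ν h1 h2).re
  rw [hre μ μ ‹_› ‹_›, hre ν ν ‹_› ‹_›, hre μ ν ‹_› ‹_›]
  have key : ∫ x, ‖charFun μ x - charFun ν x‖ ^ 2 ∂(gaussMeasure (4 * t)⁻¹) =
      ∫ x, ((charFun μ x * conj (charFun μ x)).re + (charFun ν x * conj (charFun ν x)).re
        - 2 * (charFun μ x * conj (charFun ν x)).re) ∂(gaussMeasure (4 * t)⁻¹) := by
    congr with x
    rw [← Complex.normSq_eq_norm_sq, Complex.normSq_sub]
    simp [Complex.normSq_apply]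
  rw [key, integral_sub, integral_add, integral_const_mul]
  · ring
  · exact hir μ μ ‹_› ‹_›
  · exact hir ν ν ‹_› ‹_›
  · exact (hir μ μ ‹_› ‹_›).add (hir ν ν ‹_› ‹_›)
  · exact (hir μ ν ‹_› ‹_›).const_mul 2

lemma continuous_charFun (μ : Measure ℂ) [IsFiniteMeasure μ] : Continuous (charFun μ) := by
  have : charFun μ = fun t : ℂ => ∫ x, Complex.exp (inner ℝ x t * I) ∂μ := by
    ext t; rw [charFun_apply]
  rw [this]
  refine continuous_of_dominated (bound := fun _ => 1) (fun t => ?_) (fun t => ?_)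
    (integrable_const _) ?_
  · exact Continuous.aestronglyMeasurable (by fun_prop)
  · exact ae_of_all _ fun x => (Complex.norm_exp_ofReal_mul_I _).le
  · exact ae_of_all _ fun x => by fun_prop

/-- The Gaussian density is positive, so the characteristic functions agree Lebesgue-a.e., hence
everywhere by continuity, and they determine the measures. -/
lemma eq_of_charDist_eq_zero {t : ℝ} (ht : 0 < t) {μ ν : Measure ℂ} [IsFiniteMeasure μ]
    [IsFiniteMeasure ν] (h : charDist t μ ν = 0) : μ = ν := by
  have hfin := isFiniteMeasure_gaussMeasure (s := (4 * t)⁻¹) (by positivity)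
  have hc : Continuous fun x => ‖charFun μ x - charFun ν x‖ ^ 2 :=
    ((continuous_charFun μ).sub (continuous_charFun ν)).norm.pow 2
  have hint : Integrable (fun x => ‖charFun μ x - charFun ν x‖ ^ 2) (gaussMeasure (4 * t)⁻¹) := by
    refine Integrable.mono' (g := fun _ => (μ.real Set.univ + ν.real Set.univ) ^ 2)
      (integrable_const _) hc.aestronglyMeasurable (ae_of_all _ fun x => ?_)
    rw [Real.norm_of_nonneg (by positivity)]
    gcongr
    exact (norm_sub_le _ _).trans (add_le_add (norm_charFun_le x) (norm_charFun_le x))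
  have h0 : ∫ x, ‖charFun μ x - charFun ν x‖ ^ 2 ∂(gaussMeasure (4 * t)⁻¹) = 0 := by
    rcases mul_eq_zero.1 h with h | h
    · have := Real.pi_pos
      have : (4 * Real.pi * t)⁻¹ ≠ 0 := by positivity
      contradiction
    · exact h
  rw [integral_eq_zero_iff_of_nonneg (fun x => by positivity) hint] at h0
  have habs : volume ≪ gaussMeasure (4 * t)⁻¹ :=
    withDensity_absolutelyContinuous' (by fun_prop)
      (ae_of_all _ fun x => by simp [Real.exp_pos])
  have h1 := Measure.eq_of_ae_eq (habs h0) hc continuous_const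
  refine Measure.ext_of_charFun (funext fun x => ?_)
  have h2 := congrFun h1 x
  simpa [sub_eq_zero] using h2

/-! ### Logarithmic energy -/

/-- The mutual logarithmic energy `∬ log (b / |z-w|²) dμ(z) dν(w)`. -/
def logEnergy (b : ℝ) (μ ν : Measure ℂ) : ℝ≥0∞ :=
  ∫⁻ p, frullani b (‖p.1 - p.2‖ ^ 2) ∂(μ.prod ν)

lemma ae_prod_sq_norm_sub_le {μ ν : Measure ℂ} [SFinite μ] [SFinite ν] {R : ℝ}
    (hμ : ∀ᵐ z ∂μ, ‖z‖ ≤ R) (hν : ∀ᵐ z ∂ν, ‖z‖ ≤ R) :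
    ∀ᵐ p ∂(μ.prod ν), ‖p.1 - p.2‖ ^ 2 ≤ (2 * R) ^ 2 := by
  filter_upwards [Measure.quasiMeasurePreserving_fst.ae hμ,
    Measure.quasiMeasurePreserving_snd.ae hν] with p h1 h2
  have := norm_sub_le p.1 p.2
  gcongr
  linarith

lemma measurable_gaussEnergy (μ ν : Measure ℂ) [SFinite μ] [SFinite ν] :
    Measurable fun t => gaussEnergy t μ ν := by
  unfold gaussEnergy
  have : Continuous fun q : ℝ × ℂ × ℂ => Real.exp (-q.1 * ‖q.2.1 - q.2.2‖ ^ 2) := by fun_prop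
  exact this.stronglyMeasurable.integral_prod_right'.measurable

lemma integrable_exp_neg_mul_sq_norm_sub {t : ℝ} (ht : 0 ≤ t) (μ ν : Measure ℂ)
    [IsFiniteMeasure μ] [IsFiniteMeasure ν] :
    Integrable (fun p : ℂ × ℂ => Real.exp (-t * ‖p.1 - p.2‖ ^ 2)) (μ.prod ν) := by
  refine Integrable.mono' (g := fun _ => (1 : ℝ)) (integrable_const _)
    (Continuous.aestronglyMeasurable (by fun_prop)) (ae_of_all _ fun p => ?_)
  rw [Real.norm_of_nonneg (Real.exp_pos _).le, Real.exp_le_one_iff]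
  have := mul_nonneg ht (sq_nonneg ‖p.1 - p.2‖)
  linarith

lemma exp_le_gaussEnergy {t b : ℝ} (ht : 0 ≤ t) {μ ν : Measure ℂ}
    [IsProbabilityMeasure μ] [IsProbabilityMeasure ν]
    (h : ∀ᵐ p ∂(μ.prod ν), ‖p.1 - p.2‖ ^ 2 ≤ b) :
    Real.exp (-t * b) ≤ gaussEnergy t μ ν := by
  have h1 : ∫ _p, Real.exp (-t * b) ∂(μ.prod ν) ≤ gaussEnergy t μ ν := by
    refine integral_mono_ae (integrable_const _) (integrable_exp_neg_mul_sq_norm_sub ht μ ν) ?_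
    filter_upwards [h] with p hp
    exact Real.exp_le_exp.2 (by nlinarith)
  simpa using h1

/-- The bound |z-w|² ≤ b keeps the Frullani integrand nonnegative; otherwise `ENNReal.ofReal` would
clip it before the integration over pairs. -/
lemma logEnergy_eq {b : ℝ} {μ ν : Measure ℂ} [IsProbabilityMeasure μ] [IsProbabilityMeasure ν]
    (h : ∀ᵐ p ∂(μ.prod ν), ‖p.1 - p.2‖ ^ 2 ≤ b) :
    logEnergy b μ ν = ∫⁻ t in Set.Ioi (0 : ℝ),
      ENNReal.ofReal ((gaussEnergy t μ ν - Real.exp (-t * b)) / t) := by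
  unfold logEnergy frullani
  rw [lintegral_lintegral_swap (by fun_prop)]
  refine setLIntegral_congr_fun measurableSet_Ioi fun t ht => ?_
  have ht0 : 0 < t := ht
  have hi := integrable_exp_neg_mul_sq_norm_sub ht0.le μ ν
  have hi2 : Integrable (fun p : ℂ × ℂ =>
      (Real.exp (-t * ‖p.1 - p.2‖ ^ 2) - Real.exp (-t * b)) / t) (μ.prod ν) :=
    (hi.sub (integrable_const _)).div_const t
  rw [← ofReal_integral_eq_lintegral_ofReal hi2, integral_div, integral_sub hi (integrable_const _), gaussEnergy]
  · simp
  · filter_upwards [h] with p hp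
    refine div_nonneg (sub_nonneg.2 (Real.exp_le_exp.2 ?_)) ht0.le
    nlinarith

/-- The parallelogram identity for the logarithmic energy. -/
lemma logEnergy_parallelogram {R : ℝ} {μ ν : Measure ℂ} [IsProbabilityMeasure μ]
    [IsProbabilityMeasure ν] (hμ : ∀ᵐ z ∂μ, ‖z‖ ≤ R) (hν : ∀ᵐ z ∂ν, ‖z‖ ≤ R) :
    logEnergy ((2 * R) ^ 2) μ μ + logEnergy ((2 * R) ^ 2) ν ν =
      2 * logEnergy ((2 * R) ^ 2) μ ν
        + ∫⁻ t in Set.Ioi (0 : ℝ), ENNReal.ofReal (charDist t μ ν / t) := by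
  have h11 := ae_prod_sq_norm_sub_le hμ hμ
  have h22 := ae_prod_sq_norm_sub_le hν hν
  have h12 := ae_prod_sq_norm_sub_le hμ hν
  set b := (2 * R) ^ 2
  rw [logEnergy_eq h11, logEnergy_eq h22, logEnergy_eq h12, ← lintegral_const_mul,
    ← lintegral_add_left, ← lintegral_add_left]
  · refine setLIntegral_congr_fun measurableSet_Ioi fun t ht => ?_
    have ht0 : 0 < t := ht
    have e1 := exp_le_gaussEnergy ht0.le h11
    have e2 := exp_le_gaussEnergy ht0.le h22
    have e3 := exp_le_gaussEnergy ht0.le h12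
    have e4 := charDist_nonneg ht0 μ ν
    have key := gaussEnergy_parallelogram ht0 μ ν
    rw [show (2 : ℝ≥0∞) = ENNReal.ofReal 2 by simp, ← ENNReal.ofReal_mul (by norm_num),
      ← ENNReal.ofReal_add (div_nonneg (sub_nonneg.2 e1) ht0.le)
        (div_nonneg (sub_nonneg.2 e2) ht0.le),
      ← ENNReal.ofReal_add (mul_nonneg zero_le_two (div_nonneg (sub_nonneg.2 e3) ht0.le))
        (div_nonneg e4 ht0.le)]
    congr 1
    rw [← add_div, ← mul_div_assoc, ← add_div]
    congr 1
    linarith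
  all_goals
    have := measurable_gaussEnergy μ ν
    have := measurable_gaussEnergy μ μ
    fun_prop

lemma two_mul_logEnergy_le {R : ℝ} {μ ν : Measure ℂ} [IsProbabilityMeasure μ]
    [IsProbabilityMeasure ν] (hμ : ∀ᵐ z ∂μ, ‖z‖ ≤ R) (hν : ∀ᵐ z ∂ν, ‖z‖ ≤ R) :
    2 * logEnergy ((2 * R) ^ 2) μ ν ≤
      logEnergy ((2 * R) ^ 2) μ μ + logEnergy ((2 * R) ^ 2) ν ν := by
  rw [logEnergy_parallelogram hμ hν]
  exact le_self_add

/-- The logarithmic energy is strictly convex. -/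
lemma eq_of_logEnergy_le {R : ℝ} {μ ν : Measure ℂ} [IsProbabilityMeasure μ]
    [IsProbabilityMeasure ν] (hμ : ∀ᵐ z ∂μ, ‖z‖ ≤ R) (hν : ∀ᵐ z ∂ν, ‖z‖ ≤ R)
    (hfin : logEnergy ((2 * R) ^ 2) μ ν ≠ ⊤)
    (h : logEnergy ((2 * R) ^ 2) μ μ + logEnergy ((2 * R) ^ 2) ν ν ≤
      2 * logEnergy ((2 * R) ^ 2) μ ν) : μ = ν := by
  rw [logEnergy_parallelogram hμ hν] at h
  have h0 : ∫⁻ t in Set.Ioi (0 : ℝ), ENNReal.ofReal (charDist t μ ν / t) = 0 := by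
    have h2 := ENNReal.mul_ne_top (by norm_num : (2 : ℝ≥0∞) ≠ ⊤) hfin
    -- Writes the right side as 2L + 0, so that the finite term 2L cancels and the Fourier defect is
    -- at most 0.
    rw [← add_zero (2 * logEnergy ((2 * R) ^ 2) μ ν), add_assoc, zero_add] at h
    simpa using (ENNReal.add_le_add_iff_left h2).1 h
  -- Measurability in t is read off the Gaussian energies, with which the distance agrees for t > 0.
  have hm : AEMeasurable (fun t => ENNReal.ofReal (charDist t μ ν / t))
      (volume.restrict (Set.Ioi (0 : ℝ))) := by
    have h1 := measurable_gaussEnergy μ ν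
    have h2 := measurable_gaussEnergy μ μ
    have h3 := measurable_gaussEnergy ν ν
    refine AEMeasurable.congr (f := fun t => ENNReal.ofReal
      ((gaussEnergy t μ μ + gaussEnergy t ν ν - 2 * gaussEnergy t μ ν) / t)) (by fun_prop) ?_
    filter_upwards [ae_restrict_mem measurableSet_Ioi] with t ht
    rw [gaussEnergy_parallelogram ht μ ν, add_sub_cancel_left]
  rw [lintegral_eq_zero_iff' hm] at h0
  have hne : (ae (volume.restrict (Set.Ioi (0 : ℝ)))).NeBot := by
    rw [ae_neBot, Ne, Measure.restrict_eq_zero]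
    simp
  obtain ⟨t, ht, ht0⟩ := (h0.and (ae_restrict_mem measurableSet_Ioi)).exists
  have ht1 : 0 < t := ht0
  refine eq_of_charDist_eq_zero ht1 (le_antisymm ?_ (charDist_nonneg ht1 μ ν))
  have h4 : charDist t μ ν / t ≤ 0 := by simpa using ht
  by_contra h5
  exact absurd h4 (not_le.2 (div_pos (not_le.1 h5) ht1))

/-! ### The shifted kernel -/

/-- A continuous potential for which `θ Φ` dominates `5 log (1 + |z|)`; the constant `c` makes
`log (1 / E) + c` nonnegative. -/
structure IsPotential (Φ : ℂ → ℝ) (θ c : ℝ) : Prop where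
  continuous : Continuous Φ
  nonneg : 0 ≤ c
  le : ∀ z, 5 * Real.log (1 + ‖z‖) - c / 2 ≤ θ * Φ z

lemma exists_isPotential {Φ : ℂ → ℝ} (hc : Continuous Φ) (hg : GrowsFasterThanLog Φ) {θ : ℝ}
    (hθ : 0 < θ) : ∃ c, IsPotential Φ θ c := by
  -- Of the exponent 5, one unit absorbs |z-w| ≤ (1+|z|)(1+|w|); the remaining decay (1+|z|)⁻⁴ is
  -- integrable on the plane.
  obtain ⟨C, hC⟩ := hg (5 / θ) (by positivity)
  obtain ⟨m, hm⟩ := ((isCompact_closedBall (0 : ℂ) 1).bddBelow_image hc.continuousOn)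
  have hlog2 : 0 < Real.log 2 := Real.log_pos (by norm_num)
  refine ⟨2 * (5 * Real.log 2 + θ * |C| + θ * |m|), hc, by positivity, fun z => ?_⟩
  have e1 : 0 ≤ θ * |C| := by positivity
  have e2 : 0 ≤ θ * |m| := by positivity
  have hz := norm_nonneg z
  rcases le_total ‖z‖ 1 with h | h
  · have h1 : Real.log (1 + ‖z‖) ≤ Real.log 2 := Real.log_le_log (by positivity) (by linarith)
    have h2 : m ≤ Φ z := hm ⟨z, by simpa using h, rfl⟩
    have h3 : θ * (-|m|) ≤ θ * Φ z := by
      gcongr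
      exact (neg_abs_le m).trans h2
    linarith
  · have hz0 : z ≠ 0 := by rintro rfl; norm_num at h
    have h1 : Real.log (1 + ‖z‖) ≤ Real.log 2 + Real.log ‖z‖ := by
      rw [← Real.log_mul (by norm_num) (by positivity)]
      exact Real.log_le_log (by positivity) (by linarith)
    have h2 : θ * (5 / θ * Real.log ‖z‖ - |C|) ≤ θ * Φ z := by
      gcongr
      linarith [hC z hz0, le_abs_self C]
    have h3 : θ * (5 / θ * Real.log ‖z‖ - |C|) = 5 * Real.log ‖z‖ - θ * |C| := by
      field_simp
    linarith

lemma EFun_nonneg (Φ : ℂ → ℝ) (θ : ℝ) (z w : ℂ) : 0 ≤ EFun Φ θ z w := by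
  unfold EFun; positivity

lemma EFun_pos (Φ : ℂ → ℝ) (θ : ℝ) {z w : ℂ} (h : z ≠ w) : 0 < EFun Φ θ z w := by
  have := norm_pos_iff.2 (sub_ne_zero.2 h)
  unfold EFun; positivity

@[simp] lemma EFun_self (Φ : ℂ → ℝ) (θ : ℝ) (z : ℂ) : EFun Φ θ z z = 0 := by simp [EFun]

/-- The bound `(1 + |z|) e^{-θΦ(z)}` for one of the two factors of `E`. -/
def tailFactor (Φ : ℂ → ℝ) (θ : ℝ) (z : ℂ) : ℝ := (1 + ‖z‖) * Real.exp (-θ * Φ z)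

lemma tailFactor_nonneg (Φ : ℂ → ℝ) (θ : ℝ) (z : ℂ) : 0 ≤ tailFactor Φ θ z := by
  unfold tailFactor; positivity

/-- Decoupling the two variables lets products over pairs be integrated coordinate by coordinate. -/
lemma EFun_le_tailFactor_mul (Φ : ℂ → ℝ) (θ : ℝ) (z w : ℂ) :
    EFun Φ θ z w ≤ tailFactor Φ θ z * tailFactor Φ θ w := by
  have h1 : ‖z - w‖ ≤ (1 + ‖z‖) * (1 + ‖w‖) := by
    nlinarith [norm_sub_le z w, norm_nonneg z, norm_nonneg w,
      mul_nonneg (norm_nonneg z) (norm_nonneg w)]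
  calc EFun Φ θ z w
      ≤ (1 + ‖z‖) * (1 + ‖w‖) * Real.exp (-θ * (Φ z + Φ w)) := by
        unfold EFun; gcongr
    _ = _ := by
        unfold tailFactor
        rw [mul_add (-θ), Real.exp_add]
        ring

variable {Φ : ℂ → ℝ} {θ c : ℝ}

namespace IsPotential

lemma tailFactor_le (hP : IsPotential Φ θ c) (z : ℂ) :
    tailFactor Φ θ z ≤ Real.exp (c / 2) * (1 + ‖z‖) ^ (-4 : ℝ) := by
  have hz : 0 < 1 + ‖z‖ := by positivity
  have h1 : Real.exp (-θ * Φ z) ≤ Real.exp (c / 2) * (1 + ‖z‖) ^ (-5 : ℝ) := by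
    rw [Real.rpow_def_of_pos hz, ← Real.exp_add]
    exact Real.exp_le_exp.2 (by linarith [hP.le z])
  calc tailFactor Φ θ z ≤ (1 + ‖z‖) * (Real.exp (c / 2) * (1 + ‖z‖) ^ (-5 : ℝ)) := by
        unfold tailFactor; gcongr
    _ = Real.exp (c / 2) * ((1 + ‖z‖) ^ (1 : ℝ) * (1 + ‖z‖) ^ (-5 : ℝ)) := by
        rw [Real.rpow_one]; ring
    _ = _ := by rw [← Real.rpow_add hz]; norm_num

lemma EFun_le (hP : IsPotential Φ θ c) (z w : ℂ) :
    EFun Φ θ z w ≤ Real.exp c * ((1 + ‖z‖) ^ (-4 : ℝ) * (1 + ‖w‖) ^ (-4 : ℝ)) := by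
  refine (EFun_le_tailFactor_mul Φ θ z w).trans ((mul_le_mul (hP.tailFactor_le z)
    (hP.tailFactor_le w) (tailFactor_nonneg _ _ _) (by positivity)).trans_eq ?_)
  rw [show Real.exp c = Real.exp (c / 2) * Real.exp (c / 2) by rw [← Real.exp_add]; ring_nf]
  ring

lemma one_add_norm_rpow_le_one (z : ℂ) : (1 + ‖z‖) ^ (-4 : ℝ) ≤ 1 :=
  Real.rpow_le_one_of_one_le_of_nonpos (by linarith [norm_nonneg z]) (by norm_num)

lemma EFun_le_exp (hP : IsPotential Φ θ c) (z w : ℂ) : EFun Φ θ z w ≤ Real.exp c := by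
  refine (hP.EFun_le z w).trans (mul_le_of_le_one_right (Real.exp_pos _).le ?_)
  exact mul_le_one₀ (one_add_norm_rpow_le_one z) (by positivity) (one_add_norm_rpow_le_one w)

lemma continuous_EFun (hP : IsPotential Φ θ c) :
    Continuous fun p : ℂ × ℂ => EFun Φ θ p.1 p.2 := by
  have := hP.continuous
  unfold EFun
  fun_prop

end IsPotential

/-! ### The shifted kernel and its bounded continuous truncations. -/

/-- `log (1 / E) + c`, as an extended nonnegative number. -/
def kernel (Φ : ℂ → ℝ) (θ c : ℝ) (p : ℂ × ℂ) : ℝ≥0∞ :=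
  if p.1 = p.2 then ⊤ else ENNReal.ofReal (c - Real.log (EFun Φ θ p.1 p.2))

/-- The truncation of the kernel at height `c + m`. -/
def truncKernel (Φ : ℂ → ℝ) (θ c : ℝ) (m : ℕ) (p : ℂ × ℂ) : ℝ :=
  c - Real.log (max (EFun Φ θ p.1 p.2) (Real.exp (-m)))

lemma truncKernel_mono : Monotone fun (m : ℕ) (p : ℂ × ℂ) => truncKernel Φ θ c m p := by
  intro m n hmn p
  have h1 : (m : ℝ) ≤ n := by exact_mod_cast hmn
  have h2 : Real.exp (-n) ≤ Real.exp (-m) := Real.exp_le_exp.2 (by linarith)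
  have := Real.exp_pos (-n : ℝ)
  exact sub_le_sub_left (Real.log_le_log (lt_max_of_lt_right this) (max_le_max le_rfl h2)) _

lemma truncKernel_le (m : ℕ) (p : ℂ × ℂ) : truncKernel Φ θ c m p ≤ c + m := by
  have h := Real.log_le_log (Real.exp_pos (-m : ℝ))
    (le_max_right (EFun Φ θ p.1 p.2) (Real.exp (-m)))
  rw [Real.log_exp] at h
  unfold truncKernel
  linarith

lemma truncKernel_self (m : ℕ) (z : ℂ) : truncKernel Φ θ c m (z, z) = c + m := by
  simp [truncKernel, max_eq_right (Real.exp_pos _).le]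

lemma ofReal_truncKernel_le (m : ℕ) (p : ℂ × ℂ) :
    ENNReal.ofReal (truncKernel Φ θ c m p) ≤ kernel Φ θ c p := by
  unfold kernel
  split_ifs with h
  · exact le_top
  · exact ENNReal.ofReal_le_ofReal
      (sub_le_sub_left (Real.log_le_log (EFun_pos Φ θ h) (le_max_left _ _)) _)

/-- Truncation alters the kernel only above the height c + m, so lower bounds of the kernel up to
that height survive. -/
lemma min_le_truncKernel (m : ℕ) (p : ℂ × ℂ) :
    min (kernel Φ θ c p) (ENNReal.ofReal (c + m)) ≤ ENNReal.ofReal (truncKernel Φ θ c m p) := by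
  rcases le_total (EFun Φ θ p.1 p.2) (Real.exp (-m)) with h | h
  · refine (min_le_right _ _).trans (ENNReal.ofReal_le_ofReal ?_)
    rw [truncKernel, max_eq_right h, Real.log_exp]
    linarith
  · refine (min_le_left _ _).trans ?_
    have hp : p.1 ≠ p.2 := fun hp => by
      rw [hp, EFun_self] at h
      exact absurd h (not_le.2 (Real.exp_pos _))
    rw [kernel, if_neg hp, truncKernel, max_eq_left h]

lemma iSup_truncKernel (p : ℂ × ℂ) :
    ⨆ m : ℕ, ENNReal.ofReal (truncKernel Φ θ c m p) = kernel Φ θ c p := by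
  refine le_antisymm (iSup_le fun m => ofReal_truncKernel_le m p) (le_of_forall_lt fun x hx => ?_)
  obtain ⟨y, hxy, hy⟩ := exists_between hx
  have hy' : y ≠ ⊤ := (hy.trans_le le_top).ne
  obtain ⟨m, hm⟩ := exists_nat_ge (y.toReal - c)
  refine hxy.trans_le (le_iSup_of_le m ((le_min hy.le ?_).trans (min_le_truncKernel m p)))
  rw [← ENNReal.ofReal_toReal hy']
  exact ENNReal.ofReal_le_ofReal (by linarith)

namespace IsPotential

lemma truncKernel_nonneg (hP : IsPotential Φ θ c) (m : ℕ) (p : ℂ × ℂ) :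
    0 ≤ truncKernel Φ θ c m p := by
  have h1 : max (EFun Φ θ p.1 p.2) (Real.exp (-m)) ≤ Real.exp c :=
    max_le (hP.EFun_le_exp _ _) (Real.exp_le_exp.2 (by linarith [hP.nonneg, m.cast_nonneg (α := ℝ)]))
  have h2 := Real.log_le_log (lt_max_of_lt_right (Real.exp_pos (-m : ℝ))) h1
  rw [Real.log_exp] at h2
  exact sub_nonneg.2 h2

lemma continuous_truncKernel (hP : IsPotential Φ θ c) (m : ℕ) :
    Continuous (truncKernel Φ θ c m) := by
  have h := hP.continuous_EFun
  refine continuous_const.sub (Continuous.log (by fun_prop) fun p => ?_)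
  exact (lt_max_of_lt_right (Real.exp_pos (-m : ℝ))).ne'

lemma measurable_kernel (hP : IsPotential Φ θ c) : Measurable (kernel Φ θ c) := by
  have : kernel Φ θ c = fun p => ⨆ m : ℕ, ENNReal.ofReal (truncKernel Φ θ c m p) :=
    funext fun p => (iSup_truncKernel p).symm
  rw [this]
  exact .iSup fun m => (hP.continuous_truncKernel m).measurable.ennreal_ofReal

end IsPotential

lemma kernel_swap (p : ℂ × ℂ) : kernel Φ θ c p.swap = kernel Φ θ c p := by
  simp [kernel, EFun, norm_sub_rev, eq_comm, add_comm]

lemma logInvE_eq (hP : IsPotential Φ θ c) (z w : ℂ) :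
    logInvE Φ θ z w = (kernel Φ θ c (z, w) : EReal) - (ENNReal.ofReal c : EReal) := by
  have hc : (ENNReal.ofReal c : EReal) = (c : EReal) := EReal.coe_ennreal_ofReal.trans
    (by rw [max_eq_left hP.nonneg])
  rw [hc]
  unfold logInvE kernel
  split_ifs with h
  · replace h : z = w := h
    subst h
    simp
  · replace h : z ≠ w := h
    have h0 := EFun_pos Φ θ h
    have h1 := Real.log_le_log h0 (hP.EFun_le_exp z w)
    rw [Real.log_exp] at h1
    rw [ENNReal.log_inv, ENNReal.log_ofReal_of_pos h0, EReal.coe_ennreal_ofReal,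
      max_eq_left (by linarith), ← EReal.coe_sub, ← EReal.coe_neg]
    congr 1
    ring

/-- Integrating (h - C)⁺ + C = (C - h)⁺ + h gives the identity up to rearrangement, which is
legitimate because ∫ (C - h)⁺ ≤ C is finite. Only ∫ h may be infinite. -/
lemma extIntegral_sub_const {α : Type*} [MeasurableSpace α] (μ : Measure α)
    [IsProbabilityMeasure μ] {h : α → ℝ≥0∞} (hm : Measurable h) {C : ℝ≥0∞} (hC : C ≠ ⊤) :
    extIntegral μ (fun x => (h x : EReal) - (C : EReal)) = ((∫⁻ x, h x ∂μ : ℝ≥0∞) : EReal) - C := by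
  have hpos : ∀ x, ((h x : EReal) - (C : EReal)).toENNReal = h x - C := fun x => by
    rw [EReal.toENNReal_sub (EReal.coe_ennreal_nonneg _)]
    simp
  have hneg : ∀ x, (-((h x : EReal) - (C : EReal))).toENNReal = C - h x := fun x => by
    rw [EReal.neg_sub (by simp) (by simp [hC]), add_comm, ← sub_eq_add_neg, EReal.toENNReal_sub (EReal.coe_ennreal_nonneg _)]
    simp
  unfold extIntegral
  simp only [hpos, hneg]
  have h1 : (∫⁻ x, (h x - C) ∂μ) + C = (∫⁻ x, (C - h x) ∂μ) + ∫⁻ x, h x ∂μ := by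
    have : C = ∫⁻ _x, C ∂μ := by simp
    nth_rewrite 2 [this]
    rw [← lintegral_add_right _ measurable_const, ← lintegral_add_right _ hm]
    congr with x
    rcases le_total (h x) C with hx | hx
    · rw [tsub_eq_zero_of_le hx, tsub_add_cancel_of_le hx, zero_add]
    · rw [tsub_eq_zero_of_le hx, tsub_add_cancel_of_le hx, zero_add]
  have h2 : ∫⁻ x, (C - h x) ∂μ ≠ ⊤ := by
    refine ne_top_of_le_ne_top hC ((lintegral_mono fun x => tsub_le_self).trans_eq ?_)
    simp
  generalize ∫⁻ x, (h x - C) ∂μ = a at *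
  generalize ∫⁻ x, (C - h x) ∂μ = b at *
  generalize ∫⁻ x, h x ∂μ = d at *
  by_cases hd : d = ⊤
  · subst hd
    have ha : a = ⊤ := by simpa [hC] using h1
    subst ha
    lift b to NNReal using h2
    lift C to NNReal using hC
    rfl
  · have ha : a ≠ ⊤ := fun ha => by
      subst ha
      exact (ENNReal.add_ne_top.2 ⟨h2, hd⟩) (by simpa using h1.symm)
    lift a to NNReal using ha
    lift b to NNReal using h2
    lift C to NNReal using hC
    lift d to NNReal using hd
    have h3 : (a : ℝ) + C = b + d := by exact_mod_cast h1
    have : (a : ℝ) - b = d - C := by linarith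
    have h4 := congrArg (fun x : ℝ => (x : EReal)) this
    simpa only [EReal.coe_nnreal_eq_coe_real, EReal.coe_sub] using h4

/-! ### Shifted energies in `ℝ≥0∞`. -/

/-- The shifted mutual energy. -/
def mutualEnergy (Φ : ℂ → ℝ) (θ c : ℝ) (μ ν : Measure ℂ) : ℝ≥0∞ :=
  ∫⁻ p, kernel Φ θ c p ∂(μ.prod ν)

/-- The truncated shifted energy. -/
def truncEnergy (Φ : ℂ → ℝ) (θ c : ℝ) (m : ℕ) (μ : Measure ℂ) : ℝ≥0∞ :=
  ∫⁻ p, ENNReal.ofReal (truncKernel Φ θ c m p) ∂(μ.prod μ)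

/-- The infimum of the shifted energy. -/
def minEnergy (Φ : ℂ → ℝ) (θ c : ℝ) : ℝ≥0∞ := ⨅ σ ∈ compactProb, mutualEnergy Φ θ c σ σ

lemma energy_eq (hP : IsPotential Φ θ c) (σ : Measure ℂ) [IsProbabilityMeasure σ] :
    energy Φ θ σ = (mutualEnergy Φ θ c σ σ : EReal) - (ENNReal.ofReal c : EReal) := by
  unfold energy
  simp only [logInvE_eq hP]
  exact extIntegral_sub_const _ hP.measurable_kernel ENNReal.ofReal_ne_top

lemma truncEnergy_le_mutualEnergy (m : ℕ) (μ : Measure ℂ) :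
    truncEnergy Φ θ c m μ ≤ mutualEnergy Φ θ c μ μ :=
  lintegral_mono fun p => ofReal_truncKernel_le m p

lemma truncEnergy_mono (μ : Measure ℂ) : Monotone fun m => truncEnergy Φ θ c m μ :=
  fun _ _ hmn => lintegral_mono fun p => ENNReal.ofReal_le_ofReal (truncKernel_mono hmn p)

lemma iSup_truncEnergy (hP : IsPotential Φ θ c) (μ : Measure ℂ) :
    ⨆ m, truncEnergy Φ θ c m μ = mutualEnergy Φ θ c μ μ := by
  unfold truncEnergy mutualEnergy
  rw [← lintegral_iSup (fun m => (hP.continuous_truncKernel m).measurable.ennreal_ofReal)]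
  · simp only [iSup_truncKernel]
  · exact fun _ _ hmn p => ENNReal.ofReal_le_ofReal (truncKernel_mono hmn p)

/-- Away from a large compact set the kernel is large. -/
lemma exists_compact_le_kernel (hP : IsPotential Φ θ c) (B : ℝ) :
    ∃ K : Set ℂ, IsCompact K ∧ ∀ p ∉ K ×ˢ K, ENNReal.ofReal B ≤ kernel Φ θ c p := by
  -- A point outside this ball has log(1+|z|) ≥ B, and the kernel is at least 4(log(1+|z|) +
  -- log(1+|w|)).
  refine ⟨Metric.closedBall 0 (Real.exp B), isCompact_closedBall _ _, fun p hp => ?_⟩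
  unfold kernel
  split_ifs with h
  · exact le_top
  refine ENNReal.ofReal_le_ofReal ?_
  have h0 := EFun_pos Φ θ h
  have h1 := Real.log_le_log h0 (hP.EFun_le p.1 p.2)
  have h2 : ∀ z : ℂ, 0 < (1 + ‖z‖) := fun z => by positivity
  have hB : ∀ z : ℂ, 0 ≤ Real.log (1 + ‖z‖) :=
    fun z => Real.log_nonneg (by linarith [norm_nonneg z])
  rw [Real.log_mul (Real.exp_pos _).ne' (mul_pos (Real.rpow_pos_of_pos (h2 _) _)
    (Real.rpow_pos_of_pos (h2 _) _)).ne', Real.log_exp, Real.log_mul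
    (Real.rpow_pos_of_pos (h2 _) _).ne' (Real.rpow_pos_of_pos (h2 _) _).ne',
    Real.log_rpow (h2 _), Real.log_rpow (h2 _)] at h1
  have hz : ∀ z : ℂ, z ∉ Metric.closedBall 0 (Real.exp B) → B ≤ Real.log (1 + ‖z‖) := by
    intro z hz
    rw [mem_closedBall_zero_iff, not_le] at hz
    rw [Real.le_log_iff_exp_le (h2 z)]
    linarith
  have h3 : B ≤ Real.log (1 + ‖p.1‖) + Real.log (1 + ‖p.2‖) := by
    by_cases h4 : p.1 ∈ Metric.closedBall 0 (Real.exp B)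
    · have h5 : p.2 ∉ Metric.closedBall 0 (Real.exp B) := fun h5 => hp ⟨h4, h5⟩
      linarith [hz _ h5, hB p.1]
    · linarith [hz _ h4, hB p.2]
  linarith [hB p.1, hB p.2]

/-! ### Energies of measures on a disc -/

/-- The nonnegative potential `2 θ Φ + c`. -/
def shiftedPotential (Φ : ℂ → ℝ) (θ c : ℝ) (z : ℂ) : ℝ := 2 * θ * Φ z + c

lemma IsPotential.shiftedPotential_nonneg (hP : IsPotential Φ θ c) (z : ℂ) :
    0 ≤ shiftedPotential Φ θ c z := by
  have h1 := hP.le z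
  have h2 : 0 ≤ Real.log (1 + ‖z‖) := Real.log_nonneg (by linarith [norm_nonneg z])
  unfold shiftedPotential
  linarith

lemma IsPotential.continuous_shiftedPotential (hP : IsPotential Φ θ c) :
    Continuous (shiftedPotential Φ θ c) := by
  have := hP.continuous
  unfold shiftedPotential
  fun_prop

/-- The kernel is a logarithm plus a function of z plus a function of w. Doubling produces |z-w|²,
the variable of the Gaussian mixture, and b ≥ 1 makes all terms nonnegative, so no subtraction in
`ℝ≥0∞` is needed. -/
lemma two_mul_kernel_add (hP : IsPotential Φ θ c) {b : ℝ} (hb : 1 ≤ b) {p : ℂ × ℂ}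
    (hp : ‖p.1 - p.2‖ ^ 2 ≤ b) :
    2 * kernel Φ θ c p + ENNReal.ofReal (Real.log b) =
      frullani b (‖p.1 - p.2‖ ^ 2) + (ENNReal.ofReal (shiftedPotential Φ θ c p.1)
        + ENNReal.ofReal (shiftedPotential Φ θ c p.2)) := by
  unfold kernel
  split_ifs with h
  · rw [h, sub_self, norm_zero, zero_pow two_ne_zero, frullani_zero (by linarith)]
    simp
  · have hn : 0 < ‖p.1 - p.2‖ := norm_pos_iff.2 (sub_ne_zero.2 h)
    have h0 : 0 ≤ c - Real.log (EFun Φ θ p.1 p.2) := by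
      have := Real.log_le_log (EFun_pos Φ θ h) (hP.EFun_le_exp p.1 p.2)
      rw [Real.log_exp] at this
      linarith
    have h1 : Real.log (EFun Φ θ p.1 p.2) = Real.log ‖p.1 - p.2‖ - θ * (Φ p.1 + Φ p.2) := by
      rw [EFun, Real.log_mul hn.ne' (Real.exp_pos _).ne', Real.log_exp]
      ring
    have h2 : Real.log (b / ‖p.1 - p.2‖ ^ 2) = Real.log b - 2 * Real.log ‖p.1 - p.2‖ := by
      rw [Real.log_div (by linarith) (by positivity), Real.log_pow]
      norm_num
    have h3 : 0 ≤ Real.log (b / ‖p.1 - p.2‖ ^ 2) :=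
      Real.log_nonneg ((one_le_div (by positivity)).2 hp)
    rw [frullani_eq (by positivity) hp, show (2 : ℝ≥0∞) = ENNReal.ofReal 2 by simp,
      ← ENNReal.ofReal_mul (by norm_num),
      ← ENNReal.ofReal_add (by linarith) (Real.log_nonneg hb),
      ← ENNReal.ofReal_add (hP.shiftedPotential_nonneg _) (hP.shiftedPotential_nonneg _),
      ← ENNReal.ofReal_add h3 (add_nonneg (hP.shiftedPotential_nonneg _)
        (hP.shiftedPotential_nonneg _))]
    congr 1
    rw [h1, h2]
    unfold shiftedPotential
    ring

lemma two_mul_mutualEnergy_add (hP : IsPotential Φ θ c) {R : ℝ} (hR : 1 ≤ R) {μ ν : Measure ℂ}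
    [IsProbabilityMeasure μ] [IsProbabilityMeasure ν]
    (hμ : ∀ᵐ z ∂μ, ‖z‖ ≤ R) (hν : ∀ᵐ z ∂ν, ‖z‖ ≤ R) :
    2 * mutualEnergy Φ θ c μ ν + ENNReal.ofReal (Real.log ((2 * R) ^ 2)) =
      logEnergy ((2 * R) ^ 2) μ ν + (∫⁻ z, ENNReal.ofReal (shiftedPotential Φ θ c z) ∂μ
        + ∫⁻ z, ENNReal.ofReal (shiftedPotential Φ θ c z) ∂ν) := by
  have hm : Measurable fun z => ENNReal.ofReal (shiftedPotential Φ θ c z) :=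
    hP.continuous_shiftedPotential.measurable.ennreal_ofReal
  have hk := hP.measurable_kernel
  have hm1 : Measurable fun p : ℂ × ℂ => ENNReal.ofReal (shiftedPotential Φ θ c p.1) :=
    hm.comp measurable_fst
  have hm2 : Measurable fun p : ℂ × ℂ => ENNReal.ofReal (shiftedPotential Φ θ c p.2) :=
    hm.comp measurable_snd
  have hmf : Measurable fun p : ℂ × ℂ => frullani ((2 * R) ^ 2) (‖p.1 - p.2‖ ^ 2) :=
    (measurable_frullani _).comp (by fun_prop)
  have e1 : ∫⁻ z, ENNReal.ofReal (shiftedPotential Φ θ c z) ∂μ =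
      ∫⁻ p, ENNReal.ofReal (shiftedPotential Φ θ c p.1) ∂(μ.prod ν) := by
    rw [lintegral_prod _ hm1.aemeasurable]
    simp
  have e2 : ∫⁻ z, ENNReal.ofReal (shiftedPotential Φ θ c z) ∂ν =
      ∫⁻ p, ENNReal.ofReal (shiftedPotential Φ θ c p.2) ∂(μ.prod ν) := by
    rw [lintegral_prod _ hm2.aemeasurable]
    simp
  have e3 : ENNReal.ofReal (Real.log ((2 * R) ^ 2)) =
      ∫⁻ _p, ENNReal.ofReal (Real.log ((2 * R) ^ 2)) ∂(μ.prod ν) := by simp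
  rw [e1, e2, e3, mutualEnergy, logEnergy, ← lintegral_const_mul _ hk,
    ← lintegral_add_right _ measurable_const, ← lintegral_add_right _ hm2,
    ← lintegral_add_left hmf]
  refine lintegral_congr_ae ?_
  filter_upwards [ae_prod_sq_norm_sub_le hμ hν] with p hp
  exact two_mul_kernel_add hP (by nlinarith) hp

/-- The potential enters linearly in each measure, so it cancels and only the convexity of the
logarithmic energy remains. -/
lemma two_mul_mutualEnergy_le (hP : IsPotential Φ θ c) {R : ℝ} (hR : 1 ≤ R) {μ ν : Measure ℂ}
    [IsProbabilityMeasure μ] [IsProbabilityMeasure ν]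
    (hμ : ∀ᵐ z ∂μ, ‖z‖ ≤ R) (hν : ∀ᵐ z ∂ν, ‖z‖ ≤ R) :
    2 * mutualEnergy Φ θ c μ ν ≤ mutualEnergy Φ θ c μ μ + mutualEnergy Φ θ c ν ν := by
  have h11 := two_mul_mutualEnergy_add hP hR hμ hμ
  have h22 := two_mul_mutualEnergy_add hP hR hν hν
  have h12 := two_mul_mutualEnergy_add hP hR hμ hν
  have hl := two_mul_logEnergy_le hμ hν
  set l : ℝ≥0∞ := ENNReal.ofReal (Real.log ((2 * R) ^ 2))
  have hlt : l ≠ ⊤ := ENNReal.ofReal_ne_top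
  set a := ∫⁻ z, ENNReal.ofReal (shiftedPotential Φ θ c z) ∂μ
  set b := ∫⁻ z, ENNReal.ofReal (shiftedPotential Φ θ c z) ∂ν
  have key : 2 * (2 * mutualEnergy Φ θ c μ ν) + 2 * l ≤
      2 * (mutualEnergy Φ θ c μ μ + mutualEnergy Φ θ c ν ν) + 2 * l := by
    calc 2 * (2 * mutualEnergy Φ θ c μ ν) + 2 * l
        = 2 * logEnergy ((2 * R) ^ 2) μ ν + 2 * (a + b) := by
          rw [← mul_add, h12, mul_add]
      _ ≤ logEnergy ((2 * R) ^ 2) μ μ + logEnergy ((2 * R) ^ 2) ν ν + 2 * (a + b) := by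
          gcongr
      _ = (logEnergy ((2 * R) ^ 2) μ μ + (a + a)) + (logEnergy ((2 * R) ^ 2) ν ν + (b + b)) := by
          ring
      _ = _ := by rw [← h11, ← h22]; ring
  have h2 := (ENNReal.add_le_add_iff_right (ENNReal.mul_ne_top (by norm_num) hlt)).1 key
  exact (ENNReal.mul_le_mul_iff_right (by norm_num) (by norm_num)).1 h2

/-- Strict convexity of the weighted energy. -/
lemma eq_of_mutualEnergy_le (hP : IsPotential Φ θ c) {R : ℝ} (hR : 1 ≤ R) {μ ν : Measure ℂ}
    [IsProbabilityMeasure μ] [IsProbabilityMeasure ν]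
    (hμ : ∀ᵐ z ∂μ, ‖z‖ ≤ R) (hν : ∀ᵐ z ∂ν, ‖z‖ ≤ R) (hfin : mutualEnergy Φ θ c μ ν ≠ ⊤)
    (h : mutualEnergy Φ θ c μ μ + mutualEnergy Φ θ c ν ν ≤ 2 * mutualEnergy Φ θ c μ ν) :
    μ = ν := by
  have h11 := two_mul_mutualEnergy_add hP hR hμ hμ
  have h22 := two_mul_mutualEnergy_add hP hR hν hν
  have h12 := two_mul_mutualEnergy_add hP hR hμ hν
  set l : ℝ≥0∞ := ENNReal.ofReal (Real.log ((2 * R) ^ 2))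
  have hlt : l ≠ ⊤ := ENNReal.ofReal_ne_top
  set a := ∫⁻ z, ENNReal.ofReal (shiftedPotential Φ θ c z) ∂μ
  set b := ∫⁻ z, ENNReal.ofReal (shiftedPotential Φ θ c z) ∂ν
  have hfin2 : logEnergy ((2 * R) ^ 2) μ ν + (a + b) ≠ ⊤ := by
    rw [← h12]
    exact ENNReal.add_ne_top.2 ⟨ENNReal.mul_ne_top (by norm_num) hfin, hlt⟩
  rw [ENNReal.add_ne_top] at hfin2
  refine eq_of_logEnergy_le hμ hν hfin2.1 ?_
  refine (ENNReal.add_le_add_iff_right (ENNReal.mul_ne_top (by norm_num : (2 : ℝ≥0∞) ≠ ⊤)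
    hfin2.2)).1 ?_
  calc logEnergy ((2 * R) ^ 2) μ μ + logEnergy ((2 * R) ^ 2) ν ν + 2 * (a + b)
      = (logEnergy ((2 * R) ^ 2) μ μ + (a + a)) + (logEnergy ((2 * R) ^ 2) ν ν + (b + b)) := by
        ring
    _ = 2 * (mutualEnergy Φ θ c μ μ + mutualEnergy Φ θ c ν ν) + 2 * l := by
        rw [← h11, ← h22]; ring
    _ ≤ 2 * (2 * mutualEnergy Φ θ c μ ν) + 2 * l := by gcongr
    _ = 2 * (2 * mutualEnergy Φ θ c μ ν + l) := by ring
    _ = _ := by rw [h12]; ring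

/-! ### The uniform measure on a disc has finite energy -/

/-- The uniform probability measure on the disc of radius `ε`. -/
def unifDisc (ε : ℝ) : Measure ℂ := ProbabilityTheory.cond volume (Metric.ball (0 : ℂ) ε)

lemma isProbabilityMeasure_unifDisc {ε : ℝ} (hε : 0 < ε) : IsProbabilityMeasure (unifDisc ε) :=
  ProbabilityTheory.cond_isProbabilityMeasure_of_finite
    (Metric.measure_ball_pos _ _ hε).ne' measure_ball_lt_top.ne

lemma unifDisc_le (ε : ℝ) :
    unifDisc ε ≤ (volume (Metric.ball (0 : ℂ) ε))⁻¹ • (volume : Measure ℂ) := by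
  unfold unifDisc ProbabilityTheory.cond
  gcongr
  exact Measure.restrict_le_self

lemma ae_unifDisc (ε : ℝ) : ∀ᵐ z ∂(unifDisc ε), ‖z‖ < ε := by
  have h := ProbabilityTheory.ae_cond_mem (μ := (volume : Measure ℂ))
    (measurableSet_ball (x := (0 : ℂ)) (ε := ε))
  filter_upwards [h] with z hz
  simpa using hz

lemma lintegral_inv_norm_ball_lt_top (r : ℝ) :
    ∫⁻ z in Metric.ball (0 : ℂ) r, (ENNReal.ofReal ‖z‖)⁻¹ < ⊤ := by
  have h := integrableOn_ball_of_norm_le_rpow (E := ℂ) (μ := volume) (f := fun z : ℂ => ‖z‖⁻¹)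
    (C := 1) (α := 1) (r := r) (by simp) (by simp) (ae_of_all _ fun z => by
      rw [Real.rpow_neg_one]; simp) (by fun_prop)
  have h2 := h.2
  rw [hasFiniteIntegral_iff_ofReal (ae_of_all _ fun z => by positivity)] at h2
  refine lt_of_le_of_lt (lintegral_mono_ae ?_) h2
  have h0 : ∀ᵐ z ∂(volume.restrict (Metric.ball (0 : ℂ) r)), z ≠ 0 :=
    ae_restrict_of_ae (by simp [ae_iff])
  filter_upwards [h0] with z hz
  rw [ENNReal.ofReal_inv_of_pos (norm_pos_iff.2 hz)]

lemma kernel_le_inv_norm (hP : IsPotential Φ θ c) (p : ℂ × ℂ) :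
    kernel Φ θ c p ≤ ENNReal.ofReal (shiftedPotential Φ θ c p.1)
      + ENNReal.ofReal (shiftedPotential Φ θ c p.2) + (ENNReal.ofReal ‖p.1 - p.2‖)⁻¹ := by
  unfold kernel
  split_ifs with h
  · simp [h]
  · have hn : 0 < ‖p.1 - p.2‖ := norm_pos_iff.2 (sub_ne_zero.2 h)
    have h1 : Real.log (EFun Φ θ p.1 p.2) = Real.log ‖p.1 - p.2‖ - θ * (Φ p.1 + Φ p.2) := by
      rw [EFun, Real.log_mul hn.ne' (Real.exp_pos _).ne', Real.log_exp]
      ring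
    have h2 : -Real.log ‖p.1 - p.2‖ ≤ ‖p.1 - p.2‖⁻¹ := by
      rw [← Real.log_inv]
      exact (Real.log_le_sub_one_of_pos (by positivity)).trans (by linarith)
    have e1 := hP.shiftedPotential_nonneg p.1
    have e2 := hP.shiftedPotential_nonneg p.2
    rw [← ENNReal.ofReal_inv_of_pos hn, ← ENNReal.ofReal_add e1 e2,
      ← ENNReal.ofReal_add (add_nonneg e1 e2) (by positivity)]
    refine ENNReal.ofReal_le_ofReal ?_
    have h3 : θ * (Φ p.1 + Φ p.2) + c =
        (shiftedPotential Φ θ c p.1 + shiftedPotential Φ θ c p.2) / 2 := by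
      unfold shiftedPotential; ring
    rw [h1]
    linarith

/-- The potential is bounded on the disc, and log(1/r) ≤ 1/r with 1/|z| locally integrable in the
plane. This makes the minimal energy finite. -/
lemma mutualEnergy_unifDisc_lt_top (hP : IsPotential Φ θ c) :
    mutualEnergy Φ θ c (unifDisc 1) (unifDisc 1) < ⊤ := by
  have := isProbabilityMeasure_unifDisc one_pos
  obtain ⟨B, hB⟩ := (isCompact_closedBall (0 : ℂ) 1).bddAbove_image
    hP.continuous_shiftedPotential.continuousOn
  have hB' : ∀ z : ℂ, ‖z‖ < 1 → ENNReal.ofReal (shiftedPotential Φ θ c z) ≤ ENNReal.ofReal B :=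
    fun z hz => ENNReal.ofReal_le_ofReal (hB ⟨z, by simpa using hz.le, rfl⟩)
  set V := (volume (Metric.ball (0 : ℂ) 1))⁻¹ with hV
  have hVt : V < ⊤ := ENNReal.inv_lt_top.2 (Metric.measure_ball_pos _ _ one_pos)
  set I := ∫⁻ z in Metric.ball (0 : ℂ) 2, (ENNReal.ofReal ‖z‖)⁻¹ with hI
  have hIt : I < ⊤ := lintegral_inv_norm_ball_lt_top 2
  have hinner : ∀ w : ℂ, ‖w‖ < 1 →
      ∫⁻ z, (ENNReal.ofReal ‖w - z‖)⁻¹ ∂(unifDisc 1) ≤ V * I := by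
    intro w hw
    -- Differences of points of the unit disc lie in the disc of radius 2; translation invariance
    -- then removes w from the bound.
    have hind : ∀ᵐ z ∂(unifDisc 1), (ENNReal.ofReal ‖w - z‖)⁻¹ ≤
        (Metric.ball (0 : ℂ) 2).indicator (fun u => (ENNReal.ofReal ‖u‖)⁻¹) (w - z) := by
      filter_upwards [ae_unifDisc 1] with z hz
      rw [Set.indicator_of_mem]
      rw [mem_ball_zero_iff]
      exact (norm_sub_le w z).trans_lt (by linarith)
    calc ∫⁻ z, (ENNReal.ofReal ‖w - z‖)⁻¹ ∂(unifDisc 1)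
        ≤ ∫⁻ z, (Metric.ball (0 : ℂ) 2).indicator (fun u => (ENNReal.ofReal ‖u‖)⁻¹) (w - z)
            ∂(unifDisc 1) := lintegral_mono_ae hind
      _ ≤ ∫⁻ z, (Metric.ball (0 : ℂ) 2).indicator (fun u => (ENNReal.ofReal ‖u‖)⁻¹) (w - z)
            ∂(V • (volume : Measure ℂ)) := lintegral_mono' (unifDisc_le 1) le_rfl
      _ = V * I := by
        rw [lintegral_smul_measure, smul_eq_mul, lintegral_sub_left_eq_self
          (fun u => (Metric.ball (0 : ℂ) 2).indicator (fun u => (ENNReal.ofReal ‖u‖)⁻¹) u) w,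
          lintegral_indicator measurableSet_ball]
  unfold mutualEnergy
  rw [lintegral_prod _ hP.measurable_kernel.aemeasurable]
  calc ∫⁻ w, ∫⁻ z, kernel Φ θ c (w, z) ∂(unifDisc 1) ∂(unifDisc 1)
      ≤ ∫⁻ _w, (ENNReal.ofReal B + ENNReal.ofReal B + V * I) ∂(unifDisc 1) := by
        refine lintegral_mono_ae ?_
        filter_upwards [ae_unifDisc 1] with w hw
        calc ∫⁻ z, kernel Φ θ c (w, z) ∂(unifDisc 1)
            ≤ ∫⁻ z, (ENNReal.ofReal B + ENNReal.ofReal B + (ENNReal.ofReal ‖w - z‖)⁻¹)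
                ∂(unifDisc 1) := by
              refine lintegral_mono_ae ?_
              filter_upwards [ae_unifDisc 1] with z hz
              exact (kernel_le_inv_norm hP (w, z)).trans
                (add_le_add_left (add_le_add (hB' w hw) (hB' z hz)) _)
          _ ≤ _ := by
              rw [lintegral_add_left measurable_const]
              simp only [lintegral_const, measure_univ, mul_one]
              exact add_le_add_right (hinner w hw) _
    _ < ⊤ := by
        simp only [lintegral_const, measure_univ, mul_one]
        exact ENNReal.add_lt_top.2 ⟨by simp, ENNReal.mul_lt_top hVt hIt⟩

lemma unifDisc_mem_compactProb {ε : ℝ} (hε : 0 < ε) : unifDisc ε ∈ compactProb := by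
  refine ⟨isProbabilityMeasure_unifDisc hε, Metric.closedBall 0 ε, isCompact_closedBall _ _, ?_⟩
  refine measure_mono_null ?_ (ae_unifDisc ε)
  intro z hz
  simp only [Set.mem_compl_iff, mem_closedBall_zero_iff, not_le] at hz
  simpa using hz.le

lemma minEnergy_lt_top (hP : IsPotential Φ θ c) : minEnergy Φ θ c < ⊤ :=
  lt_of_le_of_lt (iInf₂_le _ (unifDisc_mem_compactProb one_pos)) (mutualEnergy_unifDisc_lt_top hP)

lemma exists_ae_norm_le {σ : Measure ℂ} (hσ : σ ∈ compactProb) :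
    ∃ R : ℝ, 1 ≤ R ∧ ∀ᵐ z ∂σ, ‖z‖ ≤ R := by
  obtain ⟨-, K, hK, hσK⟩ := hσ
  obtain ⟨R, hR⟩ := hK.isBounded.exists_norm_le
  refine ⟨max R 1, le_max_right _ _, ?_⟩
  have : ∀ᵐ z ∂σ, z ∈ K := hσK
  filter_upwards [this] with z hz
  exact (hR z hz).trans (le_max_left _ _)

/-! ### Smoothing -/

lemma logEnergy_map_add_right (b : ℝ) (μ ν : Measure ℂ) [SFinite μ] [SFinite ν] (x y : ℂ) :
    logEnergy b (μ.map (x + ·)) (ν.map (y + ·)) =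
      ∫⁻ z, ∫⁻ w, frullani b (‖(x + z) - (y + w)‖ ^ 2) ∂ν ∂μ := by
  have hm := measurable_frullani b
  unfold logEnergy
  rw [lintegral_prod _ (by fun_prop), lintegral_map (by fun_prop) (by fun_prop)]
  congr with z
  rw [lintegral_map (by fun_prop) (by fun_prop)]

/-- The convolution is an average of translates of σ. The mutual energy of two translates is at most
the mean of their self-energies, and each self-energy is that of σ by translation invariance. -/
lemma logEnergy_conv_le {R ε : ℝ} (hε : 0 < ε) {σ : Measure ℂ} [IsProbabilityMeasure σ]
    (hσ : ∀ᵐ z ∂σ, ‖z‖ ≤ R) :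
    logEnergy ((2 * (R + ε)) ^ 2) ((unifDisc ε).conv σ) ((unifDisc ε).conv σ) ≤
      logEnergy ((2 * (R + ε)) ^ 2) σ σ := by
  have := isProbabilityMeasure_unifDisc hε
  set b := (2 * (R + ε)) ^ 2 with hb
  have hm := measurable_frullani b
  have hshift : ∀ x : ℂ, ‖x‖ < ε → ∀ᵐ z ∂(σ.map (x + ·)), ‖z‖ ≤ R + ε := by
    intro x hx
    rw [ae_map_iff (by fun_prop) (measurableSet_le measurable_norm measurable_const)]
    filter_upwards [hσ] with z hz
    exact (norm_add_le x z).trans (by linarith)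
  have hself : ∀ x : ℂ, logEnergy b (σ.map (x + ·)) (σ.map (x + ·)) = logEnergy b σ σ := by
    intro x
    rw [logEnergy_map_add_right, logEnergy, lintegral_prod _ (by fun_prop)]
    simp
  have hpair : ∀ x y : ℂ, ‖x‖ < ε → ‖y‖ < ε →
      logEnergy b (σ.map (x + ·)) (σ.map (y + ·)) ≤ logEnergy b σ σ := by
    intro x y hx hy
    have h1 : IsProbabilityMeasure (σ.map (x + ·)) :=
      Measure.isProbabilityMeasure_map (by fun_prop)
    have h2 : IsProbabilityMeasure (σ.map (y + ·)) :=
      Measure.isProbabilityMeasure_map (by fun_prop)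
    have h := two_mul_logEnergy_le (hshift x hx) (hshift y hy)
    rw [hself, hself, ← two_mul] at h
    exact (ENNReal.mul_le_mul_iff_right (by norm_num) (by norm_num)).1 h
  have hexp : logEnergy b ((unifDisc ε).conv σ) ((unifDisc ε).conv σ) =
      ∫⁻ x, ∫⁻ y, logEnergy b (σ.map (x + ·)) (σ.map (y + ·)) ∂(unifDisc ε) ∂(unifDisc ε) := by
    rw [logEnergy, lintegral_prod _ (by fun_prop), Measure.lintegral_conv (by fun_prop)]
    congr with x
    have : ∀ z, ∫⁻ w, frullani b (‖x + z - w‖ ^ 2) ∂((unifDisc ε).conv σ) =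
        ∫⁻ y, ∫⁻ w, frullani b (‖(x + z) - (y + w)‖ ^ 2) ∂σ ∂(unifDisc ε) := fun z =>
      Measure.lintegral_conv (by fun_prop)
    simp only [this]
    rw [lintegral_lintegral_swap (by fun_prop)]
    congr with y
    rw [logEnergy_map_add_right]
  rw [hexp]
  calc _ ≤ ∫⁻ _x, ∫⁻ _y, logEnergy b σ σ ∂(unifDisc ε) ∂(unifDisc ε) := by
        refine lintegral_mono_ae ?_
        filter_upwards [ae_unifDisc ε] with x hx
        refine lintegral_mono_ae ?_
        filter_upwards [ae_unifDisc ε] with y hy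
        exact hpair x y hx hy
    _ = _ := by simp

/-- The bounded density is what allows the test measure in Jensen's inequality to be compared with
Lebesgue measure. -/
lemma conv_unifDisc_le (ε : ℝ) (σ : Measure ℂ) [IsProbabilityMeasure σ] [SFinite (unifDisc ε)] :
    (unifDisc ε).conv σ ≤ (volume (Metric.ball (0 : ℂ) ε))⁻¹ • (volume : Measure ℂ) := by
  refine Measure.le_iff.2 fun s hs => ?_
  set V := (volume (Metric.ball (0 : ℂ) ε))⁻¹
  rw [Measure.conv_comm, ← lintegral_indicator_one hs,
    Measure.lintegral_conv (by measurability)]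
  calc ∫⁻ x, ∫⁻ y, s.indicator 1 (x + y) ∂(unifDisc ε) ∂σ
      ≤ ∫⁻ x, ∫⁻ y, s.indicator 1 (x + y) ∂(V • (volume : Measure ℂ)) ∂σ :=
        lintegral_mono fun x => lintegral_mono' (unifDisc_le ε) le_rfl
    _ = (V • (volume : Measure ℂ)) s := by
        have : ∀ x : ℂ, ∫⁻ y, s.indicator (1 : ℂ → ℝ≥0∞) (x + y) = volume s := fun x => by
          rw [lintegral_add_left_eq_self (fun y => s.indicator (1 : ℂ → ℝ≥0∞) y) x,
            lintegral_indicator_one hs]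
        simp [lintegral_smul_measure, this]

lemma ae_conv_unifDisc {R ε : ℝ} {σ : Measure ℂ} [IsProbabilityMeasure σ]
    [SFinite (unifDisc ε)] (hσ : ∀ᵐ z ∂σ, ‖z‖ ≤ R) :
    ∀ᵐ z ∂((unifDisc ε).conv σ), ‖z‖ ≤ R + ε := by
  rw [Measure.conv, ae_map_iff (by fun_prop) (measurableSet_le measurable_norm measurable_const)]
  filter_upwards [Measure.quasiMeasurePreserving_fst.ae (ae_unifDisc ε),
    Measure.quasiMeasurePreserving_snd.ae hσ] with p h1 h2
  exact (norm_add_le _ _).trans (by linarith)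

/-- Every compactly supported measure can be smoothed, with a small increase of the energy. -/
lemma exists_smooth (hP : IsPotential Φ θ c) {σ : Measure ℂ} (hσ : σ ∈ compactProb) {δ : ℝ}
    (hδ : 0 < δ) : ∃ (σ' : Measure ℂ) (V : ℝ≥0∞), IsProbabilityMeasure σ' ∧ V ≠ ⊤ ∧
      σ' ≤ V • (volume : Measure ℂ) ∧
      mutualEnergy Φ θ c σ' σ' ≤ mutualEnergy Φ θ c σ σ + ENNReal.ofReal δ := by
  obtain ⟨R, hR, hσR⟩ := exists_ae_norm_le hσ
  have hprob : IsProbabilityMeasure σ := hσ.1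
  have huc := (isCompact_closedBall (0 : ℂ) (R + 1)).uniformContinuousOn_of_continuous
    hP.continuous_shiftedPotential.continuousOn
  rw [Metric.uniformContinuousOn_iff] at huc
  obtain ⟨η, hη, huc⟩ := huc δ hδ
  -- At most η for uniform continuity of the potential, at most 1 to remain in the disc of radius R
  -- + 1.
  set ε := min η 1
  have hε : 0 < ε := lt_min hη one_pos
  have hε1 : ε ≤ 1 := min_le_right _ _
  have := isProbabilityMeasure_unifDisc hε
  set σ' := (unifDisc ε).conv σ with hσ'
  have hσ'p : IsProbabilityMeasure σ' := by rw [hσ']; infer_instance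
  have hsupp : ∀ᵐ z ∂σ', ‖z‖ ≤ R + ε := ae_conv_unifDisc hσR
  have hsupp2 : ∀ᵐ z ∂σ, ‖z‖ ≤ R + ε := by
    filter_upwards [hσR] with z hz
    linarith
  refine ⟨σ', _, hσ'p, ?_, conv_unifDisc_le ε σ, ?_⟩
  · exact (ENNReal.inv_lt_top.2 (Metric.measure_ball_pos _ _ hε)).ne
  have hpot : ∫⁻ z, ENNReal.ofReal (shiftedPotential Φ θ c z) ∂σ' ≤
      ∫⁻ z, ENNReal.ofReal (shiftedPotential Φ θ c z) ∂σ + ENNReal.ofReal δ := by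
    have hm : Measurable fun z => ENNReal.ofReal (shiftedPotential Φ θ c z) :=
      hP.continuous_shiftedPotential.measurable.ennreal_ofReal
    rw [hσ', Measure.lintegral_conv hm]
    calc ∫⁻ x, ∫⁻ z, ENNReal.ofReal (shiftedPotential Φ θ c (x + z)) ∂σ ∂(unifDisc ε)
        ≤ ∫⁻ _x, ∫⁻ z, (ENNReal.ofReal (shiftedPotential Φ θ c z) + ENNReal.ofReal δ)
            ∂σ ∂(unifDisc ε) := by
          refine lintegral_mono_ae ?_
          filter_upwards [ae_unifDisc ε] with x hx
          refine lintegral_mono_ae ?_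
          filter_upwards [hσR] with z hz
          rw [← ENNReal.ofReal_add (hP.shiftedPotential_nonneg z) hδ.le]
          refine ENNReal.ofReal_le_ofReal ?_
          have h1 := huc (x + z) (by
            rw [mem_closedBall_zero_iff]
            exact (norm_add_le x z).trans (by linarith)) z (by
            rw [mem_closedBall_zero_iff]; linarith) (by
            rw [dist_eq_norm, add_sub_cancel_right]
            exact hx.trans_le (min_le_left _ _))
          rw [Real.dist_eq] at h1
          linarith [(abs_lt.1 h1).2]
      _ = _ := by
          rw [lintegral_const, measure_univ, mul_one, lintegral_add_right _ measurable_const]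
          simp
  -- Both measures are placed in the same disc of radius R + ε, so the same logarithmic constant
  -- appears and cancels.
  have h1 := two_mul_mutualEnergy_add hP (by linarith) hsupp hsupp
  have h2 := two_mul_mutualEnergy_add hP (by linarith) hsupp2 hsupp2
  have h3 := logEnergy_conv_le hε hσR
  set l : ℝ≥0∞ := ENNReal.ofReal (Real.log ((2 * (R + ε)) ^ 2))
  have hl : l ≠ ⊤ := ENNReal.ofReal_ne_top
  have key : 2 * mutualEnergy Φ θ c σ' σ' + l ≤
      2 * (mutualEnergy Φ θ c σ σ + ENNReal.ofReal δ) + l := by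
    rw [h1, mul_add 2 (mutualEnergy Φ θ c σ σ), add_right_comm, h2]
    calc _ ≤ logEnergy ((2 * (R + ε)) ^ 2) σ σ +
          ((∫⁻ z, ENNReal.ofReal (shiftedPotential Φ θ c z) ∂σ + ENNReal.ofReal δ) +
          (∫⁻ z, ENNReal.ofReal (shiftedPotential Φ θ c z) ∂σ + ENNReal.ofReal δ)) := by
          gcongr
      _ = _ := by ring
  exact (ENNReal.mul_le_mul_iff_right (by norm_num) (by norm_num)).1
    ((ENNReal.add_le_add_iff_right hl).1 key)

/-! ### Weak limits of measures of bounded energy -/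

/-- The truncated kernel is bounded and continuous, and μ ↦ μ ⊗ μ is weakly continuous. -/
lemma continuous_truncEnergy (hP : IsPotential Φ θ c) (m : ℕ) :
    Continuous fun μ : ProbabilityMeasure ℂ => truncEnergy Φ θ c m (μ : Measure ℂ) := by
  set f : (ℂ × ℂ) →ᵇ ℝ := BoundedContinuousFunction.ofNormedAddCommGroup
    (truncKernel Φ θ c m) (hP.continuous_truncKernel m) (c + m) (fun p => by
      rw [Real.norm_of_nonneg (hP.truncKernel_nonneg m p)]
      exact truncKernel_le m p) with hf
  have h1 : Continuous fun μ : ProbabilityMeasure ℂ => μ.prod μ :=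
    ProbabilityMeasure.continuous_prod.comp (continuous_id.prodMk continuous_id)
  refine continuous_iff_continuousAt.2 fun μ => ?_
  exact ProbabilityMeasure.tendsto_iff_forall_lintegral_tendsto.1 (h1.tendsto μ) f.nnrealPart

lemma measure_compl_mul_le_truncEnergy (m : ℕ) {K : Set ℂ} (hK : MeasurableSet K)
    (h : ∀ p ∉ K ×ˢ K, ENNReal.ofReal (c + m) ≤ kernel Φ θ c p) (μ : Measure ℂ)
    [IsProbabilityMeasure μ] :
    ENNReal.ofReal (c + m) * μ Kᶜ ≤ truncEnergy Φ θ c m μ := by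
  calc ENNReal.ofReal (c + m) * μ Kᶜ
      = ∫⁻ _p in Kᶜ ×ˢ Set.univ, ENNReal.ofReal (c + m) ∂(μ.prod μ) := by simp
    _ ≤ ∫⁻ p in Kᶜ ×ˢ Set.univ, ENNReal.ofReal (truncKernel Φ θ c m p) ∂(μ.prod μ) := by
        refine setLIntegral_mono' (hK.compl.prod .univ) fun p hp => ?_
        refine (le_min (h p fun h' => hp.1 h'.1) le_rfl).trans (min_le_truncKernel m p)
    _ ≤ truncEnergy Φ θ c m μ := setLIntegral_le_lintegral _ _

/-- For a high truncation level m, Chebyshev bounds the mass off a compact set by e/(c+m) for all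
but finitely many k; each of the remaining measures is tight on its own. -/
lemma isTightMeasureSet_of_truncEnergy (hP : IsPotential Φ θ c) {μ : ℕ → ProbabilityMeasure ℂ}
    {e : ℝ≥0∞} (he : e ≠ ⊤)
    (h : ∀ m, ∀ᶠ k in atTop, truncEnergy Φ θ c m (μ k : Measure ℂ) ≤ e) :
    IsTightMeasureSet (Set.range fun k => (μ k : Measure ℂ)) := by
  rw [isTightMeasureSet_iff_exists_isCompact_measure_compl_le]
  intro ε hε
  wlog hεt : ε ≠ ⊤ generalizing ε
  · obtain ⟨K, hK, h1⟩ := this 1 one_pos (by simp)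
    exact ⟨K, hK, fun ν hν => (h1 ν hν).trans (by rw [not_not.1 hεt]; exact le_top)⟩
  obtain ⟨m, hm⟩ := exists_nat_gt (e / ε).toReal
  have hdt : e / ε ≠ ⊤ := ENNReal.div_ne_top he hε.ne'
  have hm' : e / ε < ENNReal.ofReal (c + m) := by
    rw [← ENNReal.ofReal_toReal hdt]
    exact (ENNReal.ofReal_lt_ofReal_iff (by linarith [hP.nonneg, ENNReal.toReal_nonneg (a := e / ε)])).2
      (by linarith [hP.nonneg])
  obtain ⟨K₀, hK₀, hker⟩ := exists_compact_le_kernel hP (c + m)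
  obtain ⟨n, hn⟩ := eventually_atTop.1 (h m)
  have hsing : ∀ k, ∃ K : Set ℂ, IsCompact K ∧ (μ k : Measure ℂ) Kᶜ ≤ ε := fun k => by
    have h1 : IsTightMeasureSet {(μ k : Measure ℂ)} := isTightMeasureSet_singleton
    obtain ⟨K, hK, h2⟩ := isTightMeasureSet_iff_exists_isCompact_measure_compl_le.1 h1 ε hε
    exact ⟨K, hK, h2 _ rfl⟩
  choose K hK hKε using hsing
  refine ⟨K₀ ∪ ⋃ k ∈ Finset.range n, K k,
    hK₀.union ((Finset.range n).isCompact_biUnion fun k _ => hK k), ?_⟩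
  rintro _ ⟨k, rfl⟩
  by_cases hk : k < n
  · refine (measure_mono (Set.compl_subset_compl.2 ?_)).trans (hKε k)
    exact (Set.subset_biUnion_of_mem (u := K) (by simpa using hk)).trans Set.subset_union_right
  · refine (measure_mono (Set.compl_subset_compl.2 Set.subset_union_left)).trans ?_
    have h1 := (measure_compl_mul_le_truncEnergy m hK₀.measurableSet hker (μ k)).trans
      (hn k (not_lt.1 hk))
    rw [mul_comm] at h1
    have h2 : (μ k : Measure ℂ) K₀ᶜ * (e / ε) ≤ e := le_trans (by gcongr) h1
    have hpos : ENNReal.ofReal (c + m) ≠ 0 := (lt_of_le_of_lt zero_le hm').ne'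
    have h3 := ENNReal.le_div_iff_mul_le (Or.inl hpos) (Or.inl ENNReal.ofReal_ne_top) |>.2 h1
    refine h3.trans ?_
    refine ENNReal.div_le_of_le_mul ?_
    have h4 := (ENNReal.div_le_iff_le_mul (Or.inl hε.ne') (Or.inl hεt)).1 hm'.le
    rwa [mul_comm] at h4

/-- A sequence of measures whose truncated energies are asymptotically at most `e` has a weak
cluster point of energy at most `e`. -/
lemma exists_mapClusterPt_mutualEnergy_le (hP : IsPotential Φ θ c)
    {μ : ℕ → ProbabilityMeasure ℂ} {e : ℝ≥0∞} (he : e ≠ ⊤)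
    (h : ∀ k : ℕ, truncEnergy Φ θ c k (μ k : Measure ℂ) ≤ e + ENNReal.ofReal (1 / (k + 1))) :
    ∃ ν : ProbabilityMeasure ℂ, MapClusterPt ν atTop μ ∧
      mutualEnergy Φ θ c (ν : Measure ℂ) ν ≤ e := by
  -- Truncated energies increase with the height, so the bound at height k controls every fixed
  -- height m ≤ k.
  have hev : ∀ m, ∀ ε : ℝ, 0 < ε →
      ∀ᶠ k in atTop, truncEnergy Φ θ c m (μ k : Measure ℂ) ≤ e + ENNReal.ofReal ε := by
    intro m ε hε
    filter_upwards [eventually_ge_atTop m,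
      tendsto_one_div_add_atTop_nhds_zero_nat.eventually (gt_mem_nhds hε)] with k hk hk2
    refine (truncEnergy_mono _ hk).trans ((h k).trans ?_)
    gcongr
  have ht := isTightMeasureSet_of_truncEnergy hP (e := e + ENNReal.ofReal 1) (by finiteness)
    fun m => hev m 1 one_pos
  have hcomp : IsCompact (closure (Set.range μ)) := by
    refine isCompact_closure_of_isTightMeasureSet ?_
    convert ht using 1
    ext x
    simp
  obtain ⟨ν, -, hν⟩ := hcomp.exists_mapClusterPt (f := atTop) (u := μ)
    (tendsto_principal.2 (Eventually.of_forall fun k => subset_closure ⟨k, rfl⟩))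
  refine ⟨ν, hν, ?_⟩
  -- Lower semicontinuity: at each fixed height the energy is weakly continuous, so the cluster
  -- point inherits the bound, and the supremum over heights restores the full energy.
  rw [← iSup_truncEnergy hP]
  refine iSup_le fun m => ENNReal.le_of_forall_pos_le_add fun ε hε _ => ?_
  by_contra hlt
  have hopen : ∀ᶠ (μ' : ProbabilityMeasure ℂ) in 𝓝 ν, e + ε < truncEnergy Φ θ c m (μ' : Measure ℂ) :=
    (continuous_truncEnergy hP m).continuousAt.eventually (lt_mem_nhds (not_le.1 hlt))
  have hm := hev m ε hε
  rw [ENNReal.ofReal_coe_nnreal] at hm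
  obtain ⟨k, hk1, hk2⟩ := ((hν.frequently hopen).and_eventually hm).exists
  exact absurd hk2 (not_le.2 hk1)

/-! ### Confinement of measures of nearly minimal energy. -/

/-- If a kernel is at least `B` off `K × K`, then measures lose energy when restricted to `K`. -/
lemma le_lintegral_prod_of_confined {q : ℂ × ℂ → ℝ≥0∞} (hq : Measurable q) {K : Set ℂ}
    (hK : MeasurableSet K) {j B : ℝ≥0∞}
    (hj : ∀ μ : Measure ℂ, IsProbabilityMeasure μ → μ Kᶜ = 0 → j ≤ ∫⁻ p, q p ∂(μ.prod μ))
    (hB : ∀ p ∉ K ×ˢ K, B ≤ q p) (ν : Measure ℂ) [IsProbabilityMeasure ν] :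
    ν K * ν K * j + (1 - ν K * ν K) * B ≤ ∫⁻ p, q p ∂(ν.prod ν) := by
  rw [← lintegral_add_compl _ (hK.prod hK)]
  refine add_le_add ?_ ?_
  · rw [← Measure.prod_restrict]
    by_cases h0 : ν K = 0
    · simp [h0]
    have ht : ν K ≠ ⊤ := measure_ne_top _ _
    -- Normalizing ν on K gives a competitor carried by K; undoing the normalization costs the
    -- factor ν(K)².
    have h1 := hj (ProbabilityTheory.cond ν K) (ProbabilityTheory.cond_isProbabilityMeasure h0)
      (ProbabilityTheory.ae_cond_mem hK)
    rw [lintegral_prod _ hq.aemeasurable, ProbabilityTheory.cond] at h1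
    simp only [lintegral_smul_measure, smul_eq_mul] at h1
    rw [lintegral_const_mul' _ _ (ENNReal.inv_ne_top.2 h0),
      ← lintegral_prod _ hq.aemeasurable] at h1
    calc ν K * ν K * j ≤ ν K * ν K * ((ν K)⁻¹ * ((ν K)⁻¹ *
          ∫⁻ p, q p ∂((ν.restrict K).prod (ν.restrict K)))) := by gcongr
      _ = (ν K * (ν K)⁻¹) * (ν K * (ν K)⁻¹) *
          ∫⁻ p, q p ∂((ν.restrict K).prod (ν.restrict K)) := by ring
      _ = _ := by rw [ENNReal.mul_inv_cancel h0 ht, one_mul, one_mul]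
  · calc (1 - ν K * ν K) * B = ∫⁻ _p in (K ×ˢ K)ᶜ, B ∂(ν.prod ν) := by
          rw [setLIntegral_const, prob_compl_eq_one_sub (hK.prod hK), Measure.prod_prod, mul_comm]
      _ ≤ _ := setLIntegral_mono' (hK.prod hK).compl fun p hp => hB p hp

/-- `K` is a compact set off whose square the shifted kernel exceeds the minimal energy by one. -/
def ConfinesKernel (Φ : ℂ → ℝ) (θ c : ℝ) (K : Set ℂ) : Prop :=
  IsCompact K ∧ ∀ p ∉ K ×ˢ K, minEnergy Φ θ c + 1 ≤ kernel Φ θ c p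

lemma exists_confinesKernel (hP : IsPotential Φ θ c) : ∃ K, ConfinesKernel Φ θ c K := by
  obtain ⟨K, hK, h⟩ := exists_compact_le_kernel hP (minEnergy Φ θ c + 1).toReal
  refine ⟨K, hK, fun p hp => ?_⟩
  have := h p hp
  rwa [ENNReal.ofReal_toReal (by have := (minEnergy_lt_top hP).ne; finiteness)] at this

/-- With t = ν(K), the mean of j and j + 1 with weights t² and 1 - t² is j + (1 - t²), and t² ≤ t.
-/
lemma add_le_of_convex_bound {t j e : ℝ≥0∞} (ht : t ≤ 1)
    (h : t * t * j + (1 - t * t) * (j + 1) ≤ e) : j + (1 - t) ≤ e := by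
  have htt : t * t ≤ t := mul_le_of_le_one_left' ht
  have h1 : t * t + (1 - t * t) = 1 := add_tsub_cancel_of_le (htt.trans ht)
  calc j + (1 - t) ≤ j + (1 - t * t) := by gcongr
    _ = (t * t + (1 - t * t)) * j + (1 - t * t) := by rw [h1, one_mul]
    _ = t * t * j + (1 - t * t) * (j + 1) := by ring
    _ ≤ e := h

/-- Valid without assuming compact support, which is not known in advance for a weak limit; it
forces a minimizer to give no mass to the complement of K. -/
lemma minEnergy_add_le (hP : IsPotential Φ θ c) {K : Set ℂ} (hK : ConfinesKernel Φ θ c K)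
    (ν : Measure ℂ) [IsProbabilityMeasure ν] :
    minEnergy Φ θ c + ν Kᶜ ≤ mutualEnergy Φ θ c ν ν := by
  have hm := hK.1.measurableSet
  rw [prob_compl_eq_one_sub hm]
  refine add_le_of_convex_bound prob_le_one
    (le_lintegral_prod_of_confined hP.measurable_kernel hm (fun μ h1 h2 => ?_) hK.2 ν)
  exact iInf₂_le μ ⟨h1, K, hK.1, h2⟩

lemma minEnergy_le (hP : IsPotential Φ θ c) (ν : Measure ℂ) [IsProbabilityMeasure ν] :
    minEnergy Φ θ c ≤ mutualEnergy Φ θ c ν ν := by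
  obtain ⟨K, hK⟩ := exists_confinesKernel hP
  exact le_self_add.trans (minEnergy_add_le hP hK ν)

lemma mem_compactProb_of_mutualEnergy_le (hP : IsPotential Φ θ c) {ν : Measure ℂ}
    [IsProbabilityMeasure ν] (h : mutualEnergy Φ θ c ν ν ≤ minEnergy Φ θ c) :
    ν ∈ compactProb := by
  obtain ⟨K, hK⟩ := exists_confinesKernel hP
  refine ⟨inferInstance, K, hK.1, ?_⟩
  have h1 := (minEnergy_add_le hP hK ν).trans (h.trans (add_zero _).symm.le)
  simpa using (ENNReal.add_le_add_iff_left (minEnergy_lt_top hP).ne).1 h1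

/-! ### Existence, uniqueness and stability of the minimizer. -/

lemma exists_minimizer (hP : IsPotential Φ θ c) :
    ∃ σ ∈ compactProb, mutualEnergy Φ θ c σ σ = minEnergy Φ θ c := by
  have hlt := (minEnergy_lt_top hP).ne
  have hseq : ∀ k : ℕ, ∃ σ : ProbabilityMeasure ℂ,
      mutualEnergy Φ θ c (σ : Measure ℂ) σ ≤
        minEnergy Φ θ c + ENNReal.ofReal (1 / (k + 1)) := by
    intro k
    have h1 : minEnergy Φ θ c < minEnergy Φ θ c + ENNReal.ofReal (1 / (k + 1)) :=
      ENNReal.lt_add_right hlt (ENNReal.ofReal_pos.2 (by positivity)).ne'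
    nth_rewrite 1 [minEnergy] at h1
    obtain ⟨σ, hσ, h2⟩ := by simpa only [iInf_lt_iff] using h1
    exact ⟨⟨σ, hσ.1⟩, h2.le⟩
  choose σ hσ using hseq
  obtain ⟨ν, -, hν⟩ := exists_mapClusterPt_mutualEnergy_le hP hlt
    (fun k => (truncEnergy_le_mutualEnergy k _).trans (hσ k))
  exact ⟨ν, mem_compactProb_of_mutualEnergy_le hP hν, le_antisymm hν (minEnergy_le hP ν)⟩

/-- The midpoint of two minimizers has energy at least j, so I(μ) + I(ν) + 2I(μ,ν) ≥ 4j. As I(μ),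
I(ν) ≤ j, this gives 2I(μ,ν) ≥ I(μ) + I(ν), the equality case of strict convexity. -/
lemma minimizer_unique (hP : IsPotential Φ θ c) {μ ν : Measure ℂ} [IsProbabilityMeasure μ]
    [IsProbabilityMeasure ν] (hμ : mutualEnergy Φ θ c μ μ ≤ minEnergy Φ θ c)
    (hν : mutualEnergy Φ θ c ν ν ≤ minEnergy Φ θ c) : μ = ν := by
  obtain ⟨R, hR, hμR⟩ := exists_ae_norm_le (mem_compactProb_of_mutualEnergy_le hP hμ)
  obtain ⟨S, -, hνS⟩ := exists_ae_norm_le (mem_compactProb_of_mutualEnergy_le hP hν)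
  have hμR' : ∀ᵐ z ∂μ, ‖z‖ ≤ max R S := by
    filter_upwards [hμR] with z hz using hz.trans (le_max_left _ _)
  have hνR' : ∀ᵐ z ∂ν, ‖z‖ ≤ max R S := by
    filter_upwards [hνS] with z hz using hz.trans (le_max_right _ _)
  have hR' : 1 ≤ max R S := hR.trans (le_max_left _ _)
  have hj := (minEnergy_lt_top hP).ne
  set j := minEnergy Φ θ c
  have h12 := two_mul_mutualEnergy_le hP hR' hμR' hνR'
  have hfin2 : 2 * mutualEnergy Φ θ c μ ν ≠ ⊤ :=
    ne_top_of_le_ne_top (by finiteness) (h12.trans (add_le_add hμ hν))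
  have hfin : mutualEnergy Φ θ c μ ν ≠ ⊤ := fun h => hfin2 (by rw [h]; simp)
  refine eq_of_mutualEnergy_le hP hR' hμR' hνR' hfin ?_
  -- the energy of the midpoint is at least the minimum
  have hmid : IsProbabilityMeasure ((2 : ℝ≥0∞)⁻¹ • (μ + ν)) := by
    refine ⟨?_⟩
    simp only [Measure.smul_apply, Measure.add_apply, measure_univ, smul_eq_mul]
    rw [one_add_one_eq_two, ENNReal.inv_mul_cancel (by norm_num) (by norm_num)]
  have hge := minEnergy_le hP ((2 : ℝ≥0∞)⁻¹ • (μ + ν))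
  have hk := hP.measurable_kernel
  have hsymm : mutualEnergy Φ θ c ν μ = mutualEnergy Φ θ c μ ν := by
    unfold mutualEnergy
    rw [← lintegral_prod_swap]
    simp only [kernel_swap]
  have hexp : mutualEnergy Φ θ c ((2 : ℝ≥0∞)⁻¹ • (μ + ν)) ((2 : ℝ≥0∞)⁻¹ • (μ + ν)) =
      2⁻¹ * (2⁻¹ * (mutualEnergy Φ θ c μ μ + mutualEnergy Φ θ c ν ν
        + 2 * mutualEnergy Φ θ c μ ν)) := by
    have e : ∀ a b : Measure ℂ, SFinite a → SFinite b → mutualEnergy Φ θ c a b =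
        ∫⁻ x, ∫⁻ y, kernel Φ θ c (x, y) ∂b ∂a :=
      fun a b _ _ => lintegral_prod _ hk.aemeasurable
    have hms : ∀ a : Measure ℂ, SFinite a →
        Measurable fun x => ∫⁻ y, kernel Φ θ c (x, y) ∂a := fun a _ =>
      hk.lintegral_prod_right'
    -- One copy of the mutual energy is turned into that of (ν, μ), to match the bilinear expansion
    -- of the midpoint.
    rw [two_mul (mutualEnergy Φ θ c μ ν)]
    nth_rewrite 2 [← hsymm]
    rw [e _ _ inferInstance inferInstance, e _ _ inferInstance inferInstance,
      e _ _ inferInstance inferInstance, e _ _ inferInstance inferInstance,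
      e _ _ inferInstance inferInstance]
    simp only [lintegral_smul_measure, smul_eq_mul, lintegral_add_measure]
    rw [lintegral_const_mul' _ _ (by norm_num), lintegral_const_mul' _ _ (by norm_num),
      lintegral_add_left (hms μ inferInstance), lintegral_add_left (hms μ inferInstance)]
    ring
  rw [hexp] at hge
  have h4 : 4 * j ≤ mutualEnergy Φ θ c μ μ + mutualEnergy Φ θ c ν ν
      + 2 * mutualEnergy Φ θ c μ ν := by
    calc 4 * j ≤ 4 * (2⁻¹ * (2⁻¹ * (mutualEnergy Φ θ c μ μ + mutualEnergy Φ θ c ν ν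
        + 2 * mutualEnergy Φ θ c μ ν))) := by gcongr
      _ = (2 * 2⁻¹) * (2 * 2⁻¹) * (mutualEnergy Φ θ c μ μ + mutualEnergy Φ θ c ν ν
        + 2 * mutualEnergy Φ θ c μ ν) := by ring
      _ = _ := by rw [ENNReal.mul_inv_cancel (by norm_num) (by norm_num), one_mul, one_mul]
  have h5 : (mutualEnergy Φ θ c μ μ + mutualEnergy Φ θ c ν ν) + (j + j) ≤
      2 * mutualEnergy Φ θ c μ ν + (j + j) := by
    calc _ ≤ (j + j) + (j + j) := by gcongr
      _ = 4 * j := by ring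
      _ ≤ _ := h4
      _ ≤ (j + j) + 2 * mutualEnergy Φ θ c μ ν := by gcongr
      _ = _ := add_comm _ _
  exact (ENNReal.add_le_add_iff_right (by finiteness)).1 h5

/-- The infima of the truncated energies tend to the minimal energy. -/
lemma exists_minEnergy_le_truncEnergy (hP : IsPotential Φ θ c) {ε : ℝ} (hε : 0 < ε) :
    ∃ m, ∀ ν : Measure ℂ, IsProbabilityMeasure ν →
      minEnergy Φ θ c ≤ truncEnergy Φ θ c m ν + ENNReal.ofReal ε := by
  by_contra! h
  choose ν hν h using h
  have hj := (minEnergy_lt_top hP).ne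
  have hεj : ENNReal.ofReal ε ≤ minEnergy Φ θ c := le_add_self.trans (h 0).le
  have hb : ∀ k, truncEnergy Φ θ c k (ν k) ≤ minEnergy Φ θ c - ENNReal.ofReal ε := fun k =>
    ENNReal.le_sub_of_add_le_right ENNReal.ofReal_ne_top (h k).le
  -- The counterexamples at all heights k have a cluster point whose full energy is at most the
  -- minimum minus ε.
  obtain ⟨ν', -, h'⟩ := exists_mapClusterPt_mutualEnergy_le hP
    (μ := fun k => ⟨ν k, hν k⟩) (ENNReal.sub_ne_top hj)
    (fun k => (hb k).trans le_self_add)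
  have h1 := (minEnergy_le hP (ν' : Measure ℂ)).trans h'
  have hpos : ENNReal.ofReal ε ≠ 0 := (ENNReal.ofReal_pos.2 hε).ne'
  have hj0 : minEnergy Φ θ c ≠ 0 := fun h0 => hpos (le_antisymm (h0 ▸ hεj) zero_le)
  exact absurd h1 (not_le.2 (ENNReal.sub_lt_self hj hj0 hpos))

/-- Measures of almost minimal truncated energy have little mass off a confining set. -/
lemma exists_measure_compl_le (hP : IsPotential Φ θ c) {K : Set ℂ}
    (hK : ConfinesKernel Φ θ c K) {η : ℝ} (hη : 0 < η) :
    ∃ m, ∃ δ : ℝ, 0 < δ ∧ ∀ ν : Measure ℂ, IsProbabilityMeasure ν →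
      truncEnergy Φ θ c m ν ≤ minEnergy Φ θ c + ENNReal.ofReal δ → ν Kᶜ ≤ ENNReal.ofReal η := by
  have hj := (minEnergy_lt_top hP).ne
  have hm := hK.1.measurableSet
  obtain ⟨m₁, hm₁⟩ := exists_minEnergy_le_truncEnergy hP (half_pos hη)
  obtain ⟨m₂, hm₂⟩ := exists_nat_ge (minEnergy Φ θ c + 1).toReal
  -- The level m₁ brings the truncated infimum within η/2 of the minimum; m₂ puts the cut above j +
  -- 1, so K still confines the truncated kernel.
  refine ⟨max m₁ m₂, η / 2, half_pos hη, fun ν hν h => ?_⟩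
  set m := max m₁ m₂
  set j := minEnergy Φ θ c
  set d := ENNReal.ofReal (η / 2)
  have hbig : j + 1 ≤ ENNReal.ofReal (c + m) := by
    rw [← ENNReal.ofReal_toReal (show j + 1 ≠ ⊤ by finiteness)]
    refine ENNReal.ofReal_le_ofReal (hm₂.trans ?_)
    have : (m₂ : ℝ) ≤ m := by exact_mod_cast le_max_right m₁ m₂
    linarith [hP.nonneg]
  -- Adding the constant η/2 to the truncated kernel restores the lower bound j, so the confinement
  -- estimate applies to it.
  have hlow : ∀ μ : Measure ℂ, IsProbabilityMeasure μ → μ Kᶜ = 0 →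
      j ≤ ∫⁻ p, (ENNReal.ofReal (truncKernel Φ θ c m p) + d) ∂(μ.prod μ) := by
    intro μ hμ _
    rw [lintegral_add_right _ measurable_const]
    simp only [lintegral_const, measure_univ, mul_one]
    exact (hm₁ μ hμ).trans (add_le_add_left (truncEnergy_mono μ (le_max_left _ _)) _)
  have hmeas : Measurable fun p => ENNReal.ofReal (truncKernel Φ θ c m p) + d :=
    (hP.continuous_truncKernel m).measurable.ennreal_ofReal.add_const d
  have h1 := add_le_of_convex_bound prob_le_one
    (le_lintegral_prod_of_confined hmeas hm hlow (B := j + 1) (fun p hp =>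
      ((le_min (hK.2 p hp) hbig).trans (min_le_truncKernel m p)).trans le_self_add) ν)
  rw [lintegral_add_right _ measurable_const] at h1
  simp only [lintegral_const, measure_univ, mul_one] at h1
  rw [prob_compl_eq_one_sub hm]
  have h2 : j + (1 - ν K) ≤ j + (d + d) := by
    refine h1.trans ?_
    rw [← add_assoc]
    exact add_le_add_left h _
  have h3 := (ENNReal.add_le_add_iff_left hj).1 h2
  rwa [← ENNReal.ofReal_add (half_pos hη).le (half_pos hη).le, add_halves] at h3

/-- Measures of almost minimal truncated energy are weakly close to the minimizer. -/
lemma exists_norm_integral_sub_lt (hP : IsPotential Φ θ c) {σ : Measure ℂ}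
    [IsProbabilityMeasure σ] (hσ : mutualEnergy Φ θ c σ σ ≤ minEnergy Φ θ c) {n : ℕ}
    (f : (Fin n → ℂ) →ᵇ ℂ) {ε : ℝ} (hε : 0 < ε) :
    ∃ m, ∃ δ : ℝ, 0 < δ ∧ ∀ ν : Measure ℂ, IsProbabilityMeasure ν →
      truncEnergy Φ θ c m ν ≤ minEnergy Φ θ c + ENNReal.ofReal δ →
      ‖∫ z, f z ∂(Measure.pi fun _ : Fin n => ν) - ∫ z, f z ∂(Measure.pi fun _ : Fin n => σ)‖
        < ε := by
  by_contra! h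
  have hseq : ∀ k : ℕ, ∃ ν : ProbabilityMeasure ℂ, truncEnergy Φ θ c k (ν : Measure ℂ) ≤
      minEnergy Φ θ c + ENNReal.ofReal (1 / (k + 1)) ∧
      ε ≤ ‖∫ z, f z ∂(Measure.pi fun _ : Fin n => (ν : Measure ℂ))
        - ∫ z, f z ∂(Measure.pi fun _ : Fin n => σ)‖ := fun k => by
    obtain ⟨ν, hν, h1, h2⟩ := h k (1 / (k + 1)) (by positivity)
    exact ⟨⟨ν, hν⟩, h1, h2⟩
  choose ν hν hfar using hseq
  -- The cluster point of the supposed counterexamples is a minimizer, hence σ; weak continuity of ν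
  -- ↦ ν^{⊗n} then contradicts their distance ε.
  obtain ⟨ν', hcl, hmin⟩ := exists_mapClusterPt_mutualEnergy_le hP (minEnergy_lt_top hP).ne hν
  have heq : (ν' : Measure ℂ) = σ := minimizer_unique hP hmin hσ
  have hcont : Continuous fun ν : ProbabilityMeasure ℂ =>
      ∫ z, f z ∂(Measure.pi fun _ : Fin n => (ν : Measure ℂ)) := by
    have h1 : Continuous fun ν : ProbabilityMeasure ℂ =>
        ProbabilityMeasure.pi fun _ : Fin n => ν :=
      ProbabilityMeasure.continuous_pi.comp (continuous_pi fun _ => continuous_id)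
    refine continuous_iff_continuousAt.2 fun ν => ?_
    exact (ProbabilityMeasure.tendsto_iff_forall_integral_rclike_tendsto ℂ).1 (h1.tendsto ν) f
  have hnear : ∀ᶠ (ν : ProbabilityMeasure ℂ) in 𝓝 ν', ‖∫ z, f z ∂(Measure.pi fun _ : Fin n => (ν : Measure ℂ))
        - ∫ z, f z ∂(Measure.pi fun _ : Fin n => σ)‖ < ε := by
    refine (hcont.sub continuous_const).norm.continuousAt.eventually (gt_mem_nhds ?_)
    simpa [heq] using hε
  obtain ⟨k, hk⟩ := (hcl.frequently hnear).exists
  exact absurd (hfar k) (not_le.2 hk)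

/-! ### Products over pairs and product measures -/

lemma prod_offDiag_eq_prod_prod {ι M : Type*} [Fintype ι] [DecidableEq ι] [CommMonoid M]
    (f : ι × ι → M) :
    ∏ p ∈ (Finset.univ : Finset ι).offDiag, f p = ∏ i, ∏ j ∈ Finset.univ.erase i, f (i, j) :=
  Finset.prod_finset_product _ _ _ fun p => by simp [eq_comm]

/-- Each index occurs in 2(N-1) ordered pairs, N-1 times in each position. -/
lemma prod_offDiag_mul {N : ℕ} {M : Type*} [CommMonoid M] (g : Fin N → M) :
    ∏ p ∈ (Finset.univ : Finset (Fin N)).offDiag, (g p.1 * g p.2) =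
      (∏ i, g i) ^ (2 * (N - 1)) := by
  have h1 : ∏ p ∈ (Finset.univ : Finset (Fin N)).offDiag, g p.1 = (∏ i, g i) ^ (N - 1) := by
    rw [prod_offDiag_eq_prod_prod]
    simp [Finset.prod_pow]
  have h2 : ∏ p ∈ (Finset.univ : Finset (Fin N)).offDiag, g p.2 = (∏ i, g i) ^ (N - 1) := by
    rw [← h1]
    refine Finset.prod_equiv (Equiv.prodComm _ _) (fun p => by simp [eq_comm]) (fun p _ => rfl)
  rw [Finset.prod_mul_distrib, h1, h2, ← pow_add, two_mul]

lemma norm_vanDerMonde_sq {N : ℕ} (z : Fin N → ℂ) :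
    ‖vanDerMonde z‖ ^ 2 =
      ∏ p ∈ (Finset.univ : Finset (Fin N)).offDiag, ‖z p.1 - z p.2‖ := by
  have h1 : (Finset.univ : Finset (Fin N)).offDiag =
      Finset.univ.filter (fun p : Fin N × Fin N => p.1 < p.2) ∪
        Finset.univ.filter (fun p : Fin N × Fin N => p.2 < p.1) := by
    ext p
    simp [lt_or_lt_iff_ne]
  have h2 : Disjoint (Finset.univ.filter fun p : Fin N × Fin N => p.1 < p.2)
      (Finset.univ.filter fun p : Fin N × Fin N => p.2 < p.1) := by
    rw [Finset.disjoint_filter]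
    intro p _ h h'
    exact absurd h (not_lt.2 h'.le)
  have h3 : ∏ p : Fin N × Fin N with p.2 < p.1, ‖z p.1 - z p.2‖ =
      ∏ p : Fin N × Fin N with p.1 < p.2, ‖z p.1 - z p.2‖ :=
    Finset.prod_equiv (Equiv.prodComm _ _) (fun p => by simp) fun p _ => norm_sub_rev _ _
  rw [h1, Finset.prod_union h2, h3, vanDerMonde, norm_prod, sq]

lemma lintegral_fin_prod_eq_prod {n : ℕ} {E : Type*} [MeasurableSpace E] (μ : Measure E)
    [SigmaFinite μ] {f : Fin n → E → ℝ≥0∞} (hf : ∀ i, Measurable (f i)) :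
    ∫⁻ x, ∏ i, f i (x i) ∂(Measure.pi fun _ : Fin n => μ) = ∏ i, ∫⁻ x, f i x ∂μ := by
  induction n with
  | zero => simp
  | succ n ih =>
    have hm : Measurable fun y : Fin n → E => ∏ i, f (Fin.succ i) (y i) :=
      Finset.measurable_fun_prod _ fun i _ => (hf _).comp (measurable_pi_apply i)
    rw [← (measurePreserving_piFinSuccAbove (fun _ : Fin (n + 1) => μ) 0).symm.lintegral_comp_emb
      (MeasurableEquiv.measurableEmbedding _)]
    simp only [MeasurableEquiv.piFinSuccAbove_symm_apply, Fin.insertNthEquiv, Equiv.coe_fn_mk,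
      Fin.prod_univ_succ, Fin.insertNth_zero, Fin.cons_zero, Fin.cons_succ, cast_eq]
    rw [lintegral_prod_mul (hf 0).aemeasurable hm.aemeasurable, ih fun i => hf _]

lemma pi_withDensity {n : ℕ} {E : Type*} [MeasurableSpace E] (μ : Measure E) [SigmaFinite μ]
    {g : E → ℝ≥0∞} (hg : Measurable g) [SigmaFinite (μ.withDensity g)] :
    Measure.pi (fun _ : Fin n => μ.withDensity g) =
      (Measure.pi fun _ : Fin n => μ).withDensity fun z => ∏ i, g (z i) := by
  refine Measure.pi_eq fun s hs => ?_
  have hS : MeasurableSet (Set.univ.pi s) := .univ_pi hs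
  rw [withDensity_apply _ hS, ← lintegral_indicator hS]
  have h1 : (Set.univ.pi s).indicator (fun z : Fin n → E => ∏ i, g (z i)) =
      fun z => ∏ i, (s i).indicator g (z i) := by
    ext z
    by_cases hz : z ∈ Set.univ.pi s
    · rw [Set.indicator_of_mem hz]
      refine Finset.prod_congr rfl fun i _ => ?_
      rw [Set.indicator_of_mem (hz i (Set.mem_univ i))]
    · rw [Set.indicator_of_notMem hz]
      simp only [Set.mem_univ_pi, not_forall] at hz
      obtain ⟨i, hi⟩ := hz
      exact (Finset.prod_eq_zero (Finset.mem_univ i) (Set.indicator_of_notMem hi _)).symm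
  rw [h1, lintegral_fin_prod_eq_prod μ fun i => hg.indicator (hs i)]
  refine Finset.prod_congr rfl fun i _ => ?_
  rw [lintegral_indicator (hs i), withDensity_apply _ (hs i)]

/-- The Radon–Nikodym density is at most V almost everywhere, so the product density is at most V^n.
-/
lemma pi_le_smul_pi {n : ℕ} {E : Type*} [MeasurableSpace E] {σ μ : Measure E} [SigmaFinite σ]
    [SigmaFinite μ] {V : ℝ≥0∞} (h : σ ≤ V • μ) :
    Measure.pi (fun _ : Fin n => σ) ≤ V ^ n • Measure.pi fun _ : Fin n => μ := by
  have hac : σ ≪ μ := (Measure.absolutelyContinuous_of_le h).trans Measure.smul_absolutelyContinuous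
  have hd : μ.withDensity (σ.rnDeriv μ) = σ := Measure.withDensity_rnDeriv_eq _ _ hac
  have hle : ∀ᵐ x ∂μ, σ.rnDeriv μ x ≤ V := by
    refine ae_le_of_forall_setLIntegral_le_of_sigmaFinite (Measure.measurable_rnDeriv _ _)
      fun s hs _ => ?_
    rw [← withDensity_apply _ hs, hd, setLIntegral_const]
    exact h s
  have : SigmaFinite (μ.withDensity (σ.rnDeriv μ)) := by rw [hd]; infer_instance
  have h2 := pi_withDensity (n := n) μ (Measure.measurable_rnDeriv σ μ)
  simp only [hd] at h2
  rw [h2, ← withDensity_const]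
  refine withDensity_mono ?_
  have h3 : ∀ᵐ z ∂(Measure.pi fun _ : Fin n => μ), ∀ i, σ.rnDeriv μ (z i) ≤ V :=
    ae_all_iff.2 fun i => (Measure.quasiMeasurePreserving_eval (fun _ : Fin n => μ) i).ae hle
  filter_upwards [h3] with z hz
  calc ∏ i, σ.rnDeriv μ (z i) ≤ ∏ _i : Fin n, V := Finset.prod_le_prod' fun i _ => hz i
    _ = V ^ n := by simp

lemma map_pi_eval_pair {n : ℕ} {E : Type*} [MeasurableSpace E] (σ : Measure E)
    [IsProbabilityMeasure σ] {i j : Fin n} (hij : i ≠ j) :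
    (Measure.pi fun _ : Fin n => σ).map (fun z => (z i, z j)) = σ.prod σ := by
  have h := (ProbabilityTheory.iIndepFun_pi (μ := fun _ : Fin n => σ) (X := fun _ x => x)
    fun _ => aemeasurable_id).indepFun hij
  rw [ProbabilityTheory.indepFun_iff_map_prod_eq_prod_map_map
    (measurable_pi_apply i).aemeasurable (measurable_pi_apply j).aemeasurable] at h
  rw [h, (measurePreserving_eval (fun _ : Fin n => σ) i).map_eq,
    (measurePreserving_eval (fun _ : Fin n => σ) j).map_eq]

lemma map_concat_pi {n N : ℕ} (hn : n ≤ N) (μ : Measure ℂ) [SigmaFinite μ] :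
    ((Measure.pi fun _ : Fin n => μ).prod (Measure.pi fun _ : Fin (N - n) => μ)).map
      (fun p => (concat p.1 p.2 : Fin N → ℂ)) = Measure.pi fun _ : Fin N => μ := by
  obtain ⟨k, rfl⟩ := Nat.exists_eq_add_of_le hn
  have hmeas : Measurable fun p : (Fin n → ℂ) × (Fin (n + k - n) → ℂ) =>
      (concat p.1 p.2 : Fin (n + k) → ℂ) := by
    refine measurable_pi_lambda _ fun i => ?_
    unfold concat
    split_ifs <;> fun_prop
  have e : n + k - n = k := by omega
  symm
  refine Measure.pi_eq fun s hs => ?_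
  rw [Measure.map_apply hmeas (.univ_pi hs)]
  have hpre : (fun p : (Fin n → ℂ) × (Fin (n + k - n) → ℂ) => (concat p.1 p.2 : Fin (n + k) → ℂ))
      ⁻¹' (Set.univ.pi s) = (Set.univ.pi fun i : Fin n => s (Fin.castAdd k i)) ×ˢ
        (Set.univ.pi fun i : Fin (n + k - n) => s (Fin.natAdd n (Fin.cast e i))) := by
    ext p
    simp only [Set.mem_preimage, Set.mem_univ_pi, Set.mem_prod]
    constructor
    · intro h
      refine ⟨fun i => ?_, fun i => ?_⟩
      · have := h (Fin.castAdd k i)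
        simpa [concat] using this
      · have := h (Fin.natAdd n (Fin.cast e i))
        simpa [concat] using this
    · rintro ⟨h1, h2⟩ i
      unfold concat
      split_ifs with hi
      · exact h1 ⟨i, hi⟩
      · have := h2 ⟨i - n, by have := i.isLt; omega⟩
        convert this
        ext
        simp
        omega
  rw [hpre, Measure.prod_prod, Measure.pi_pi, Measure.pi_pi, Fin.prod_univ_add]
  congr 1
  exact Fintype.prod_equiv (finCongr e) _ _ fun i => rfl

/-! ### The Gibbs measure of `N` particles -/

/-- The density `∏_{i ≠ j} E(z_i, z_j)`. -/
def weight (Φ : ℂ → ℝ) (θ : ℝ) {N : ℕ} (z : Fin N → ℂ) : ℝ :=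
  ∏ p ∈ (Finset.univ : Finset (Fin N)).offDiag, EFun Φ θ (z p.1) (z p.2)

/-- The total mass of the density `weight`. -/
def gibbsZ (Φ : ℂ → ℝ) (θ : ℝ) (N : ℕ) : ℝ≥0∞ :=
  ∫⁻ z : Fin N → ℂ, ENNReal.ofReal (weight Φ θ z)

/-- The probability measure on `ℂ^N` with density proportional to `weight`. -/
def gibbs (Φ : ℂ → ℝ) (θ : ℝ) (N : ℕ) : Measure (Fin N → ℂ) :=
  (gibbsZ Φ θ N)⁻¹ • volume.withDensity fun z => ENNReal.ofReal (weight Φ θ z)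

lemma weight_nonneg {N : ℕ} (z : Fin N → ℂ) : 0 ≤ weight Φ θ z :=
  Finset.prod_nonneg fun _ _ => EFun_nonneg _ _ _ _

lemma continuous_weight (hP : IsPotential Φ θ c) (N : ℕ) :
    Continuous fun z : Fin N → ℂ => weight Φ θ z :=
  continuous_finsetProd _ fun p _ =>
    hP.continuous_EFun.comp (f := fun z : Fin N → ℂ => (z p.1, z p.2)) (by fun_prop)

lemma measurable_ofReal_weight (hP : IsPotential Φ θ c) (N : ℕ) :
    Measurable fun z : Fin N → ℂ => ENNReal.ofReal (weight Φ θ z) :=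
  (continuous_weight hP N).measurable.ennreal_ofReal

lemma weight_le_prod_tailFactor {N : ℕ} (z : Fin N → ℂ) :
    weight Φ θ z ≤ (∏ i, tailFactor Φ θ (z i)) ^ (2 * (N - 1)) := by
  rw [← prod_offDiag_mul]
  exact Finset.prod_le_prod (fun _ _ => EFun_nonneg _ _ _ _)
    fun p _ => EFun_le_tailFactor_mul _ _ _ _

/-- Each Φ(z_i) is collected 2(N-1) times with coefficient θ, and 2(N-1)/(2τ) = (N-1)/τ = β. -/
lemma weight_eq {N : ℕ} (hN : 1 ≤ N) {τ : ℝ} (hτ : 0 < τ) (z : Fin N → ℂ) :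
    weight Φ (1 / (2 * τ)) z =
      ‖vanDerMonde z‖ ^ 2 * ∏ i, Real.exp (-(((N : ℝ) - 1) / τ) * Φ (z i)) := by
  have h1 : ∀ a b : ℂ, EFun Φ (1 / (2 * τ)) a b = ‖a - b‖ *
      (Real.exp (-(1 / (2 * τ)) * Φ a) * Real.exp (-(1 / (2 * τ)) * Φ b)) := fun a b => by
    rw [EFun, mul_add (-(1 / (2 * τ))), Real.exp_add]
  unfold weight
  simp only [h1]
  rw [Finset.prod_mul_distrib, ← norm_vanDerMonde_sq,
    prod_offDiag_mul (fun i => Real.exp (-(1 / (2 * τ)) * Φ (z i))), ← Finset.prod_pow]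
  congr 1
  refine Finset.prod_congr rfl fun i _ => ?_
  rw [← Real.exp_nat_mul]
  congr 1
  rw [Nat.cast_mul, Nat.cast_sub hN]
  field_simp
  push_cast
  ring

/-- The integral of `(1 + |z|) e^{-θΦ(z)}`. -/
def tailMass (Φ : ℂ → ℝ) (θ : ℝ) : ℝ≥0∞ := ∫⁻ z : ℂ, ENNReal.ofReal (tailFactor Φ θ z)

lemma measurable_tailFactor (hP : IsPotential Φ θ c) : Measurable (tailFactor Φ θ) := by
  have := hP.continuous
  have : Continuous (tailFactor Φ θ) := by unfold tailFactor; fun_prop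
  exact this.measurable

lemma tailMass_lt_top (hP : IsPotential Φ θ c) : tailMass Φ θ < ⊤ := by
  have h : Integrable fun z : ℂ => Real.exp (c / 2) * (1 + ‖z‖) ^ (-4 : ℝ) :=
    (integrable_one_add_norm (by simp; norm_num)).const_mul _
  have h2 := h.2
  rw [hasFiniteIntegral_iff_ofReal (ae_of_all _ fun z => by positivity)] at h2
  exact lt_of_le_of_lt
    (lintegral_mono fun z => ENNReal.ofReal_le_ofReal (hP.tailFactor_le z)) h2

/-- The mass of the density `weight` on a sublevel set. -/
lemma setLIntegral_weight_le (hP : IsPotential Φ θ c) {N : ℕ} (hN : 2 ≤ N) {a : ℝ} (ha : 0 ≤ a)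
    {S : Set (Fin N → ℂ)} (hS : MeasurableSet S) (h : ∀ z ∈ S, weight Φ θ z ≤ a) :
    ∫⁻ z in S, ENNReal.ofReal (weight Φ θ z) ≤
      ENNReal.ofReal (a ^ (1 - 1 / (2 * ((N : ℝ) - 1)))) * tailMass Φ θ ^ N := by
  have hN' : (2 : ℝ) ≤ N := by exact_mod_cast hN
  -- With this s, weight^s is at most the product of first powers of the tail factors, which is
  -- integrable; the other factor, weight^(1-s), is bounded by the sublevel.
  set s : ℝ := 1 / (2 * ((N : ℝ) - 1)) with hs
  have hs0 : 0 < s := by rw [hs]; apply one_div_pos.2; linarith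
  have hs1 : s ≤ 1 := by rw [hs, div_le_one (by linarith)]; linarith
  have hcast : ((2 * (N - 1) : ℕ) : ℝ) * s = 1 := by
    rw [Nat.cast_mul, Nat.cast_sub (by omega), hs]
    have : (N : ℝ) - 1 ≠ 0 := by linarith
    push_cast
    field_simp
  have hpt : ∀ z ∈ S, ENNReal.ofReal (weight Φ θ z) ≤
      ENNReal.ofReal (a ^ (1 - s)) * ∏ i, ENNReal.ofReal (tailFactor Φ θ (z i)) := by
    intro z hz
    have hw := weight_nonneg (Φ := Φ) (θ := θ) z
    have hprod : 0 ≤ ∏ i, tailFactor Φ θ (z i) :=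
      Finset.prod_nonneg fun i _ => tailFactor_nonneg _ _ _
    rw [← ENNReal.ofReal_prod_of_nonneg fun i _ => tailFactor_nonneg _ _ _,
      ← ENNReal.ofReal_mul (by positivity)]
    refine ENNReal.ofReal_le_ofReal ?_
    calc weight Φ θ z = weight Φ θ z ^ (1 - s) * weight Φ θ z ^ s := by
          rw [← Real.rpow_add_of_nonneg hw (by linarith) hs0.le]
          simp
      _ ≤ a ^ (1 - s) * ((∏ i, tailFactor Φ θ (z i)) ^ (2 * (N - 1))) ^ s := by
          refine mul_le_mul (Real.rpow_le_rpow hw (h z hz) (by linarith))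
            (Real.rpow_le_rpow hw (weight_le_prod_tailFactor z) hs0.le) (by positivity)
            (by positivity)
      _ = a ^ (1 - s) * ∏ i, tailFactor Φ θ (z i) := by
          rw [← Real.rpow_natCast, ← Real.rpow_mul hprod, hcast, Real.rpow_one]
  have hm := measurable_tailFactor hP
  calc ∫⁻ z in S, ENNReal.ofReal (weight Φ θ z)
      ≤ ∫⁻ z in S, ENNReal.ofReal (a ^ (1 - s)) * ∏ i, ENNReal.ofReal (tailFactor Φ θ (z i)) :=
        setLIntegral_mono' hS hpt
    _ ≤ ∫⁻ z : Fin N → ℂ,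
          ENNReal.ofReal (a ^ (1 - s)) * ∏ i, ENNReal.ofReal (tailFactor Φ θ (z i)) :=
        setLIntegral_le_lintegral _ _
    _ = _ := by
        rw [lintegral_const_mul' _ _ ENNReal.ofReal_ne_top, volume_pi,
          lintegral_fin_prod_eq_prod volume (f := fun _ z => ENNReal.ofReal (tailFactor Φ θ z))
            fun _ => hm.ennreal_ofReal]
        simp [tailMass]

lemma gibbsZ_lt_top (hP : IsPotential Φ θ c) {N : ℕ} (hN : 2 ≤ N) : gibbsZ Φ θ N < ⊤ := by
  have h := setLIntegral_weight_le hP hN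
    (a := ∏ _p ∈ (Finset.univ : Finset (Fin N)).offDiag, Real.exp c) (S := Set.univ)
    (Finset.prod_nonneg fun _ _ => (Real.exp_pos c).le) .univ fun z _ =>
      Finset.prod_le_prod (fun _ _ => EFun_nonneg _ _ _ _) fun p _ => hP.EFun_le_exp _ _
  rw [setLIntegral_univ] at h
  exact h.trans_lt (ENNReal.mul_lt_top ENNReal.ofReal_lt_top
    (ENNReal.pow_lt_top (tailMass_lt_top hP)))

/-- A lower bound for the partition function, from Jensen's inequality. -/
lemma exp_le_mul_gibbsZ (hP : IsPotential Φ θ c) {N : ℕ} {σ : Measure ℂ}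
    [IsProbabilityMeasure σ] {V : ℝ≥0∞} (hσ : σ ≤ V • (volume : Measure ℂ))
    (hfin : mutualEnergy Φ θ c σ σ ≠ ⊤) :
    ENNReal.ofReal (Real.exp (-((N * N - N : ℕ) * ((mutualEnergy Φ θ c σ σ).toReal - c)))) ≤
      V ^ N * gibbsZ Φ θ N := by
  set J := mutualEnergy Φ θ c σ σ with hJ
  set P := Measure.pi fun _ : Fin N => σ
  have hk := hP.measurable_kernel
  -- the logarithm of `E` is integrable
  have hlt : ∀ᵐ p ∂(σ.prod σ), kernel Φ θ c p < ⊤ := ae_lt_top hk hfin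
  have hlog : ∀ᵐ p ∂(σ.prod σ),
      Real.log (EFun Φ θ p.1 p.2) = c - (kernel Φ θ c p).toReal := by
    filter_upwards [hlt] with p hp
    have hne : p.1 ≠ p.2 := fun h => by simp [kernel, h] at hp
    have h1 := Real.log_le_log (EFun_pos Φ θ hne) (hP.EFun_le_exp p.1 p.2)
    rw [Real.log_exp] at h1
    rw [kernel, if_neg hne, ENNReal.toReal_ofReal (by linarith)]
    ring
  have hint0 : Integrable (fun p => (kernel Φ θ c p).toReal) (σ.prod σ) :=
    integrable_toReal_of_lintegral_ne_top hk.aemeasurable hfin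
  have hint : Integrable (fun p : ℂ × ℂ => Real.log (EFun Φ θ p.1 p.2)) (σ.prod σ) :=
    ((integrable_const c).sub hint0).congr (hlog.mono fun p hp => hp.symm)
  have hval : ∫ p, Real.log (EFun Φ θ p.1 p.2) ∂(σ.prod σ) = -(J.toReal - c) := by
    rw [integral_congr_ae hlog, integral_sub (integrable_const c) hint0,
      integral_toReal hk.aemeasurable hlt]
    simp [hJ, mutualEnergy]
  have hmp : ∀ q ∈ (Finset.univ : Finset (Fin N)).offDiag,
      MeasurePreserving (fun z : Fin N → ℂ => (z q.1, z q.2)) P (σ.prod σ) := fun q hq =>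
    ⟨by fun_prop, map_pi_eval_pair σ (Finset.mem_offDiag.1 hq).2.2⟩
  have hintP : ∀ q ∈ (Finset.univ : Finset (Fin N)).offDiag,
      Integrable (fun z : Fin N → ℂ => Real.log (EFun Φ θ (z q.1) (z q.2))) P := fun q hq =>
    (hmp q hq).integrable_comp_of_integrable hint
  have hlogm : Measurable fun p : ℂ × ℂ => Real.log (EFun Φ θ p.1 p.2) :=
    hP.continuous_EFun.measurable.log
  have hvalP : ∀ q ∈ (Finset.univ : Finset (Fin N)).offDiag,
      ∫ z : Fin N → ℂ, Real.log (EFun Φ θ (z q.1) (z q.2)) ∂P = -(J.toReal - c) := fun q hq => by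
    rw [← hval, ← (hmp q hq).map_eq, integral_map (hmp q hq).measurable.aemeasurable
      hlogm.aestronglyMeasurable]
  have hposP : ∀ᵐ z ∂P, ∀ q ∈ (Finset.univ : Finset (Fin N)).offDiag,
      EFun Φ θ (z q.1) (z q.2) ≠ 0 := by
    refine (eventually_all_finset _).2 fun q hq => ?_
    have h1 := (hmp q hq).quasiMeasurePreserving.ae hlt
    filter_upwards [h1] with z hz
    have hne : z q.1 ≠ z q.2 := fun h => by simp [kernel, h] at hz
    exact (EFun_pos Φ θ hne).ne'
  have hexp : ∀ᵐ z ∂P, Real.exp (∑ q ∈ (Finset.univ : Finset (Fin N)).offDiag,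
      Real.log (EFun Φ θ (z q.1) (z q.2))) = weight Φ θ z := by
    filter_upwards [hposP] with z hz
    rw [Real.exp_sum]
    exact Finset.prod_congr rfl fun q hq =>
      Real.exp_log ((EFun_nonneg _ _ _ _).lt_of_ne' (hz q hq))
  have hwint : Integrable (fun z => weight Φ θ z) P := by
    refine Integrable.mono' (g := fun _ => ∏ _p ∈ (Finset.univ : Finset (Fin N)).offDiag,
      Real.exp c) (integrable_const _) (continuous_weight hP N).aestronglyMeasurable
      (ae_of_all _ fun z => ?_)
    rw [Real.norm_of_nonneg (weight_nonneg z)]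
    exact Finset.prod_le_prod (fun _ _ => EFun_nonneg _ _ _ _) fun p _ => hP.EFun_le_exp _ _
  -- Under the product measure each of the N² - N ordered pairs has law σ ⊗ σ and contributes -(J -
  -- c) to the mean of log weight.
  have hjensen := convexOn_exp.map_integral_le (μ := P) Real.continuous_exp.continuousOn
    isClosed_univ (f := fun z : Fin N → ℂ => ∑ q ∈ (Finset.univ : Finset (Fin N)).offDiag,
      Real.log (EFun Φ θ (z q.1) (z q.2))) (ae_of_all _ fun _ => Set.mem_univ _)
    (integrable_finsetSum _ hintP) (hwint.congr (hexp.mono fun z hz => hz.symm))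
  rw [integral_finsetSum _ hintP, Finset.sum_congr rfl hvalP, integral_congr_ae hexp] at hjensen
  simp only [Finset.sum_const, Finset.offDiag_card, Finset.card_univ, Fintype.card_fin,
    nsmul_eq_mul] at hjensen
  calc _ ≤ ENNReal.ofReal (∫ z, weight Φ θ z ∂P) := by
        refine ENNReal.ofReal_le_ofReal (le_trans (le_of_eq ?_) hjensen)
        congr 1
        ring
    _ = ∫⁻ z, ENNReal.ofReal (weight Φ θ z) ∂P :=
        ofReal_integral_eq_lintegral_ofReal hwint (ae_of_all _ fun z => weight_nonneg z)
    _ ≤ ∫⁻ z, ENNReal.ofReal (weight Φ θ z)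
          ∂(V ^ N • Measure.pi fun _ : Fin N => (volume : Measure ℂ)) :=
        lintegral_mono' (pi_le_smul_pi hσ) le_rfl
    _ = V ^ N * gibbsZ Φ θ N := by
        rw [lintegral_smul_measure, smul_eq_mul, gibbsZ, volume_pi]

lemma gibbsZ_ne_zero (hP : IsPotential Φ θ c) (N : ℕ) : gibbsZ Φ θ N ≠ 0 := by
  have := isProbabilityMeasure_unifDisc one_pos
  intro h
  have h1 := exp_le_mul_gibbsZ hP (N := N) (unifDisc_le 1) (mutualEnergy_unifDisc_lt_top hP).ne
  rw [h, mul_zero, nonpos_iff_eq_zero, ENNReal.ofReal_eq_zero] at h1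
  exact absurd h1 (not_le.2 (Real.exp_pos _))

lemma isProbabilityMeasure_gibbs (hP : IsPotential Φ θ c) {N : ℕ} (hN : 2 ≤ N) :
    IsProbabilityMeasure (gibbs Φ θ N) := by
  refine ⟨?_⟩
  rw [gibbs, Measure.smul_apply, withDensity_apply _ .univ, setLIntegral_univ, smul_eq_mul]
  exact ENNReal.inv_mul_cancel (gibbsZ_ne_zero hP N) (gibbsZ_lt_top hP hN).ne

lemma gibbs_apply {N : ℕ} {S : Set (Fin N → ℂ)} (hS : MeasurableSet S) :
    gibbs Φ θ N S = (gibbsZ Φ θ N)⁻¹ * ∫⁻ z in S, ENNReal.ofReal (weight Φ θ z) := by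
  rw [gibbs, Measure.smul_apply, withDensity_apply _ hS, smul_eq_mul]

/-! ### Concentration of the empirical measure -/

/-- The empirical measure of a configuration. -/
def empirical {N : ℕ} (z : Fin N → ℂ) : Measure ℂ :=
  (N : ℝ≥0∞)⁻¹ • ∑ i, Measure.dirac (z i)

lemma isProbabilityMeasure_empirical {N : ℕ} (hN : 1 ≤ N) (z : Fin N → ℂ) :
    IsProbabilityMeasure (empirical z) := by
  refine ⟨?_⟩
  simp only [empirical, Measure.smul_apply, Measure.finsetSum_apply, measure_univ,
    Finset.sum_const, Finset.card_univ, Fintype.card_fin, nsmul_eq_mul, mul_one, smul_eq_mul]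
  exact ENNReal.inv_mul_cancel (by exact_mod_cast (by omega : N ≠ 0)) (by simp)

lemma lintegral_empirical {N : ℕ} (z : Fin N → ℂ) {f : ℂ → ℝ≥0∞} (hf : Measurable f) :
    ∫⁻ x, f x ∂(empirical z) = (N : ℝ≥0∞)⁻¹ * ∑ i, f (z i) := by
  rw [empirical, lintegral_smul_measure, lintegral_finsetSum_measure, smul_eq_mul]
  simp [lintegral_dirac' _ hf]

lemma truncEnergy_empirical (hP : IsPotential Φ θ c) {N : ℕ} (hN : 1 ≤ N) (m : ℕ)
    (z : Fin N → ℂ) :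
    truncEnergy Φ θ c m (empirical z) =
      ENNReal.ofReal (((N : ℝ) ^ 2)⁻¹ * ∑ i, ∑ j, truncKernel Φ θ c m (z i, z j)) := by
  have := isProbabilityMeasure_empirical hN z
  have hm : Measurable fun p => ENNReal.ofReal (truncKernel Φ θ c m p) :=
    (hP.continuous_truncKernel m).measurable.ennreal_ofReal
  have hN0 : (0 : ℝ) < N := by exact_mod_cast hN
  have hinner : ∀ x : ℂ, ∫⁻ y, ENNReal.ofReal (truncKernel Φ θ c m (x, y)) ∂(empirical z) =
      (N : ℝ≥0∞)⁻¹ * ∑ j, ENNReal.ofReal (truncKernel Φ θ c m (x, z j)) := fun x =>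
    lintegral_empirical z (hm.comp (measurable_prodMk_left (x := x)))
  rw [truncEnergy, lintegral_prod _ hm.aemeasurable, lintegral_empirical z hm.lintegral_prod_right']
  simp only [hinner]
  rw [← Finset.mul_sum, ENNReal.ofReal_mul (by positivity), ENNReal.ofReal_inv_of_pos (by positivity),
    ENNReal.ofReal_pow hN0.le, ENNReal.ofReal_natCast, sq, ENNReal.mul_inv (by simp) (by simp),
    mul_assoc, ENNReal.ofReal_sum_of_nonneg fun i _ =>
      Finset.sum_nonneg fun j _ => hP.truncKernel_nonneg _ _]
  congr 2
  refine Finset.sum_congr rfl fun i _ => ?_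
  rw [ENNReal.ofReal_sum_of_nonneg fun j _ => hP.truncKernel_nonneg _ _]

lemma measurable_truncEnergy_empirical (hP : IsPotential Φ θ c) {N : ℕ} (hN : 1 ≤ N) (m : ℕ) :
    Measurable fun z : Fin N → ℂ => truncEnergy Φ θ c m (empirical z) := by
  simp only [truncEnergy_empirical hP hN]
  have hm := (hP.continuous_truncKernel m).measurable
  refine Measurable.ennreal_ofReal (measurable_const.mul ?_)
  refine Finset.measurable_fun_sum _ fun i _ => Finset.measurable_fun_sum _ fun j _ => ?_
  exact hm.comp (by fun_prop)

/-- The density `weight` is small at configurations of large truncated energy. -/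
lemma weight_le_of_truncEnergy (hP : IsPotential Φ θ c) {N : ℕ} (hN : 1 ≤ N) (m : ℕ)
    {e : ℝ} (z : Fin N → ℂ) (h : ENNReal.ofReal e ≤ truncEnergy Φ θ c m (empirical z)) :
    weight Φ θ z ≤ Real.exp (-(N ^ 2 * (e - c)) + N * m) := by
  have hN0 : (0 : ℝ) < N := by exact_mod_cast hN
  have hnn : 0 ≤ ((N : ℝ) ^ 2)⁻¹ * ∑ i, ∑ j, truncKernel Φ θ c m (z i, z j) :=
    mul_nonneg (by positivity)
      (Finset.sum_nonneg fun i _ => Finset.sum_nonneg fun j _ => hP.truncKernel_nonneg _ _)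
  rw [truncEnergy_empirical hP hN, ENNReal.ofReal_le_ofReal_iff hnn, inv_mul_eq_div,
    le_div_iff₀ (by positivity)] at h
  -- The truncated energy of the empirical measure includes the diagonal, which the weight omits;
  -- truncation makes its cost N(c + m), of lower order than N².
  have hsplit : ∑ i, ∑ j, truncKernel Φ θ c m (z i, z j) =
      N * (c + m) + ∑ q ∈ (Finset.univ : Finset (Fin N)).offDiag,
        truncKernel Φ θ c m (z q.1, z q.2) := by
    rw [← Finset.sum_product' Finset.univ Finset.univ
      (fun i j => truncKernel Φ θ c m (z i, z j)), ← Finset.diag_union_offDiag,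
      Finset.sum_union (Finset.disjoint_diag_offDiag _), Finset.sum_diag]
    simp only [truncKernel_self, Finset.sum_const, Finset.card_univ, Fintype.card_fin,
      nsmul_eq_mul]
  have hw : weight Φ θ z ≤ Real.exp (∑ q ∈ (Finset.univ : Finset (Fin N)).offDiag,
      (c - truncKernel Φ θ c m (z q.1, z q.2))) := by
    rw [Real.exp_sum]
    refine Finset.prod_le_prod (fun _ _ => EFun_nonneg _ _ _ _) fun q _ => ?_
    rw [truncKernel, sub_sub_cancel, Real.exp_log (lt_max_of_lt_right (Real.exp_pos _))]
    exact le_max_left _ _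
  refine hw.trans (Real.exp_le_exp.2 ?_)
  rw [Finset.sum_sub_distrib]
  simp only [Finset.sum_const, Finset.offDiag_card, Finset.card_univ, Fintype.card_fin,
    nsmul_eq_mul]
  rw [Nat.cast_sub (Nat.le_mul_self N)]
  push_cast
  nlinarith

lemma exists_le_ofReal_exp {x : ℝ≥0∞} (hx : x ≠ ⊤) : ∃ v : ℝ, x ≤ ENNReal.ofReal (Real.exp v) := by
  refine ⟨x.toReal, (ENNReal.ofReal_toReal hx).symm.le.trans (ENNReal.ofReal_le_ofReal ?_)⟩
  linarith [Real.add_one_le_exp x.toReal]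

/-- With overwhelming probability the empirical measure has almost minimal truncated energy. -/
lemma tendsto_gibbs_truncEnergy (hP : IsPotential Φ θ c) (m : ℕ) {δ : ℝ} (hδ : 0 < δ) :
    Tendsto (fun N : ℕ => gibbs Φ θ N {z | minEnergy Φ θ c + ENNReal.ofReal δ <
      truncEnergy Φ θ c m (empirical z)}) atTop (𝓝 0) := by
  obtain ⟨σ₀, hσ₀, hmin⟩ := exists_minimizer hP
  -- The test measure for the lower bound lies within δ/2 of the minimum, which leaves a gap of N²
  -- δ/2 against configurations exceeding it by δ.
  obtain ⟨σ, V, hσ, hV, hle, hen⟩ := exists_smooth hP hσ₀ (half_pos hδ)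
  rw [hmin] at hen
  have hj := (minEnergy_lt_top hP).ne
  set j := (minEnergy Φ θ c).toReal with hjdef
  have hj0 : 0 ≤ j := ENNReal.toReal_nonneg
  have hfin : mutualEnergy Φ θ c σ σ ≠ ⊤ := ne_top_of_le_ne_top (by finiteness) hen
  have hJ : (mutualEnergy Φ θ c σ σ).toReal ≤ j + δ / 2 := by
    refine (ENNReal.toReal_mono (by finiteness) hen).trans_eq ?_
    rw [ENNReal.toReal_add hj ENNReal.ofReal_ne_top, ENNReal.toReal_ofReal (by positivity)]
  obtain ⟨v, hv⟩ := exists_le_ofReal_exp hV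
  obtain ⟨d, hd⟩ := exists_le_ofReal_exp (tailMass_lt_top hP).ne
  -- Collects the errors of order N: N² - N in place of N², the lost power s, the truncated diagonal
  -- (with room), the density bound V and the tail mass.
  set C : ℝ := |j + δ / 2 - c| + |j + δ - c| + 2 * m + v + d with hC
  have hbound : ∀ N : ℕ, 2 ≤ N → gibbs Φ θ N {z | minEnergy Φ θ c + ENNReal.ofReal δ <
      truncEnergy Φ θ c m (empirical z)} ≤
        ENNReal.ofReal (Real.exp (N * (C - N * (δ / 2)))) := by
    intro N hN
    have hN' : (2 : ℝ) ≤ N := by exact_mod_cast hN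
    have hS : MeasurableSet {z : Fin N → ℂ | minEnergy Φ θ c + ENNReal.ofReal δ <
        truncEnergy Φ θ c m (empirical z)} :=
      measurableSet_lt measurable_const (measurable_truncEnergy_empirical hP (by omega) m)
    set S := {z : Fin N → ℂ | minEnergy Φ θ c + ENNReal.ofReal δ <
        truncEnergy Φ θ c m (empirical z)}
    set X : ℝ := -((N : ℝ) ^ 2 * (j + δ - c)) + N * m with hX
    set s : ℝ := 1 / (2 * ((N : ℝ) - 1)) with hs
    have hsmall : ∀ z ∈ S, weight Φ θ z ≤ Real.exp X := by
      intro z hz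
      refine weight_le_of_truncEnergy hP (by omega) m z (le_trans (le_of_eq ?_) (le_of_lt hz))
      rw [ENNReal.ofReal_add hj0 hδ.le, hjdef, ENNReal.ofReal_toReal hj]
    have hup := setLIntegral_weight_le hP hN (Real.exp_pos X).le hS hsmall
    have hlow := exp_le_mul_gibbsZ hP (N := N) hle hfin
    rw [← Real.exp_mul] at hup
    have hup2 : ∫⁻ z in S, ENNReal.ofReal (weight Φ θ z) ≤
        ENNReal.ofReal (Real.exp (X * (1 - s) + N * d)) := by
      refine hup.trans ?_
      rw [Real.exp_add, ENNReal.ofReal_mul (Real.exp_pos _).le, Real.exp_nat_mul,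
        ENNReal.ofReal_pow (Real.exp_pos _).le]
      gcongr
    have hlow2 : ENNReal.ofReal (Real.exp (-((N * N - N : ℕ) * (j + δ / 2 - c)) - N * v)) ≤
        gibbsZ Φ θ N := by
      have h1 : ENNReal.ofReal (Real.exp (-((N * N - N : ℕ) * (j + δ / 2 - c)))) ≤
          ENNReal.ofReal (Real.exp (N * v)) * gibbsZ Φ θ N := by
        refine (ENNReal.ofReal_le_ofReal (Real.exp_le_exp.2 ?_)).trans (hlow.trans ?_)
        · gcongr
        · rw [Real.exp_nat_mul, ENNReal.ofReal_pow (Real.exp_pos _).le]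
          gcongr
      rw [Real.exp_sub, ENNReal.ofReal_div_of_pos (Real.exp_pos _)]
      refine ENNReal.div_le_of_le_mul ?_
      exact h1.trans_eq (mul_comm _ _)
    rw [gibbs_apply hS, mul_comm, ← div_eq_mul_inv]
    refine ENNReal.div_le_of_le_mul (hup2.trans ?_)
    refine le_trans ?_ (mul_le_mul_right hlow2 _)
    rw [← ENNReal.ofReal_mul (Real.exp_pos _).le, ← Real.exp_add]
    refine ENNReal.ofReal_le_ofReal (Real.exp_le_exp.2 ?_)
    have hs0 : 0 ≤ s := by rw [hs]; apply one_div_nonneg.2; linarith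
    -- Here N ≥ 2 is used; it makes the lost factor exp(-Xs) only exponential in N although X is of
    -- order N².
    have hsN : s * N ≤ 1 := by
      rw [hs, one_div_mul_eq_div, div_le_one (by linarith)]
      linarith
    have hXs : -(X * s) ≤ N * |j + δ - c| := by
      have h1 : -(X * s) = s * N * (N * (j + δ - c) - m) := by rw [hX]; ring
      rw [h1]
      have h2 : N * (j + δ - c) - m ≤ N * |j + δ - c| := by
        have := mul_le_mul_of_nonneg_left (le_abs_self (j + δ - c)) (by linarith : (0 : ℝ) ≤ N)
        linarith [m.cast_nonneg (α := ℝ)]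
      calc s * N * (N * (j + δ - c) - m) ≤ s * N * (N * |j + δ - c|) := by
            gcongr
        _ ≤ 1 * (N * |j + δ - c|) := by gcongr
        _ = _ := one_mul _
    rw [Nat.cast_sub (Nat.le_mul_self N)]
    push_cast
    have h3 : -((N : ℝ) * |j + δ / 2 - c|) ≤ N * (j + δ / 2 - c) := by
      have := mul_le_mul_of_nonneg_left (neg_abs_le (j + δ / 2 - c)) (by linarith : (0 : ℝ) ≤ N)
      linarith
    have h4 : X * (1 - s) = X - X * s := by ring
    have h5 : (0 : ℝ) ≤ N * m := by positivity
    rw [h4, hC]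
    have h6 : X = -((N : ℝ) ^ 2 * (j + δ - c)) + N * m := hX
    nlinarith
  have hlim : Tendsto (fun N : ℕ => ENNReal.ofReal (Real.exp (N * (C - N * (δ / 2)))))
      atTop (𝓝 0) := by
    have h1 : Tendsto (fun N : ℕ => (N : ℝ) * (C - N * (δ / 2))) atTop atBot := by
      refine Tendsto.atTop_mul_atBot₀ tendsto_natCast_atTop_atTop ?_
      refine tendsto_atBot_add_const_left _ C (?_ : Tendsto (fun N : ℕ => -(N * (δ / 2) : ℝ)) _ _)
      exact tendsto_neg_atTop_atBot.comp
        (tendsto_natCast_atTop_atTop.atTop_mul_const (half_pos hδ))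
    have h2 := ENNReal.tendsto_ofReal (Real.tendsto_exp_atBot.comp h1)
    simpa using h2
  refine tendsto_of_tendsto_of_tendsto_of_le_of_le' tendsto_const_nhds hlim
    (Eventually.of_forall fun _ => zero_le) ?_
  filter_upwards [eventually_ge_atTop 2] with N hN using hbound N hN

/-! ### Exchangeability and marginals -/

lemma measurePreserving_comp_perm {N : ℕ} (π : Equiv.Perm (Fin N)) :
    MeasurePreserving (fun z : Fin N → ℂ => z ∘ π) := by
  refine ⟨by fun_prop, ?_⟩
  rw [volume_pi]
  symm
  refine Measure.pi_eq fun s hs => ?_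
  rw [Measure.map_apply (by fun_prop) (.univ_pi hs)]
  have : (fun z : Fin N → ℂ => z ∘ π) ⁻¹' (Set.univ.pi s) =
      Set.univ.pi fun i => s (π.symm i) := by
    ext z
    simp only [Set.mem_preimage, Set.mem_univ_pi, Function.comp_apply]
    exact ⟨fun h i => by simpa using h (π.symm i), fun h i => by simpa using h (π i)⟩
  rw [this, Measure.pi_pi]
  exact Fintype.prod_equiv π.symm _ _ fun i => rfl

lemma weight_comp_perm {N : ℕ} (π : Equiv.Perm (Fin N)) (z : Fin N → ℂ) :
    weight Φ θ (z ∘ π) = weight Φ θ z :=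
  Finset.prod_equiv (Equiv.prodCongr π π) (fun p => by simp) fun p _ => rfl

lemma map_gibbs_perm (hP : IsPotential Φ θ c) {N : ℕ} (π : Equiv.Perm (Fin N)) :
    (gibbs Φ θ N).map (fun z => z ∘ π) = gibbs Φ θ N := by
  have hmeas : Measurable fun z : Fin N → ℂ => z ∘ π := by fun_prop
  ext S hS
  rw [Measure.map_apply hmeas hS, gibbs_apply (hmeas hS), gibbs_apply hS,
    ← (measurePreserving_comp_perm π).setLIntegral_comp_preimage hS
      (measurable_ofReal_weight hP N)]
  simp only [weight_comp_perm]

lemma exists_perm_comp_eq {n N : ℕ} {ι κ : Fin n → Fin N} (hι : Function.Injective ι)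
    (hκ : Function.Injective κ) : ∃ π : Equiv.Perm (Fin N), π ∘ ι = κ := by
  have := Equiv.Perm.isMultiplyPretransitive (Fin N) n
  obtain ⟨π, hπ⟩ := MulAction.exists_smul_eq (Equiv.Perm (Fin N)) (⟨ι, hι⟩ : Fin n ↪ Fin N) ⟨κ, hκ⟩
  exact ⟨π, funext fun i => DFunLike.congr_fun hπ i⟩

/-- Permutations act transitively on injective n-tuples of indices and preserve the Gibbs measure,
so all choices of n distinct coordinates have the same law. -/
lemma map_gibbs_comp_eq (hP : IsPotential Φ θ c) {n N : ℕ} {ι κ : Fin n → Fin N}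
    (hι : Function.Injective ι) (hκ : Function.Injective κ) :
    (gibbs Φ θ N).map (fun z => z ∘ ι) = (gibbs Φ θ N).map (fun z => z ∘ κ) := by
  obtain ⟨π, rfl⟩ := exists_perm_comp_eq hι hκ
  nth_rewrite 1 [← map_gibbs_perm hP π]
  rw [Measure.map_map (by fun_prop) (by fun_prop)]
  rfl

/-! ### Marginals as images of the Gibbs measure. -/

lemma sigmaFinite_muMeasure (β : ℝ) (Φ : ℂ → ℝ) : SigmaFinite (muMeasure β Φ) := by
  unfold muMeasure
  infer_instance

lemma pi_muMeasure (hP : IsPotential Φ θ c) (β : ℝ) (N : ℕ) :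
    Measure.pi (fun _ : Fin N => muMeasure β Φ) = (volume : Measure (Fin N → ℂ)).withDensity
      fun z => ∏ i, ENNReal.ofReal (Real.exp (-β * Φ (z i))) := by
  have := sigmaFinite_muMeasure β Φ
  have hc := hP.continuous
  unfold muMeasure at *
  rw [pi_withDensity volume (by fun_prop), volume_pi]

lemma ofReal_norm_vanDerMonde_sq_mul {N : ℕ} (hN : 1 ≤ N) {τ : ℝ} (hτ : 0 < τ) (z : Fin N → ℂ) :
    (∏ i, ENNReal.ofReal (Real.exp (-(((N : ℝ) - 1) / τ) * Φ (z i)))) *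
      ENNReal.ofReal (‖vanDerMonde z‖ ^ 2) = ENNReal.ofReal (weight Φ (1 / (2 * τ)) z) := by
  rw [weight_eq hN hτ, ENNReal.ofReal_mul (by positivity),
    ENNReal.ofReal_prod_of_nonneg fun i _ => (Real.exp_pos _).le, mul_comm]

lemma measurable_vanDerMonde (N : ℕ) : Measurable (vanDerMonde : (Fin N → ℂ) → ℂ) := by
  have : Continuous (vanDerMonde : (Fin N → ℂ) → ℂ) := by
    unfold vanDerMonde
    fun_prop
  exact this.measurable

lemma lintegral_pi_muMeasure {τ : ℝ} (hP : IsPotential Φ (1 / (2 * τ)) c) {N : ℕ} (hN : 1 ≤ N)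
    (hτ : 0 < τ) {S : Set (Fin N → ℂ)} (hS : MeasurableSet S) :
    ∫⁻ z in S, ENNReal.ofReal (‖vanDerMonde z‖ ^ 2)
      ∂(Measure.pi fun _ : Fin N => muMeasure (((N : ℝ) - 1) / τ) Φ) =
      ∫⁻ z in S, ENNReal.ofReal (weight Φ (1 / (2 * τ)) z) := by
  have hv := measurable_vanDerMonde N
  have hc := hP.continuous
  rw [pi_muMeasure hP, setLIntegral_withDensity_eq_setLIntegral_mul _ (by fun_prop) (by fun_prop) hS]
  simp only [Pi.mul_apply, ofReal_norm_vanDerMonde_sq_mul hN hτ]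

lemma partitionZ_eq {τ : ℝ} (hP : IsPotential Φ (1 / (2 * τ)) c) {N : ℕ} (hN : 1 ≤ N)
    (hτ : 0 < τ) : partitionZ N (((N : ℝ) - 1) / τ) Φ = gibbsZ Φ (1 / (2 * τ)) N := by
  have := lintegral_pi_muMeasure hP hN hτ (S := Set.univ) .univ
  rw [setLIntegral_univ, setLIntegral_univ] at this
  exact this

/-- The marginal distributions are images of the Gibbs measure. -/
lemma marginal_eq_map {τ : ℝ} (hP : IsPotential Φ (1 / (2 * τ)) c) {n N : ℕ} (hN : 1 ≤ N)
    (hn : n ≤ N) (hτ : 0 < τ) :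
    marginal n N (((N : ℝ) - 1) / τ) Φ =
      (gibbs Φ (1 / (2 * τ)) N).map (fun z => z ∘ Fin.castLE hn) := by
  set β := ((N : ℝ) - 1) / τ with hβ
  have hsf := sigmaFinite_muMeasure β Φ
  have hres : Measurable fun z : Fin N → ℂ => z ∘ Fin.castLE hn := by fun_prop
  have hv := measurable_vanDerMonde N
  have hcm : Measurable fun p : (Fin n → ℂ) × (Fin (N - n) → ℂ) =>
      (concat p.1 p.2 : Fin N → ℂ) := by
    refine measurable_pi_lambda _ fun i => ?_
    unfold concat
    split_ifs <;> fun_prop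
  ext S hS
  have hS' := hres hS
  rw [Measure.map_apply hres hS, gibbs_apply hS', marginal, withDensity_apply _ hS,
    ← lintegral_pi_muMeasure hP hN hτ hS', partitionZ_eq hP hN hτ, ← hβ]
  have hF : Measurable fun p : (Fin n → ℂ) × (Fin (N - n) → ℂ) =>
      ENNReal.ofReal (‖vanDerMonde (concat p.1 p.2 : Fin N → ℂ)‖ ^ 2) :=
    ((hv.comp hcm).norm.pow_const 2).ennreal_ofReal
  rw [lintegral_const_mul _ hF.lintegral_prod_right']
  congr 1
  rw [← map_concat_pi hn, setLIntegral_map hS' (by fun_prop) hcm]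
  have hpre : (fun p : (Fin n → ℂ) × (Fin (N - n) → ℂ) => (concat p.1 p.2 : Fin N → ℂ)) ⁻¹'
      ((fun z : Fin N → ℂ => z ∘ Fin.castLE hn) ⁻¹' S) = S ×ˢ Set.univ := by
    ext p
    have : (concat p.1 p.2 : Fin N → ℂ) ∘ Fin.castLE hn = p.1 := by
      ext i
      simp [concat]
    simp [this]
  rw [hpre, ← Measure.prod_restrict, Measure.restrict_univ, lintegral_prod _ hF.aemeasurable]

/-! ### Products of empirical measures -/

/-- Expanding a product of sums runs over all maps of indices, injective or not; only the injective
ones correspond to the marginal. -/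
lemma pi_empirical {n N : ℕ} (hN : 1 ≤ N) (z : Fin N → ℂ) :
    Measure.pi (fun _ : Fin n => empirical z) =
      ((N : ℝ≥0∞) ^ n)⁻¹ • ∑ ι : Fin n → Fin N, Measure.dirac (z ∘ ι) := by
  have := isProbabilityMeasure_empirical hN z
  refine Measure.pi_eq fun s hs => ?_
  have hS : MeasurableSet (Set.univ.pi s) := .univ_pi hs
  have h1 : ∀ ι : Fin n → Fin N, Measure.dirac (z ∘ ι) (Set.univ.pi s) =
      ∏ i, (s i).indicator (1 : ℂ → ℝ≥0∞) (z (ι i)) := by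
    intro ι
    rw [Measure.dirac_apply' _ hS]
    by_cases h : z ∘ ι ∈ Set.univ.pi s
    · rw [Set.indicator_of_mem h]
      symm
      refine Finset.prod_eq_one fun i _ => Set.indicator_of_mem (h i (Set.mem_univ i)) _
    · rw [Set.indicator_of_notMem h]
      simp only [Set.mem_univ_pi, not_forall] at h
      obtain ⟨i, hi⟩ := h
      exact (Finset.prod_eq_zero (Finset.mem_univ i) (Set.indicator_of_notMem hi _)).symm
  have h2 : ∀ i, empirical z (s i) =
      (N : ℝ≥0∞)⁻¹ * ∑ j, (s i).indicator (1 : ℂ → ℝ≥0∞) (z j) := by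
    intro i
    simp only [empirical, Measure.smul_apply, Measure.finsetSum_apply, smul_eq_mul,
      Measure.dirac_apply' _ (hs i)]
  simp only [Measure.smul_apply, Measure.finsetSum_apply, smul_eq_mul, h1, h2]
  rw [Finset.prod_mul_distrib, Finset.prod_univ_sum]
  simp [ENNReal.inv_pow]

lemma integral_pi_empirical {n N : ℕ} (hN : 1 ≤ N) (z : Fin N → ℂ) (f : (Fin n → ℂ) →ᵇ ℂ) :
    ∫ x, f x ∂(Measure.pi fun _ : Fin n => empirical z) =
      ((N : ℂ) ^ n)⁻¹ * ∑ ι : Fin n → Fin N, f (z ∘ ι) := by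
  rw [pi_empirical hN, integral_smul_measure, integral_finsetSum_measure]
  · simp [integral_dirac]
  · exact fun ι _ => integrable_dirac (by finiteness)

/-- Most maps `Fin n → Fin N` are injective. -/
lemma tendsto_card_not_injective (n : ℕ) :
    Tendsto (fun N : ℕ => ((N : ℝ) ^ n)⁻¹ *
      (Finset.univ.filter fun ι : Fin n → Fin N => ¬ Function.Injective ι).card) atTop (𝓝 0) := by
  have hcard : ∀ N : ℕ, ((Finset.univ.filter
      fun ι : Fin n → Fin N => ¬ Function.Injective ι).card : ℝ) =
        (N : ℝ) ^ n - N.descFactorial n := by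
    intro N
    have h1 := Finset.card_filter_add_card_filter_not (s := (Finset.univ : Finset (Fin n → Fin N)))
      (p := fun ι => Function.Injective ι)
    have h2 : (Finset.univ.filter fun ι : Fin n → Fin N => Function.Injective ι).card =
        N.descFactorial n := by
      rw [← Fintype.card_subtype, Fintype.card_congr (Equiv.subtypeInjectiveEquivEmbedding _ _),
        Fintype.card_embedding_eq]
      simp
    rw [h2] at h1
    simp only [Finset.card_univ, Fintype.card_fun, Fintype.card_fin] at h1
    rw [eq_sub_iff_add_eq', ← Nat.cast_add, h1, Nat.cast_pow]
  simp only [hcard]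
  -- Squeeze: the number of injective maps, a falling factorial, is at least (N - n)^n.
  have hlim : Tendsto (fun N : ℕ => 1 - (1 - (n : ℝ) / N) ^ n) atTop (𝓝 0) := by
    have h1 : Tendsto (fun N : ℕ => (n : ℝ) / N) atTop (𝓝 0) :=
      tendsto_const_div_atTop_nhds_zero_nat _
    simpa using (((tendsto_const_nhds (x := (1 : ℝ))).sub h1).pow n).const_sub 1
  refine tendsto_of_tendsto_of_tendsto_of_le_of_le' tendsto_const_nhds hlim ?_ ?_
  · filter_upwards with N
    refine mul_nonneg (by positivity) (sub_nonneg.2 ?_)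
    exact_mod_cast Nat.descFactorial_le_pow N n
  · filter_upwards [eventually_ge_atTop (n + 1)] with N hN
    have hN0 : (0 : ℝ) < N := by exact_mod_cast (by omega : 0 < N)
    have h1 : ((N : ℝ) - n) ^ n ≤ N.descFactorial n := by
      have h2 := Nat.pow_sub_le_descFactorial N n
      have h3 : ((N : ℝ) - n) ^ n ≤ ((N + 1 - n : ℕ) : ℝ) ^ n := by
        rw [Nat.cast_sub (by omega)]
        have : (n : ℝ) ≤ N := by exact_mod_cast (by omega : n ≤ N)
        push_cast
        gcongr
        linarith
      exact h3.trans (by exact_mod_cast h2)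
    have h4 : (1 - (n : ℝ) / N) ^ n = ((N : ℝ) ^ n)⁻¹ * ((N : ℝ) - n) ^ n := by
      rw [one_sub_div hN0.ne', div_pow, div_eq_inv_mul]
    rw [h4, mul_sub, inv_mul_cancel₀ (by positivity)]
    gcongr

/-! ### Limits of the marginal distributions -/

/-- By exchangeability every coordinate has the same law, hence the law given by the mean empirical
measure. -/
lemma gibbs_coord_eq_lintegral (hP : IsPotential Φ θ c) {N : ℕ} (k : Fin N) {s : Set ℂ}
    (hs : MeasurableSet s) :
    gibbs Φ θ N {z | z k ∈ s} = ∫⁻ z, empirical z s ∂(gibbs Φ θ N) := by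
  have hN : N ≠ 0 := fun h => by subst h; exact k.elim0
  have hset : ∀ i : Fin N, MeasurableSet {z : Fin N → ℂ | z i ∈ s} := fun i =>
    measurable_pi_apply i hs
  have heq : ∀ i : Fin N, gibbs Φ θ N {z | z i ∈ s} = gibbs Φ θ N {z | z k ∈ s} := by
    intro i
    nth_rewrite 1 [← map_gibbs_perm hP (Equiv.swap i k)]
    rw [Measure.map_apply (by fun_prop) (hset i)]
    simp
  have h1 : ∀ z : Fin N → ℂ, empirical z s =
      (N : ℝ≥0∞)⁻¹ * ∑ i, {z : Fin N → ℂ | z i ∈ s}.indicator 1 z := by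
    intro z
    simp only [empirical, Measure.smul_apply, Measure.finsetSum_apply, smul_eq_mul,
      Measure.dirac_apply' _ hs]
    rfl
  simp only [h1]
  rw [lintegral_const_mul' _ _ (by simp [hN]), lintegral_finsetSum _ fun i _ =>
    measurable_one.indicator (hset i)]
  simp only [lintegral_indicator_one (hset _), heq, Finset.sum_const, Finset.card_univ,
    Fintype.card_fin, nsmul_eq_mul]
  rw [← mul_assoc, ENNReal.inv_mul_cancel (by simp [hN]) (by simp), one_mul]

lemma measurableSet_truncEnergy_empirical (hP : IsPotential Φ θ c) {N : ℕ} (hN : 1 ≤ N) (m : ℕ)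
    (e : ℝ≥0∞) : MeasurableSet {z : Fin N → ℂ | e < truncEnergy Φ θ c m (empirical z)} :=
  measurableSet_lt measurable_const (measurable_truncEnergy_empirical hP hN m)

/-- Outside the event of large truncated energy the mass off K is uniformly small; on that event it
is at most 1, and the event has vanishing probability. -/
lemma tendsto_lintegral_empirical_compl (hP : IsPotential Φ θ c) {K : Set ℂ}
    (hK : ConfinesKernel Φ θ c K) :
    Tendsto (fun N : ℕ => ∫⁻ z, empirical z Kᶜ ∂(gibbs Φ θ N)) atTop (𝓝 0) := by
  rw [ENNReal.tendsto_nhds_zero]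
  intro ε hε
  wlog hεt : ε ≠ ⊤ generalizing ε
  · filter_upwards [this 1 one_pos (by simp)] with N hN
    rw [not_not.1 hεt]
    exact le_top
  have hη : 0 < ε.toReal / 2 := half_pos (ENNReal.toReal_pos hε.ne' hεt)
  obtain ⟨m, δ, hδ, hm⟩ := exists_measure_compl_le hP hK hη
  filter_upwards [eventually_ge_atTop 2, (ENNReal.tendsto_nhds_zero.1
    (tendsto_gibbs_truncEnergy hP m hδ)) (ENNReal.ofReal (ε.toReal / 2))
      (ENNReal.ofReal_pos.2 hη)] with N hN hsmall
  have := isProbabilityMeasure_gibbs hP hN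
  set S := {z : Fin N → ℂ | minEnergy Φ θ c + ENNReal.ofReal δ <
      truncEnergy Φ θ c m (empirical z)}
  have hS : MeasurableSet S := measurableSet_truncEnergy_empirical hP (by omega) m _
  calc ∫⁻ z, empirical z Kᶜ ∂(gibbs Φ θ N)
      ≤ ∫⁻ z, (ENNReal.ofReal (ε.toReal / 2) + S.indicator 1 z) ∂(gibbs Φ θ N) := by
        refine lintegral_mono fun z => ?_
        have := isProbabilityMeasure_empirical (by omega : 1 ≤ N) z
        by_cases hz : z ∈ S
        · rw [Set.indicator_of_mem hz]
          exact prob_le_one.trans le_add_self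
        · exact (hm _ this (not_lt.1 hz)).trans le_self_add
    _ = ENNReal.ofReal (ε.toReal / 2) + gibbs Φ θ N S := by
        rw [lintegral_add_left measurable_const, lintegral_indicator_one hS]
        simp
    _ ≤ ENNReal.ofReal (ε.toReal / 2) + ENNReal.ofReal (ε.toReal / 2) := by gcongr
    _ = ε := by
        rw [← ENNReal.ofReal_add hη.le hη.le, add_halves, ENNReal.ofReal_toReal hεt]

/-- A union bound over the n coordinates. The size N + n guarantees room for n indices for every N.
-/
lemma tendsto_map_gibbs_pi (hP : IsPotential Φ θ c) {K : Set ℂ} (hK : ConfinesKernel Φ θ c K)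
    {n : ℕ} (ι : ∀ N : ℕ, Fin n → Fin (N + n)) :
    Tendsto (fun N : ℕ => (gibbs Φ θ (N + n)).map (fun z => z ∘ ι N)
      (Set.univ.pi fun _ : Fin n => K)) atTop (𝓝 1) := by
  have hKm := hK.1.measurableSet
  have hbox : MeasurableSet (Set.univ.pi fun _ : Fin n => K) := .univ_pi fun _ => hKm
  have h0 : Tendsto (fun N : ℕ => n * ∫⁻ z, empirical z Kᶜ ∂(gibbs Φ θ (N + n))) atTop (𝓝 0) := by
    have := (tendsto_lintegral_empirical_compl hP hK).comp (tendsto_add_atTop_nat n)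
    simpa using ENNReal.Tendsto.const_mul this (Or.inr (ENNReal.natCast_ne_top n))
  have h1 : Tendsto (fun N : ℕ => 1 - n * ∫⁻ z, empirical z Kᶜ ∂(gibbs Φ θ (N + n)))
      atTop (𝓝 1) := by
    simpa using ENNReal.Tendsto.sub tendsto_const_nhds h0 (Or.inl ENNReal.one_ne_top)
  have hev : ∀ᶠ N : ℕ in atTop, IsProbabilityMeasure ((gibbs Φ θ (N + n)).map
      (fun z => z ∘ ι N)) := by
    filter_upwards [eventually_ge_atTop 2] with N hN
    have := isProbabilityMeasure_gibbs hP (by omega : 2 ≤ N + n)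
    exact Measure.isProbabilityMeasure_map (by fun_prop : Measurable _).aemeasurable
  refine tendsto_of_tendsto_of_tendsto_of_le_of_le' h1 tendsto_const_nhds ?_ ?_
  · filter_upwards [hev] with N hN
    rw [tsub_le_iff_left]
    have h2 : (gibbs Φ θ (N + n)).map (fun z => z ∘ ι N) (Set.univ.pi fun _ : Fin n => K)ᶜ ≤
        n * ∫⁻ z, empirical z Kᶜ ∂(gibbs Φ θ (N + n)) := by
      rw [Measure.map_apply (by fun_prop) hbox.compl]
      calc _ ≤ gibbs Φ θ (N + n) (⋃ i, {z | z (ι N i) ∈ Kᶜ}) := by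
            refine measure_mono fun z hz => ?_
            simpa using hz
        _ ≤ ∑ i : Fin n, gibbs Φ θ (N + n) {z | z (ι N i) ∈ Kᶜ} := measure_iUnion_fintype_le _ _
        _ = _ := by
            simp only [gibbs_coord_eq_lintegral hP _ hKm.compl]
            simp
    calc (1 : ℝ≥0∞) = (gibbs Φ θ (N + n)).map (fun z => z ∘ ι N)
          (Set.univ.pi fun _ : Fin n => K)ᶜ + (gibbs Φ θ (N + n)).map (fun z => z ∘ ι N)
          (Set.univ.pi fun _ : Fin n => K) := by
          rw [add_comm, prob_add_prob_compl hbox]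
      _ ≤ _ := by gcongr
  · filter_upwards [hev] with N hN using prob_le_one

lemma integral_map_gibbs {n N : ℕ} (ι : Fin n → Fin N) (f : (Fin n → ℂ) →ᵇ ℂ) :
    ∫ x, f x ∂((gibbs Φ θ N).map fun z => z ∘ ι) = ∫ z, f (z ∘ ι) ∂(gibbs Φ θ N) :=
  integral_map (by fun_prop : Measurable _).aemeasurable f.continuous.aestronglyMeasurable

lemma integrable_comp_gibbs {n N : ℕ} [IsFiniteMeasure (gibbs Φ θ N)] (ι : Fin n → Fin N)
    (f : (Fin n → ℂ) →ᵇ ℂ) : Integrable (fun z => f (z ∘ ι)) (gibbs Φ θ N) := by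
  refine Integrable.mono' (integrable_const ‖f‖) ?_ (ae_of_all _ fun z => f.norm_coe_le_norm _)
  exact (f.continuous.comp (by fun_prop)).aestronglyMeasurable

/-- Integrals against a marginal are nearly averages of integrals against powers of the empirical
measure. -/
lemma norm_integral_map_gibbs_sub_le (hP : IsPotential Φ θ c) {n N : ℕ} (hN : 2 ≤ N)
    {κ : Fin n → Fin N} (hκ : Function.Injective κ) (f : (Fin n → ℂ) →ᵇ ℂ) :
    ‖∫ x, f x ∂((gibbs Φ θ N).map fun z => z ∘ κ) -
      ∫ z, ∫ x, f x ∂(Measure.pi fun _ : Fin n => empirical z) ∂(gibbs Φ θ N)‖ ≤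
      (((N : ℝ) ^ n)⁻¹ * (Finset.univ.filter
        fun ι : Fin n → Fin N => ¬ Function.Injective ι).card) * (2 * ‖f‖) := by
  have := isProbabilityMeasure_gibbs hP hN
  have hN0 : (N : ℂ) ≠ 0 := by exact_mod_cast (by omega : N ≠ 0)
  set A := ∫ x, f x ∂((gibbs Φ θ N).map fun z => z ∘ κ) with hA
  have h1 : ∫ z, ∫ x, f x ∂(Measure.pi fun _ : Fin n => empirical z) ∂(gibbs Φ θ N) =
      ((N : ℂ) ^ n)⁻¹ * ∑ ι : Fin n → Fin N, ∫ z, f (z ∘ ι) ∂(gibbs Φ θ N) := by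
    simp only [integral_pi_empirical (by omega : 1 ≤ N)]
    rw [integral_const_mul, integral_finsetSum _ fun ι _ => integrable_comp_gibbs ι f]
  have h2 : A = ((N : ℂ) ^ n)⁻¹ * ∑ _ι : Fin n → Fin N, A := by
    simp only [Finset.sum_const, Finset.card_univ, Fintype.card_fun, Fintype.card_fin,
      nsmul_eq_mul, Nat.cast_pow]
    rw [← mul_assoc, inv_mul_cancel₀ (pow_ne_zero _ hN0), one_mul]
  have hle : ∀ ι : Fin n → Fin N, ‖∫ z, f (z ∘ ι) ∂(gibbs Φ θ N)‖ ≤ ‖f‖ := fun ι => by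
    refine (norm_integral_le_of_norm_le_const (C := ‖f‖)
      (ae_of_all _ fun z => f.norm_coe_le_norm _)).trans ?_
    simp
  rw [h1]
  nth_rewrite 1 [h2]
  rw [← mul_sub, ← Finset.sum_sub_distrib, norm_mul, mul_assoc]
  have h3 : ‖((N : ℂ) ^ n)⁻¹‖ = ((N : ℝ) ^ n)⁻¹ := by simp
  rw [h3]
  refine mul_le_mul_of_nonneg_left ?_ (by positivity)
  -- Injective maps contribute 0 by exchangeability; each of the others contributes at most 2‖f‖.
  rw [← Finset.sum_filter_add_sum_filter_not Finset.univ fun ι : Fin n → Fin N =>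
    Function.Injective ι, Finset.sum_eq_zero, zero_add]
  · refine (norm_sum_le _ _).trans ((Finset.sum_le_card_nsmul _ _ (2 * ‖f‖) fun ι _ => ?_).trans ?_)
    · rw [hA, integral_map_gibbs]
      exact (norm_sub_le _ _).trans (by linarith [hle ι, hle κ])
    · rw [nsmul_eq_mul]
  · intro ι hι
    rw [hA, map_gibbs_comp_eq hP hκ (Finset.mem_filter.1 hι).2, integral_map_gibbs, sub_self]

lemma tendsto_integral_empirical (hP : IsPotential Φ θ c) {σ : Measure ℂ}
    [IsProbabilityMeasure σ] (hσ : mutualEnergy Φ θ c σ σ ≤ minEnergy Φ θ c) {n : ℕ}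
    (f : (Fin n → ℂ) →ᵇ ℂ) :
    Tendsto (fun N : ℕ =>
      ∫ z, ∫ x, f x ∂(Measure.pi fun _ : Fin n => empirical z) ∂(gibbs Φ θ N)) atTop
      (𝓝 (∫ x, f x ∂(Measure.pi fun _ : Fin n => σ))) := by
  rw [tendsto_iff_norm_sub_tendsto_zero]
  set L := ∫ x, f x ∂(Measure.pi fun _ : Fin n => σ) with hL
  rw [Metric.tendsto_atTop']
  intro ε hε
  obtain ⟨m, δ, hδ, hm⟩ := exists_norm_integral_sub_lt hP hσ f (half_pos hε)
  -- Chosen so that 2‖f‖r < ε/2; the +1 covers f = 0.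
  set r := ε / (2 * (2 * ‖f‖ + 1)) with hr
  have hf0 := norm_nonneg f
  have hr0 : 0 < r := by positivity
  have hev := (ENNReal.tendsto_nhds_zero.1 (tendsto_gibbs_truncEnergy hP m hδ))
    (ENNReal.ofReal r) (ENNReal.ofReal_pos.2 hr0)
  obtain ⟨N₀, hN₀⟩ := eventually_atTop.1 (hev.and (eventually_ge_atTop 2))
  refine ⟨N₀, fun N hN => ?_⟩
  obtain ⟨hsmall, hN2⟩ := hN₀ N hN.le
  have := isProbabilityMeasure_gibbs hP hN2
  set S := {z : Fin N → ℂ | minEnergy Φ θ c + ENNReal.ofReal δ <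
      truncEnergy Φ θ c m (empirical z)}
  have hS : MeasurableSet S := measurableSet_truncEnergy_empirical hP (by omega) m _
  have hbd : ∀ ν : Measure ℂ, IsProbabilityMeasure ν →
      ‖∫ x, f x ∂(Measure.pi fun _ : Fin n => ν)‖ ≤ ‖f‖ := fun ν hν => by
    refine (norm_integral_le_of_norm_le_const (C := ‖f‖)
      (ae_of_all _ fun z => f.norm_coe_le_norm _)).trans ?_
    simp
  have hint : Integrable (fun z : Fin N → ℂ =>
      ∫ x, f x ∂(Measure.pi fun _ : Fin n => empirical z)) (gibbs Φ θ N) := by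
    simp only [integral_pi_empirical (by omega : 1 ≤ N)]
    exact (integrable_finsetSum _ fun ι _ => integrable_comp_gibbs ι f).const_mul _
  have hsub : ∫ z, ∫ x, f x ∂(Measure.pi fun _ : Fin n => empirical z) ∂(gibbs Φ θ N) - L =
      ∫ z, (∫ x, f x ∂(Measure.pi fun _ : Fin n => empirical z) - L) ∂(gibbs Φ θ N) := by
    rw [integral_sub hint (integrable_const _)]
    simp
  have hindint : Integrable (S.indicator (fun _ => 2 * ‖f‖)) (gibbs Φ θ N) :=
    (integrable_const _).indicator hS
  have hmain : ‖∫ z, ∫ x, f x ∂(Measure.pi fun _ : Fin n => empirical z) ∂(gibbs Φ θ N) - L‖ ≤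
      ε / 2 + 2 * ‖f‖ * r := by
    rw [hsub]
    calc _ ≤ ∫ z, (ε / 2 + S.indicator (fun _ => 2 * ‖f‖) z) ∂(gibbs Φ θ N) := by
          refine norm_integral_le_of_norm_le ((integrable_const _).add hindint)
            (ae_of_all _ fun z => ?_)
          have hp := isProbabilityMeasure_empirical (by omega : 1 ≤ N) z
          by_cases hz : z ∈ S
          · rw [Set.indicator_of_mem hz]
            refine (norm_sub_le _ _).trans ?_
            linarith [hbd _ hp, hbd σ inferInstance]
          · rw [Set.indicator_of_notMem hz, add_zero]
            exact (hm _ hp (not_lt.1 hz)).le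
      _ = ε / 2 + (gibbs Φ θ N).real S * (2 * ‖f‖) := by
          rw [integral_add (integrable_const _) hindint, integral_indicator_const _ hS]
          simp
      _ ≤ ε / 2 + r * (2 * ‖f‖) := by
          gcongr
          exact ENNReal.toReal_le_of_le_ofReal hr0.le hsmall
      _ = _ := by ring
  rw [Real.dist_eq, sub_zero, abs_of_nonneg (norm_nonneg _)]
  refine hmain.trans_lt ?_
  have h2 : 2 * ‖f‖ * r < ε / 2 := by
    rw [hr, ← mul_div_assoc, div_lt_div_iff₀ (by positivity) (by norm_num)]
    nlinarith
  linarith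

/-! ### The weighted energy problem in terms of the shifted kernel -/

lemma coe_sub_add_one_lt_iff {j C k : ℝ≥0∞} (hj : j ≠ ⊤) (hC : C ≠ ⊤) :
    (j : EReal) - (C : EReal) + 1 < (k : EReal) - (C : EReal) ↔ j + 1 < k := by
  lift j to NNReal using hj
  lift C to NNReal using hC
  by_cases hk : k = ⊤
  · subst hk
    refine iff_of_true ?_ (by finiteness)
    have : ((⊤ : ℝ≥0∞) : EReal) - ((C : ℝ≥0∞) : EReal) = ⊤ := rfl
    rw [this]
    exact EReal.coe_lt_top ((j : ℝ) - C + 1)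
  · lift k to NNReal using hk
    have h1 : ((j : ℝ≥0∞) : EReal) - ((C : ℝ≥0∞) : EReal) + 1 = ((j - C + 1 : ℝ) : EReal) := rfl
    have h2 : ((k : ℝ≥0∞) : EReal) - ((C : ℝ≥0∞) : EReal) = ((k - C : ℝ) : EReal) := rfl
    rw [h1, h2, EReal.coe_lt_coe_iff]
    constructor
    · intro h
      have : (j : ℝ) + 1 < k := by linarith
      exact_mod_cast this
    · intro h
      have : (j : ℝ) + 1 < k := by exact_mod_cast h
      linarith

/-- Attainment of the minimum gives the upper bound, so the constant leaves the infimum without any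
continuity of subtraction in `EReal`. -/
lemma kappa_eq (hP : IsPotential Φ θ c) :
    kappa Φ θ = (minEnergy Φ θ c : EReal) - (ENNReal.ofReal c : EReal) := by
  refine le_antisymm ?_ (le_iInf₂ fun σ hσ => ?_)
  · obtain ⟨σ, hσ, hmin⟩ := exists_minimizer hP
    have := hσ.1
    rw [← hmin, ← energy_eq hP]
    exact iInf₂_le σ hσ
  · have := hσ.1
    rw [energy_eq hP]
    exact EReal.sub_le_sub (by exact_mod_cast minEnergy_le hP σ) le_rfl

lemma mutualEnergy_le_of_isExtremalMeasure (hP : IsPotential Φ θ c) {σ : Measure ℂ}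
    (h : IsExtremalMeasure Φ θ σ) : mutualEnergy Φ θ c σ σ ≤ minEnergy Φ θ c := by
  have := h.1.1
  have h2 := h.2
  rw [energy_eq hP, kappa_eq hP] at h2
  have hj := (minEnergy_lt_top hP).ne
  by_contra hlt
  have hlt' : ((minEnergy Φ θ c : ℝ≥0∞) : EReal) < (mutualEnergy Φ θ c σ σ : ℝ≥0∞) := by
    exact_mod_cast not_le.1 hlt
  have h3 : ((minEnergy Φ θ c : ℝ≥0∞) : EReal) - (ENNReal.ofReal c : EReal) <
      (mutualEnergy Φ θ c σ σ : EReal) - (ENNReal.ofReal c : EReal) :=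
    EReal.sub_lt_sub_of_lt_of_le hlt' le_rfl (by simp) (by simp)
  exact absurd h2 h3.ne'

lemma existsUnique_isExtremalMeasure (hP : IsPotential Φ θ c) :
    ∃! σ : Measure ℂ, IsExtremalMeasure Φ θ σ := by
  obtain ⟨σ, hσ, hmin⟩ := exists_minimizer hP
  have := hσ.1
  refine ⟨σ, ⟨hσ, by rw [energy_eq hP, kappa_eq hP, hmin]⟩, fun ν hν => ?_⟩
  have := hν.1.1
  exact minimizer_unique hP (mutualEnergy_le_of_isExtremalMeasure hP hν) hmin.le

lemma isConfining_iff (hP : IsPotential Φ θ c) (K : Set ℂ) :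
    IsConfining Φ θ K ↔ IsCompact K ∧ ∀ p ∉ K ×ˢ K, minEnergy Φ θ c + 1 < kernel Φ θ c p := by
  unfold IsConfining
  simp only [kappa_eq hP, logInvE_eq hP,
    coe_sub_add_one_lt_iff (minEnergy_lt_top hP).ne ENNReal.ofReal_ne_top, Prod.forall]

lemma exists_isConfining (hP : IsPotential Φ θ c) : ∃ K, IsConfining Φ θ K := by
  -- The margin 2 in place of 1 yields the strict inequality.
  obtain ⟨K, hK, h⟩ := exists_compact_le_kernel hP (minEnergy Φ θ c + 2).toReal
  refine ⟨K, (isConfining_iff hP K).2 ⟨hK, fun p hp => lt_of_lt_of_le ?_ (h p hp)⟩⟩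
  have hj := (minEnergy_lt_top hP).ne
  rw [ENNReal.ofReal_toReal (by finiteness)]
  exact (ENNReal.add_lt_add_iff_left hj).2 (by norm_num)

end NormalMatrix

end

/-! ### Assembly of the theorem. -/

theorem mainTheorem1 (Φ : ℂ → ℝ) (hΦ : ContDiff ℝ 2 Φ)
    (hgrowth : NormalMatrix.GrowsFasterThanLog Φ) (τ : ℝ) (hτ : 0 < τ) :
    -- the objects `K` and `σ̂` in the theorem exist, and `σ̂` is unique
    (∃ K : Set ℂ, NormalMatrix.IsConfining Φ (1 / (2 * τ)) K) ∧
    (∃! σ : Measure ℂ, NormalMatrix.IsExtremalMeasure Φ (1 / (2 * τ)) σ) ∧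
    ∀ n : ℕ, 1 ≤ n →
      -- `Π^{(n)}` is a probability measure
      (∀ N : ℕ, 2 ≤ N → n ≤ N →
        NormalMatrix.marginal n N (((N : ℝ) - 1) / τ) Φ Set.univ = 1) ∧
      -- the mass concentrates on `K^n`
      (∀ K : Set ℂ, NormalMatrix.IsConfining Φ (1 / (2 * τ)) K →
        Tendsto (fun N : ℕ => NormalMatrix.marginal n N (((N : ℝ) - 1) / τ) Φ
          (Set.univ.pi fun _ : Fin n => K)) atTop (𝓝 1)) ∧
      -- weak-star convergence to the product of the extremal measure
      (∀ σ : Measure ℂ, NormalMatrix.IsExtremalMeasure Φ (1 / (2 * τ)) σ →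
        ∀ f : (Fin n → ℂ) →ᵇ ℂ,
          Tendsto (fun N : ℕ => ∫ z, f z ∂(NormalMatrix.marginal n N (((N : ℝ) - 1) / τ) Φ))
            atTop (𝓝 (∫ z, f z ∂(Measure.pi fun _ : Fin n => σ)))) := by
  open NormalMatrix in
  obtain ⟨c, hP⟩ := exists_isPotential hΦ.continuous hgrowth (θ := 1 / (2 * τ)) (by positivity)
  refine ⟨exists_isConfining hP, existsUnique_isExtremalMeasure hP, fun n hn => ⟨?_, ?_, ?_⟩⟩
  · intro N hN hnN
    have := isProbabilityMeasure_gibbs hP hN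
    rw [marginal_eq_map hP (by omega) hnN hτ, Measure.map_apply (by fun_prop) .univ,
      Set.preimage_univ, measure_univ]
  · intro K hK
    have hK' : ConfinesKernel Φ (1 / (2 * τ)) c K := by
      have h := (isConfining_iff hP K).1 hK
      exact ⟨h.1, fun p hp => (h.2 p hp).le⟩
    -- Shifting N by n makes n ≤ N automatic, so the marginal is an image of the Gibbs measure at
    -- every index.
    rw [← tendsto_add_atTop_iff_nat n]
    refine (tendsto_map_gibbs_pi hP hK' fun N => Fin.castLE (Nat.le_add_left n N)).congr fun N => ?_
    rw [marginal_eq_map hP (by omega) (Nat.le_add_left n N) hτ]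
  · intro σ hσ f
    have hprob := hσ.1.1
    have h1 := tendsto_integral_empirical hP (mutualEnergy_le_of_isExtremalMeasure hP hσ) f
    have h2 := (tendsto_card_not_injective n).mul_const (2 * ‖f‖)
    rw [zero_mul] at h2
    -- The difference between the marginal and the mean power of the empirical measure is bounded by
    -- the vanishing proportion of non-injective maps.
    have h3 : Tendsto (fun N : ℕ => ∫ z, f z ∂(marginal n N (((N : ℝ) - 1) / τ) Φ) -
        ∫ z, ∫ x, f x ∂(Measure.pi fun _ : Fin n => empirical z) ∂(gibbs Φ (1 / (2 * τ)) N))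
        atTop (𝓝 0) := by
      refine squeeze_zero_norm' ?_ h2
      filter_upwards [eventually_ge_atTop (max 2 n)] with N hN
      have hN2 : 2 ≤ N := (le_max_left _ _).trans hN
      have hnN : n ≤ N := (le_max_right _ _).trans hN
      rw [marginal_eq_map hP (by omega) hnN hτ]
      exact norm_integral_map_gibbs_sub_le hP hN2 (Fin.castLE_injective hnN) f
    simpa using h3.add h1
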